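/- For integers $B$ and $M$, let $\mathcal{F}^{B}_{M}$ be the set of binary quartic forms $f(x,y)=ax^4+Bx^2y^2+cy^4$ with $a,c\in\mathbb{Z}$, $ac=M$ and $0\le \operatorname{ord}_p a\le 1$ for every prime $p$. Write $C_f\colon z^2=f(x,y)$ for the associated curve (in the weighted projective plane $\mathbb{P}(1,1,2)$, so that a point over a field $K$ is given by $x,y,z\in K$ with $(x,y)\neq(0,0)$ and $z^2=f(x,y)$). Let $\mathcal{F}^{B,\mathrm{sol}}_{M}$ be the set of $f\in\mathcal{F}^{B}_{M}$ with $C_f(\mathbb{Q})\neq\emptyset$ (soluble forms), and $\mathcal{F}^{B,\mathrm{ls}}_{M}$ the set of $f\in\mathcal{F}^{B}_{M}$ with $C_f(\mathbb{R})\neq\emptyset$ and $C_f(\mathbb{Q}_p)\neq\emptyset$ for every prime $p$ (locally soluble forms). **Theorem.** $$\lim_{X\to\infty}\frac{\sum_{0<n<X,\ n\text{ squarefree}}\#\mathcal{F}^{6n,\mathrm{sol}}_{n^2}}{\sum_{0<n<X,\ n\text{ squarefree}}\#\mathcal{F}^{6n,\mathrm{ls}}_{n^2}} =\lim_{X\to\infty}\frac{\sum_{0<n<X,\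 n\text{ squarefree}}\#\mathcal{F}^{-6n,\mathrm{sol}}_{n^2}}{\sum_{0<n<X,\ n\text{ squarefree}}\#\mathcal{F}^{-6n,\mathrm{ls}}_{n^2}}=1.$$ -/

import Mathlib

open Filter Topology

/-- An integral binary quartic form `a x⁴ + b x³y + c x²y² + d xy³ + e y⁴`, given by its
coefficients. -/
@[ext]
structure BinaryQuartic where
  a : ℤ
  b : ℤ
  c : ℤ
  d : ℤ
  e : ℤ

namespace BinaryQuartic

/-- The value of the form at a pair `(x, y)` of elements of a field `K`. -/
def eval {K : Type*} [Field K] (f : BinaryQuartic) (x y : K) : K :=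
  (f.a : K) * x ^ 4 + (f.b : K) * x ^ 3 * y + (f.c : K) * x ^ 2 * y ^ 2
    + (f.d : K) * x * y ^ 3 + (f.e : K) * y ^ 4

/-- The curve `C_f : z² = f(x, y)` has a `K`-rational point. The curve lives in the weighted
projective plane `ℙ(1, 1, 2)`; for `x = y = 0` the equation forces `z = 0`, so a point is the
class of a solution with `(x, y) ≠ (0, 0)`. -/
def HasPoint (K : Type*) [Field K] (f : BinaryQuartic) : Prop :=
  ∃ x y z : K, (x ≠ 0 ∨ y ≠ 0) ∧ z ^ 2 = f.eval x y

/-- `C_f(ℚ) ≠ ∅`. -/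
def IsSoluble (f : BinaryQuartic) : Prop := f.HasPoint ℚ

/-- `C_f(ℚ_v) ≠ ∅` for all places `v` of `ℚ`: the real one and the one of each prime `p`. -/
def IsLocallySoluble (f : BinaryQuartic) : Prop :=
  f.HasPoint ℝ ∧ ∀ (p : ℕ) [Fact p.Prime], f.HasPoint ℚ_[p]

/-- `W^B_M(ℤ)`: the integral forms `a x⁴ + B x²y² + c y⁴` with `ac = M`. -/
def W (B M : ℤ) : Set BinaryQuartic :=
  {f | ∃ a c : ℤ, f = ⟨a, 0, B, 0, c⟩ ∧ a * c = M}

/-- `𝓕^B_M`: the forms in `W^B_M(ℤ)` with `0 ≤ ord_p a ≤ 1` for every prime `p`; the lower bound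
is automatic for an integer, and `ord_p 0 = ∞`. -/
def F (B M : ℤ) : Set BinaryQuartic :=
  {f | f ∈ W B M ∧ ∀ p : ℕ, p.Prime → emultiplicity (p : ℤ) f.a ≤ 1}

/-- The soluble forms in `𝓕^B_M`. -/
def Fsol (B M : ℤ) : Set BinaryQuartic := {f | f ∈ F B M ∧ f.IsSoluble}

/-- The locally soluble forms in `𝓕^B_M`. -/
def Fls (B M : ℤ) : Set BinaryQuartic := {f | f ∈ F B M ∧ f.IsLocallySoluble}

/-- For `M ≠ 0` the set `𝓕^B_M` is finite, so `Set.ncard` really counts its subsets. -/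
theorem F_finite (B : ℤ) {M : ℤ} (hM : M ≠ 0) : (F B M).Finite := by
  have h : (Set.Icc (-|M|) |M|).Finite := Set.finite_Icc _ _
  refine ((h.prod h).image (fun q : ℤ × ℤ => (⟨q.1, 0, B, 0, q.2⟩ : BinaryQuartic))).subset ?_
  rintro f ⟨⟨a, c, rfl, hac⟩, -⟩
  have ha : |a| ≤ |M| :=
    Int.le_of_dvd (abs_pos.mpr hM) ((abs_dvd_abs _ _).mpr ⟨c, hac.symm⟩)
  have hc : |c| ≤ |M| :=
    Int.le_of_dvd (abs_pos.mpr hM) ((abs_dvd_abs _ _).mpr ⟨a, by rw [← hac, mul_comm]⟩)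
  exact ⟨(a, c), ⟨abs_le.mp ha, abs_le.mp hc⟩, rfl⟩

end BinaryQuartic

/-- The squarefree integers `n` with `0 < n < X`. -/
noncomputable def sqfreeBelow (X : ℝ) : Finset ℕ :=
  (Finset.range ⌈X⌉₊).filter (fun n => 0 < n ∧ Squarefree n)

theorem mem_sqfreeBelow (X : ℝ) (n : ℕ) :
    n ∈ sqfreeBelow X ↔ (0 < n ∧ (n : ℝ) < X) ∧ Squarefree n := by
  simp only [sqfreeBelow, Finset.mem_filter, Finset.mem_range, Nat.lt_ceil]
  tauto

/-!
Write `n = De` with `a = sD`, `s = ±1`, for the leading coefficient of a form in `𝓕^{6εn}_{n²}`. The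
form is `a (x⁴ + 6 ε s e x² y² + e² y⁴)`. If `a = 1` it has the rational point `(1 : 0 : 1)`, and the
squarefree `n` have positive lower density, so it is enough to show that the locally soluble forms
with `a ≠ 1` and `n ≤ N` number `o(N)`. Solubility at the odd primes dividing `n` gives three
conditions on quadratic residues (`localCond_of_hasPoint`): `2` is a square modulo the primes of
`D`, `sD` modulo those of `e`, and `-εs e` modulo those of `D`. Only upper bounds for the number of
pairs `(D, e)` satisfying these are needed (`sum_localCond_ne_one_le`). With a cutoff `z`, a power
of `2` whose logarithm is of order `(log N)^{1/32}`, there are three ranges.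

* `D ≤ z`: the integer `sD ≠ 1` is not a square, so the `e` all of whose primes have `sD` as a
  residue have density zero. If `g` is their indicator function and `χ` the Jacobi symbol of `sD`,
  then `g * g ≤ 1 * χ`, and the partial sums of `∑ χ(m) / m` are `O(log D)`; this bounds
  `∑ g(m) / m` (`sq_sum_oddRes_inv_le`), and Chebyshev's bound turns the logarithmic mean into a
  natural one (`log_mul_sum_le`). As only upper bounds enter, small values of `L(1, χ)` do no
  harm.
* `e ≤ z`: the same argument with the fixed integer `2` and the variable `D`.
* `D, e > z`: expand the conditions at the primes larger than `z` into Jacobi symbols, which run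
  over factorizations of `D` and `e`. A term in which a symbol pairs two variables larger than `z`
  cancels on average, by Hölder's inequality and the orthogonality of distinct Jacobi symbols
  (`jacobi_bilinear_pow_eight_le`). The remaining terms contribute at most twice the sum of
  `2 ^ (-k)`, where `k` is the number of primes larger than `z` dividing `De`, over the pairs for
  which `2` is a residue modulo the odd primes of `D` (`sum_localCond_le`). The weights and this
  last restriction together save a power of `log N` (`sq_sum_mul_sum_splitWeight_le`).
-/

/-! ### Sums over products and moments of the divisor function -/

theorem sum_eq_sum_divisorsAntidiagonal {R : Type*} [AddCommMonoid R] (s : Finset (ℕ × ℕ)) (X : ℕ)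
    (hs : ∀ q ∈ s, 1 ≤ q.1 * q.2 ∧ q.1 * q.2 ≤ X) (F : ℕ × ℕ → R) :
    ∑ q ∈ s, F q = ∑ n ∈ Finset.Icc 1 X, ∑ q ∈ n.divisorsAntidiagonal with q ∈ s, F q := by
  rw [← Finset.sum_fiberwise_of_maps_to (t := Finset.Icc 1 X) (g := fun q : ℕ × ℕ => q.1 * q.2)
    (fun q hq => Finset.mem_Icc.mpr (hs q hq))]
  refine Finset.sum_congr rfl fun n hn => Finset.sum_congr ?_ fun _ _ => rfl
  ext q
  simp only [Finset.mem_filter, Nat.mem_divisorsAntidiagonal]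
  have := (Finset.mem_Icc.mp hn).1
  constructor
  · rintro ⟨h1, h2⟩; exact ⟨⟨h2, by omega⟩, h1⟩
  · rintro ⟨⟨h1, h2⟩, h3⟩; exact ⟨h3, h1⟩

theorem sum_divisorsAntidiagonal_Icc {R : Type*} [AddCommMonoid R] (X : ℕ) (F : ℕ × ℕ → R) :
    ∑ n ∈ Finset.Icc 1 X, ∑ q ∈ n.divisorsAntidiagonal, F q =
      ∑ a ∈ Finset.Icc 1 X, ∑ b ∈ Finset.Icc 1 (X / a), F (a, b) := by
  have h1 := sum_eq_sum_divisorsAntidiagonal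
    ((Finset.Icc 1 X ×ˢ Finset.Icc 1 X).filter fun q => q.1 * q.2 ≤ X) X (fun q hq => by
      simp only [Finset.mem_filter, Finset.mem_product, Finset.mem_Icc] at hq
      exact ⟨Nat.mul_pos hq.1.1.1 hq.1.2.1, hq.2⟩) F
  have h2 : ∀ n ∈ Finset.Icc 1 X, n.divisorsAntidiagonal.filter (fun q => q ∈
      (Finset.Icc 1 X ×ˢ Finset.Icc 1 X).filter fun q : ℕ × ℕ => q.1 * q.2 ≤ X) =
      n.divisorsAntidiagonal := by
    intro n hn
    rw [Finset.filter_eq_self]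
    intro q hq
    obtain ⟨h3, h4⟩ := Nat.mem_divisorsAntidiagonal.mp hq
    have h5 := (Finset.mem_Icc.mp hn).2
    have ha : q.1 ≠ 0 := by rintro h; simp [h] at h3; omega
    have hb : q.2 ≠ 0 := by rintro h; simp [h] at h3; omega
    have h6 : q.1 ≤ n := h3 ▸ Nat.le_mul_of_pos_right _ (Nat.pos_of_ne_zero hb)
    have h7 : q.2 ≤ n := h3 ▸ Nat.le_mul_of_pos_left _ (Nat.pos_of_ne_zero ha)
    simp only [Finset.mem_filter, Finset.mem_product, Finset.mem_Icc]
    omega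
  replace h1 := h1.trans (Finset.sum_congr rfl fun n hn => by rw [h2 n hn])
  rw [← h1, Finset.sum_filter, Finset.sum_product]
  refine Finset.sum_congr rfl fun a ha => ?_
  rw [← Finset.sum_filter]
  refine Finset.sum_congr ?_ fun _ _ => rfl
  have ha' := (Finset.mem_Icc.mp ha).1
  ext b
  simp only [Finset.mem_filter, Finset.mem_Icc, Nat.le_div_iff_mul_le ha']
  constructor
  · rintro ⟨⟨h1, h2⟩, h3⟩; exact ⟨h1, by linarith [mul_comm a b]⟩
  · rintro ⟨h1, h2⟩
    exact ⟨⟨h1, (Nat.le_mul_of_pos_right b ha').trans h2⟩, by linarith [mul_comm a b]⟩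

/-- Every pair `(a, b)` with `ab ≤ X` is one of the pairs with `a ≤ X` and `b ≤ X`. -/
theorem sum_divisorsAntidiagonal_le (X : ℕ) (F : ℕ × ℕ → ℝ) (hF : ∀ q, 0 ≤ F q) :
    ∑ n ∈ Finset.Icc 1 X, ∑ q ∈ n.divisorsAntidiagonal, F q ≤
      ∑ a ∈ Finset.Icc 1 X, ∑ b ∈ Finset.Icc 1 X, F (a, b) := by
  rw [sum_divisorsAntidiagonal_Icc]
  refine Finset.sum_le_sum fun a _ => Finset.sum_le_sum_of_subset_of_nonneg ?_ fun _ _ _ => hF _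
  exact Finset.Icc_subset_Icc_right (Nat.div_le_self _ _)

theorem sum_mul_sum_le_sum_divisorsAntidiagonal (X : ℕ) (f g : ℕ → ℝ) (hf : ∀ n, 0 ≤ f n)
    (hg : ∀ n, 0 ≤ g n) :
    (∑ a ∈ Finset.Icc 1 X, f a) * ∑ b ∈ Finset.Icc 1 X, g b ≤
      ∑ n ∈ Finset.Icc 1 (X ^ 2), ∑ q ∈ n.divisorsAntidiagonal, f q.1 * g q.2 := by
  rw [Finset.sum_mul_sum, ← Finset.sum_product',
    sum_eq_sum_divisorsAntidiagonal (Finset.Icc 1 X ×ˢ Finset.Icc 1 X) (X ^ 2) (fun q hq => by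
      simp only [Finset.mem_product, Finset.mem_Icc] at hq
      exact ⟨Nat.mul_pos hq.1.1 hq.2.1, by rw [sq]; exact Nat.mul_le_mul hq.1.2 hq.2.2⟩)
      (fun q => f q.1 * g q.2)]
  refine Finset.sum_le_sum fun n _ => Finset.sum_le_sum_of_subset_of_nonneg
    (Finset.filter_subset _ _) fun q _ _ => mul_nonneg (hf _) (hg _)

theorem sum_inv_Icc_le (X : ℕ) : ∑ n ∈ Finset.Icc 1 X, (n : ℝ)⁻¹ ≤ 1 + Real.log X := by
  have h := harmonic_le_one_add_log X
  rw [harmonic_eq_sum_Icc] at h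
  simpa using h

theorem card_divisors_mul_le (a b : ℕ) :
    (a * b).divisors.card ≤ a.divisors.card * b.divisors.card := by
  rw [Nat.divisors_mul]
  exact Finset.card_mul_le

theorem sum_card_divisors_pow_div_le (X j : ℕ) :
    ∑ n ∈ Finset.Icc 1 X, (n.divisors.card : ℝ) ^ j * (n : ℝ)⁻¹ ≤
      (1 + Real.log X) ^ 2 ^ j := by
  induction j with
  | zero => simpa using sum_inv_Icc_le X
  | succ j ih =>
    have h0 : 0 ≤ ∑ n ∈ Finset.Icc 1 X, (n.divisors.card : ℝ) ^ j * (n : ℝ)⁻¹ :=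
      Finset.sum_nonneg fun _ _ => by positivity
    calc ∑ n ∈ Finset.Icc 1 X, (n.divisors.card : ℝ) ^ (j + 1) * (n : ℝ)⁻¹
        = ∑ n ∈ Finset.Icc 1 X, ∑ q ∈ n.divisorsAntidiagonal,
            ((q.1 * q.2).divisors.card : ℝ) ^ j * ((q.1 * q.2 : ℕ) : ℝ)⁻¹ := by
          refine Finset.sum_congr rfl fun n _ => ?_
          rw [Finset.sum_congr rfl (fun q hq => by
            rw [(Nat.mem_divisorsAntidiagonal.mp hq).1]), Finset.sum_const, nsmul_eq_mul]
          have : n.divisorsAntidiagonal.card = n.divisors.card := by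
            rw [← Nat.map_div_right_divisors, Finset.card_map]
          rw [this]; ring
      _ ≤ ∑ a ∈ Finset.Icc 1 X, ∑ b ∈ Finset.Icc 1 X,
            ((a * b).divisors.card : ℝ) ^ j * ((a * b : ℕ) : ℝ)⁻¹ :=
          sum_divisorsAntidiagonal_le X
            (fun q => ((q.1 * q.2).divisors.card : ℝ) ^ j * ((q.1 * q.2 : ℕ) : ℝ)⁻¹)
            fun q => by positivity
      _ ≤ ∑ a ∈ Finset.Icc 1 X, ∑ b ∈ Finset.Icc 1 X,
            ((a.divisors.card : ℝ) ^ j * (a : ℝ)⁻¹) * ((b.divisors.card : ℝ) ^ j * (b : ℝ)⁻¹) := by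
          refine Finset.sum_le_sum fun a _ => Finset.sum_le_sum fun b _ => ?_
          have h : ((a * b).divisors.card : ℝ) ≤ a.divisors.card * b.divisors.card := by
            exact_mod_cast card_divisors_mul_le a b
          calc _ ≤ ((a.divisors.card : ℝ) * b.divisors.card) ^ j * ((a * b : ℕ) : ℝ)⁻¹ := by gcongr
            _ = _ := by push_cast; rw [mul_inv]; ring
      _ = (∑ n ∈ Finset.Icc 1 X, (n.divisors.card : ℝ) ^ j * (n : ℝ)⁻¹) ^ 2 := by
          rw [sq, Finset.sum_mul_sum]
      _ ≤ ((1 + Real.log X) ^ 2 ^ j) ^ 2 := by gcongr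
      _ = _ := by rw [← pow_mul, pow_succ]

theorem sum_card_divisors_pow_le (X j : ℕ) :
    ∑ n ∈ Finset.Icc 1 X, (n.divisors.card : ℝ) ^ j ≤ X * (1 + Real.log X) ^ 2 ^ j := by
  refine le_trans ?_ (mul_le_mul_of_nonneg_left (sum_card_divisors_pow_div_le X j) (by positivity))
  rw [Finset.mul_sum]
  refine Finset.sum_le_sum fun n hn => ?_
  obtain ⟨h1, h2⟩ := Finset.mem_Icc.mp hn
  have h1' : (0 : ℝ) < n := by exact_mod_cast h1
  have h2' : (n : ℝ) ≤ X := by exact_mod_cast h2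
  have : 1 ≤ (X : ℝ) * (n : ℝ)⁻¹ := by
    rw [← div_eq_mul_inv, le_div_iff₀ h1']; linarith
  calc (n.divisors.card : ℝ) ^ j = (n.divisors.card : ℝ) ^ j * 1 := by ring
    _ ≤ (n.divisors.card : ℝ) ^ j * (X * (n : ℝ)⁻¹) := by gcongr
    _ = _ := by ring

/-! ### Bilinear sums of a kernel with small correlations -/

/-- The Dirichlet convolution square of a sequence supported on `[1, N]`. -/
noncomputable def convSq (N : ℕ) (x : ℕ → ℝ) (n : ℕ) : ℝ :=
  ∑ q ∈ n.divisorsAntidiagonal with q ∈ Finset.Icc 1 N ×ˢ Finset.Icc 1 N, x q.1 * x q.2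

theorem sq_sum_eq_sum_convSq (N : ℕ) (x κ : ℕ → ℝ) (hκ : ∀ a b, κ (a * b) = κ a * κ b) :
    (∑ n ∈ Finset.Icc 1 N, x n * κ n) ^ 2 = ∑ n ∈ Finset.Icc 1 (N ^ 2), convSq N x n * κ n := by
  rw [sq, Finset.sum_mul_sum, ← Finset.sum_product',
    sum_eq_sum_divisorsAntidiagonal (Finset.Icc 1 N ×ˢ Finset.Icc 1 N) (N ^ 2) (fun q hq => by
      simp only [Finset.mem_product, Finset.mem_Icc] at hq
      exact ⟨Nat.mul_pos hq.1.1 hq.2.1, by rw [sq]; exact Nat.mul_le_mul hq.1.2 hq.2.2⟩)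
      (fun q => x q.1 * κ q.1 * (x q.2 * κ q.2))]
  refine Finset.sum_congr rfl fun n _ => ?_
  rw [convSq, Finset.sum_mul]
  refine Finset.sum_congr rfl fun q hq => ?_
  rw [← (Nat.mem_divisorsAntidiagonal.mp (Finset.mem_filter.mp hq).1).1, hκ]
  ring

theorem abs_convSq_le (N : ℕ) (x : ℕ → ℝ) (j n : ℕ) (hx : ∀ m, |x m| ≤ (m.divisors.card : ℝ) ^ j) :
    |convSq N x n| ≤ (n.divisors.card : ℝ) ^ (2 * j + 1) := by
  have hcard : n.divisorsAntidiagonal.card = n.divisors.card := by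
    rw [← Nat.map_div_right_divisors, Finset.card_map]
  calc |convSq N x n| ≤ ∑ q ∈ n.divisorsAntidiagonal with q ∈ Finset.Icc 1 N ×ˢ Finset.Icc 1 N,
        |x q.1 * x q.2| := Finset.abs_sum_le_sum_abs _ _
    _ ≤ ∑ q ∈ n.divisorsAntidiagonal, |x q.1 * x q.2| :=
        Finset.sum_le_sum_of_subset_of_nonneg (Finset.filter_subset _ _) fun _ _ _ => abs_nonneg _
    _ ≤ ∑ q ∈ n.divisorsAntidiagonal, (n.divisors.card : ℝ) ^ (2 * j) := by
        refine Finset.sum_le_sum fun q hq => ?_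
        obtain ⟨h1, h2⟩ := Nat.mem_divisorsAntidiagonal.mp hq
        have ha : (q.1.divisors.card : ℝ) ≤ n.divisors.card := by
          exact_mod_cast Finset.card_le_card (Nat.divisors_subset_of_dvd h2 (Dvd.intro _ h1))
        have hb : (q.2.divisors.card : ℝ) ≤ n.divisors.card := by
          exact_mod_cast Finset.card_le_card (Nat.divisors_subset_of_dvd h2 (Dvd.intro_left _ h1))
        rw [abs_mul, two_mul, pow_add]
        have ha' : |x q.1| ≤ (n.divisors.card : ℝ) ^ j := (hx _).trans (by gcongr)
        have hb' : |x q.2| ≤ (n.divisors.card : ℝ) ^ j := (hx _).trans (by gcongr)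
        gcongr
    _ = _ := by rw [Finset.sum_const, hcard, nsmul_eq_mul]; ring

/-- **Bilinear sums.** If `K(m, n)` is bounded by `1` and completely multiplicative in `n`, and the
functions `K(m, ·)` for different `m ≤ M` are almost orthogonal on every initial interval, then the
bilinear sum of `K` over `m ≤ M ≤ N`, `n ≤ N` saves a power of `M` over the trivial bound. Raising
the inner sum to the fourth power turns `n` into a variable of length `N⁴`, long enough for the
almost orthogonality to be effective after an application of the Cauchy-Schwarz inequality. -/
theorem bilinear_pow_eight_le (M N : ℕ) (hMN : M ≤ N) (S : Finset ℕ) (hS : S ⊆ Finset.Icc 1 M)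
    (K : ℕ → ℕ → ℝ) (hK : ∀ m n, |K m n| ≤ 1) (hmul : ∀ m a b, K m (a * b) = K m a * K m b)
    (horth : ∀ m ∈ S, ∀ m' ∈ S, m ≠ m' → ∀ Y : ℕ,
      |∑ n ∈ Finset.Icc 1 Y, K m n * K m' n| ≤ 4 * (M : ℝ) ^ 2)
    (α β : ℕ → ℝ) (hα : ∀ m, |α m| ≤ 1) (hβ : ∀ n, |β n| ≤ 1) :
    (∑ m ∈ S, ∑ n ∈ Finset.Icc 1 N, α m * β n * K m n) ^ 8 ≤
      5 * (M : ℝ) ^ 7 * (N : ℝ) ^ 8 * (1 + 4 * Real.log N) ^ 64 := by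
  set T : ℕ → ℝ := fun m => ∑ n ∈ Finset.Icc 1 N, β n * K m n with hT
  set c : ℕ → ℝ := convSq (N ^ 2) (convSq N β) with hc
  set G : ℕ → ℝ := fun n => ∑ m ∈ S, K m n with hG
  have hcard : (S.card : ℝ) ≤ M := by
    have := Finset.card_le_card hS
    simp at this
    exact_mod_cast this
  have hT4 : ∀ m, T m ^ 4 = ∑ n ∈ Finset.Icc 1 (N ^ 4), c n * K m n := by
    intro m
    have h1 : T m ^ 2 = _ := sq_sum_eq_sum_convSq N β (K m) (hmul m)
    have h2 := sq_sum_eq_sum_convSq (N ^ 2) (convSq N β) (K m) (hmul m)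
    rw [← pow_mul] at h2
    rw [← h2, ← h1]; ring
  have hcn : ∀ n, |c n| ≤ (n.divisors.card : ℝ) ^ 3 := fun n =>
    abs_convSq_le _ _ 1 n fun m => abs_convSq_le N β 0 m fun k => by simpa using hβ k
  -- The diagonal `m = m'` contributes at most `M N⁴` to the second moment of `G`.
  have hG2 : ∑ n ∈ Finset.Icc 1 (N ^ 4), G n ^ 2 ≤ 5 * M * (N : ℝ) ^ 4 := by
    have h1 : ∑ n ∈ Finset.Icc 1 (N ^ 4), G n ^ 2 =
        ∑ m ∈ S, ∑ m' ∈ S, ∑ n ∈ Finset.Icc 1 (N ^ 4), K m n * K m' n := by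
      simp only [hG, sq, Finset.sum_mul_sum]
      rw [Finset.sum_comm]
      exact Finset.sum_congr rfl fun m _ => Finset.sum_comm
    have h2 : ∀ m ∈ S, ∀ m' ∈ S, ∑ n ∈ Finset.Icc 1 (N ^ 4), K m n * K m' n ≤
        (if m = m' then (N : ℝ) ^ 4 else 0) + 4 * (M : ℝ) ^ 2 := by
      intro m hm m' hm'
      split_ifs with h
      · subst h
        have : ∑ n ∈ Finset.Icc 1 (N ^ 4), K m n * K m n ≤
            ∑ n ∈ Finset.Icc 1 (N ^ 4), (1 : ℝ) := Finset.sum_le_sum fun n _ => by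
          have := hK m n
          rw [← abs_mul_abs_self]
          nlinarith [abs_nonneg (K m n)]
        simp at this
        nlinarith [sq_nonneg (M : ℝ)]
      · have := (le_abs_self _).trans (horth m hm m' hm' h (N ^ 4))
        linarith
    have hM4 : (M : ℝ) ^ 3 ≤ (N : ℝ) ^ 3 := by gcongr
    have hN1 : (N : ℝ) ^ 3 ≤ (N : ℝ) ^ 4 := by
      rcases Nat.eq_zero_or_pos N with h | h
      · simp [h]
      · exact pow_le_pow_right₀ (by exact_mod_cast h) (by norm_num)
    calc _ ≤ ∑ m ∈ S, ∑ m' ∈ S, ((if m = m' then (N : ℝ) ^ 4 else 0) + 4 * (M : ℝ) ^ 2) := by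
          rw [h1]
          exact Finset.sum_le_sum fun m hm => Finset.sum_le_sum fun m' hm' => h2 m hm m' hm'
      _ = S.card * (N : ℝ) ^ 4 + S.card * (S.card * (4 * (M : ℝ) ^ 2)) := by
          simp only [Finset.sum_add_distrib, Finset.sum_ite_eq, Finset.sum_const, nsmul_eq_mul]
          congr 1
          rw [Finset.sum_congr rfl (fun m hm => if_pos hm)]
          simp
      _ ≤ M * (N : ℝ) ^ 4 + M * (M * (4 * (M : ℝ) ^ 2)) := by gcongr
      _ = M * (N : ℝ) ^ 4 + 4 * M * (M : ℝ) ^ 3 := by ring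
      _ ≤ M * (N : ℝ) ^ 4 + 4 * M * (N : ℝ) ^ 4 := by gcongr; linarith
      _ = _ := by ring
  have hc2 : ∑ n ∈ Finset.Icc 1 (N ^ 4), c n ^ 2 ≤
      (N : ℝ) ^ 4 * (1 + 4 * Real.log N) ^ 64 := by
    calc _ ≤ ∑ n ∈ Finset.Icc 1 (N ^ 4), (n.divisors.card : ℝ) ^ 6 := by
          refine Finset.sum_le_sum fun n _ => ?_
          rw [← sq_abs]
          calc |c n| ^ 2 ≤ ((n.divisors.card : ℝ) ^ 3) ^ 2 := by gcongr; exact hcn n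
            _ = _ := by rw [← pow_mul]
      _ ≤ _ := by
          refine (sum_card_divisors_pow_le _ _).trans (le_of_eq ?_)
          push_cast
          rw [Real.log_pow]
          norm_num
  have hTsum : (∑ m ∈ S, T m ^ 4) ^ 2 ≤
      ((N : ℝ) ^ 4 * (1 + 4 * Real.log N) ^ 64) * (5 * M * (N : ℝ) ^ 4) := by
    have h1 : ∑ m ∈ S, T m ^ 4 = ∑ n ∈ Finset.Icc 1 (N ^ 4), c n * G n := by
      simp only [hT4, hG, Finset.mul_sum]
      exact Finset.sum_comm
    rw [h1]
    refine (Finset.sum_mul_sq_le_sq_mul_sq _ _ _).trans ?_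
    exact mul_le_mul hc2 hG2 (Finset.sum_nonneg fun _ _ => sq_nonneg _)
      ((Finset.sum_nonneg fun _ _ => sq_nonneg _).trans hc2)
  have hS1 : (∑ m ∈ S, ∑ n ∈ Finset.Icc 1 N, α m * β n * K m n) = ∑ m ∈ S, α m * T m := by
    refine Finset.sum_congr rfl fun m _ => ?_
    simp only [hT, Finset.mul_sum, mul_assoc]
  have hS2 : (∑ m ∈ S, α m * T m) ^ 2 ≤ M * ∑ m ∈ S, T m ^ 2 := by
    refine (Finset.sum_mul_sq_le_sq_mul_sq _ _ _).trans ?_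
    refine mul_le_mul_of_nonneg_right ?_ (Finset.sum_nonneg fun _ _ => sq_nonneg _)
    calc ∑ m ∈ S, α m ^ 2 ≤ ∑ m ∈ S, (1 : ℝ) := Finset.sum_le_sum fun m _ => by
            rw [← sq_abs]; exact pow_le_one₀ (abs_nonneg _) (hα m)
        _ ≤ M := by simpa using hcard
  have hS3 : (∑ m ∈ S, T m ^ 2) ^ 2 ≤ M * ∑ m ∈ S, T m ^ 4 := by
    refine (sq_sum_le_card_mul_sum_sq).trans ?_
    simp only [← pow_mul]
    exact mul_le_mul_of_nonneg_right hcard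
      (Finset.sum_nonneg fun m _ => (by decide : Even 4).pow_nonneg _)
  rw [hS1]
  have hp2 : 0 ≤ ∑ m ∈ S, T m ^ 2 := Finset.sum_nonneg fun m _ => by positivity
  have hp4 : 0 ≤ ∑ m ∈ S, T m ^ 4 :=
    Finset.sum_nonneg fun m _ => (by decide : Even 4).pow_nonneg _
  calc (∑ m ∈ S, α m * T m) ^ 8 = ((∑ m ∈ S, α m * T m) ^ 2) ^ 4 := by ring
    _ ≤ (M * ∑ m ∈ S, T m ^ 2) ^ 4 := by gcongr
    _ = (M : ℝ) ^ 4 * ((∑ m ∈ S, T m ^ 2) ^ 2) ^ 2 := by ring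
    _ ≤ (M : ℝ) ^ 4 * (M * ∑ m ∈ S, T m ^ 4) ^ 2 := by gcongr
    _ = (M : ℝ) ^ 6 * (∑ m ∈ S, T m ^ 4) ^ 2 := by ring
    _ ≤ (M : ℝ) ^ 6 * (((N : ℝ) ^ 4 * (1 + 4 * Real.log N) ^ 64) * (5 * M * (N : ℝ) ^ 4)) := by
        gcongr
    _ = _ := by ring

/-! ### Jacobi symbols in intervals -/

open scoped NumberTheorySymbols in
/-- Reciprocity and the Chinese remainder theorem give a modulus at which a given non-square
natural number is a non-residue. -/
theorem exists_jacobiSym_eq_neg_one_of_not_isSquare {a : ℕ} (ha : ¬ IsSquare a) :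
    ∃ b : ℕ, b % 4 = 1 ∧ J((a : ℤ) | b) = -1 := by
  have ha0 : a ≠ 0 := by rintro rfl; exact ha ⟨0, rfl⟩
  obtain ⟨u, c, huc, hu⟩ := Nat.sq_mul_squarefree a
  have hc0 : c ≠ 0 := by rintro rfl; simp at huc; exact ha0 huc.symm
  have hu1 : u ≠ 1 := by
    rintro rfl
    exact ha ⟨c, by rw [← huc]; ring⟩
  -- It is enough to make `u` a non-residue modulo some `b` prime to `c`.
  suffices h : ∃ b : ℕ, b % 4 = 1 ∧ Nat.Coprime c b ∧ J((u : ℤ) | b) = -1 by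
    obtain ⟨b, h4, hcb, hb⟩ := h
    refine ⟨b, h4, ?_⟩
    rw [← huc]
    push_cast
    rw [jacobiSym.mul_left, jacobiSym.sq_one' (by simpa using hcb), hb, one_mul]
  have coprime_of : ∀ {p c' j b : ℕ}, c = p ^ j * c' → Nat.Coprime p b → b % c' = 1 % c' →
      Nat.Coprime c b := by
    intro p c' j b h1 h2 h3
    rw [h1]
    refine Nat.Coprime.mul_left (Nat.Coprime.pow_left _ h2) ?_
    rw [Nat.coprime_comm]
    unfold Nat.Coprime
    rw [Nat.gcd_comm, Nat.gcd_rec, h3, ← Nat.gcd_rec, Nat.gcd_one_right]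
  by_cases h2 : ∃ p : ℕ, p.Prime ∧ p ∣ u ∧ p ≠ 2
  · obtain ⟨p, hp, ⟨w, rfl⟩, hp2⟩ := h2
    have := Fact.mk hp
    have hw : Nat.Coprime p w := Nat.coprime_of_squarefree_mul hu
    obtain ⟨j, c', hpc', hcc'⟩ := Nat.exists_eq_pow_mul_and_not_dvd hc0 p hp.ne_one
    have hpodd : Odd p := hp.odd_of_ne_two hp2
    obtain ⟨r, hr⟩ := FiniteField.exists_nonsquare (F := ZMod p) (by rwa [ZMod.ringChar_zmod_n])
    have hcop : Nat.Coprime p (8 * w * c') := by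
      refine Nat.Coprime.mul_right (Nat.Coprime.mul_right ?_ hw) ?_
      · exact Nat.Coprime.pow_right 3 ((Nat.coprime_primes hp Nat.prime_two).mpr hp2)
      · exact (Nat.Prime.coprime_iff_not_dvd hp).mpr hpc'
    obtain ⟨b, hb1, hb2⟩ := Nat.chineseRemainder hcop r.val 1
    have hb8 : b ≡ 1 [MOD 8] := Nat.ModEq.of_dvd ⟨w * c', by ring⟩ hb2
    have hb4 : b % 4 = 1 := by
      have : b % 8 = 1 := hb8
      omega
    have hbr : J((b : ℤ) | p) = -1 := by
      rw [← jacobiSym.legendreSym.to_jacobiSym, legendreSym.eq_neg_one_iff]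
      have : ((b : ℕ) : ZMod p) = r := by
        rw [(ZMod.natCast_eq_natCast_iff _ _ _).mpr hb1, ZMod.natCast_zmod_val]
      rwa [Int.cast_natCast, this]
    refine ⟨b, hb4, coprime_of hcc' ?_ (Nat.ModEq.of_dvd ⟨8 * w, by ring⟩ hb2), ?_⟩
    · by_contra h
      rw [hp.coprime_iff_not_dvd, not_not] at h
      have : J((b : ℤ) | p) = 0 := by
        rw [jacobiSym.eq_zero_iff_not_coprime]
        simpa [Nat.gcd_eq_right h] using hp.ne_one
      omega
    · push_cast
      have hbodd : Odd b := Nat.odd_iff.mpr (by omega)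
      rw [jacobiSym.mul_left, jacobiSym.quadratic_reciprocity_one_mod_four' hpodd hb4, hbr,
        jacobiSym.mod_right' w hbodd]
      have h3 : b % (4 * w) = 1 % (4 * w) := Nat.ModEq.of_dvd ⟨2 * c', by ring⟩ hb2
      have h4 := jacobiSym.mod_right' w odd_one
      rw [h3, ← h4, jacobiSym.one_right]
      norm_num
  · push Not at h2
    have hu2 : u = 2 := by
      have h3 : u ∣ 2 := by
        obtain ⟨p, hp, hpu⟩ := Nat.exists_prime_and_dvd hu1
        have hp2 := h2 p hp hpu
        subst hp2
        obtain ⟨w, rfl⟩ := hpu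
        have hw1 : w = 1 := by
          by_contra hw1
          obtain ⟨q, hq, hqw⟩ := Nat.exists_prime_and_dvd hw1
          have := h2 q hq (hqw.mul_left 2)
          subst this
          exact Nat.prime_two.not_isUnit (hu 2 (mul_dvd_mul_left 2 hqw))
        simp [hw1]
      exact ((Nat.dvd_prime Nat.prime_two).mp h3).resolve_left hu1
    subst hu2
    obtain ⟨j, c', hpc', hcc'⟩ := Nat.exists_eq_pow_mul_and_not_dvd hc0 2 (by norm_num)
    have hcop : Nat.Coprime 8 c' :=
      Nat.Coprime.pow_left 3 ((Nat.Prime.coprime_iff_not_dvd Nat.prime_two).mpr hpc')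
    obtain ⟨b, hb1, hb2⟩ := Nat.chineseRemainder hcop 5 1
    have hb8 : b % 8 = 5 := hb1
    refine ⟨b, by omega, coprime_of hcc' ?_ hb2, ?_⟩
    · rw [Nat.coprime_two_left, Nat.odd_iff]; omega
    · have hbodd : Odd b := Nat.odd_iff.mpr (by omega)
      rw [Nat.cast_ofNat, jacobiSym.at_two hbodd, ZMod.χ₈_nat_mod_eight, hb8]
      decide

open scoped NumberTheorySymbols in
theorem exists_odd_jacobiSym_eq_neg_one {a : ℤ} (ha0 : a ≠ 0) (ha : ¬ IsSquare a) :
    ∃ b : ℕ, Odd b ∧ J(a | b) = -1 := by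
  by_cases h : IsSquare a.natAbs
  · obtain ⟨c, hc⟩ := h
    have hneg : a = -((c : ℤ) ^ 2) := by
      rcases Int.natAbs_eq a with h | h
      · exact absurd ⟨(c : ℤ), by rw [h, hc]; push_cast; ring⟩ ha
      · rw [h, hc]; push_cast; ring
    have hc0 : 0 < c := Nat.pos_of_ne_zero (by rintro rfl; simp at hneg; exact ha0 hneg)
    have hodd : Odd (4 * c - 1) := Nat.odd_iff.mpr (by omega)
    refine ⟨4 * c - 1, hodd, ?_⟩
    have hcop : Nat.Coprime c (4 * c - 1) := by
      have h1 : Nat.gcd c (4 * c - 1) ∣ 1 := by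
        have h2 := (Nat.dvd_sub ((Nat.gcd_dvd_left c (4 * c - 1)).mul_left 4)
          (Nat.gcd_dvd_right c (4 * c - 1)))
        rwa [show 4 * c - (4 * c - 1) = 1 by omega] at h2
      exact Nat.dvd_one.mp h1
    rw [hneg, jacobiSym.neg _ hodd, jacobiSym.sq_one' (by simpa using hcop),
      ZMod.χ₄_nat_three_mod_four (by omega)]
    rfl
  · obtain ⟨b, hb4, hb⟩ := exists_jacobiSym_eq_neg_one_of_not_isSquare h
    have hodd : Odd b := Nat.odd_iff.mpr (by omega)
    refine ⟨b, hodd, ?_⟩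
    rcases Int.natAbs_eq a with h | h
    · rw [h]; exact hb
    · rw [h, jacobiSym.neg _ hodd, hb, ZMod.χ₄_nat_one_mod_four hb4]; rfl

theorem sum_range_natCast_zmod (q : ℕ) [NeZero q] (F : ZMod q → ℝ) :
    ∑ n ∈ Finset.range q, F n = ∑ x, F x := by
  refine Finset.sum_nbij' (fun n => (n : ZMod q)) ZMod.val (by simp)
    (fun x _ => Finset.mem_range.mpr (ZMod.val_lt x)) (fun n hn => ?_) (fun x _ => by simp)
    (by simp)
  exact ZMod.val_cast_of_lt (Finset.mem_range.mp hn)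

theorem abs_sum_range_le_of_sum_eq_zero (q : ℕ) [NeZero q] (F : ZMod q → ℝ)
    (hF : ∀ x, |F x| ≤ 1) (h0 : ∑ x, F x = 0) (Y : ℕ) : |∑ n ∈ Finset.range Y, F n| ≤ q := by
  induction Y using Nat.strong_induction_on with
  | _ Y ih =>
    by_cases h : Y < q
    · calc |∑ n ∈ Finset.range Y, F n| ≤ ∑ n ∈ Finset.range Y, |F n| :=
            Finset.abs_sum_le_sum_abs _ _
        _ ≤ ∑ n ∈ Finset.range Y, (1 : ℝ) := Finset.sum_le_sum fun _ _ => hF _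
        _ = Y := by simp
        _ ≤ q := by exact_mod_cast h.le
    · obtain ⟨Z, rfl⟩ := Nat.exists_eq_add_of_le (not_lt.mp h)
      rw [Finset.sum_range_add, sum_range_natCast_zmod, h0, zero_add]
      simpa using ih Z (by have := NeZero.pos q; omega)

/-- A bounded function on `ℤ/q` that changes sign under multiplication by a unit has bounded sums
over intervals. -/
theorem abs_sum_Icc_le_of_unit (q : ℕ) [NeZero q] (F : ZMod q → ℝ) (hF : ∀ x, |F x| ≤ 1)
    (u : (ZMod q)ˣ) (hu : ∀ x, F (u * x) = -F x) (Y : ℕ) :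
    |∑ n ∈ Finset.Icc 1 Y, F n| ≤ q := by
  have h0 : ∑ x, F x = 0 := by
    have h1 : ∑ x, F (u * x) = ∑ x, F x := Equiv.sum_comp (Units.mulLeft u) F
    simp only [hu, Finset.sum_neg_distrib] at h1
    linarith
  have h2 := abs_sum_range_le_of_sum_eq_zero q (fun x => F (x + 1)) (fun x => hF _)
    (by rw [← h0]; exact Equiv.sum_comp (Equiv.addRight (1 : ZMod q)) F) Y
  rw [Finset.range_eq_Ico] at h2
  have h3 := Finset.sum_Ico_add' (fun n : ℕ => F n) 0 Y 1
  push_cast at h3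
  rwa [h3, Finset.Ico_add_one_right_eq_Icc] at h2

open scoped NumberTheorySymbols in
/-- The Jacobi symbol `(a / n)` as a function of `n`, set to zero at even `n`. -/
noncomputable def oddJacobi (a : ℤ) (n : ℕ) : ℝ := if Odd n then (J(a | n) : ℝ) else 0

open scoped NumberTheorySymbols in
theorem abs_jacobiSym_le_one (a : ℤ) (n : ℕ) : |(J(a | n) : ℝ)| ≤ 1 := by
  rcases jacobiSym.trichotomy a n with h | h | h <;> simp [h]

theorem abs_oddJacobi_le_one (a : ℤ) (n : ℕ) : |oddJacobi a n| ≤ 1 := by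
  unfold oddJacobi
  split_ifs
  · exact abs_jacobiSym_le_one a n
  · simp

theorem oddJacobi_mul_right (a : ℤ) (m n : ℕ) :
    oddJacobi a (m * n) = oddJacobi a m * oddJacobi a n := by
  unfold oddJacobi
  by_cases hm : Odd m <;> by_cases hn : Odd n <;> simp only [Nat.odd_mul, hm, hn, and_self,
    and_true, and_false, if_true, if_false, mul_zero, zero_mul]
  rw [jacobiSym.mul_right' a hm.pos.ne' hn.pos.ne']
  push_cast; rfl

theorem oddJacobi_mul_left (a b : ℤ) (n : ℕ) :
    oddJacobi (a * b) n = oddJacobi a n * oddJacobi b n := by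
  unfold oddJacobi
  split_ifs
  · rw [jacobiSym.mul_left]; push_cast; rfl
  · simp

theorem oddJacobi_mod_right (a : ℤ) (n : ℕ) :
    oddJacobi a (n % (4 * a.natAbs)) = oddJacobi a n := by
  unfold oddJacobi
  have h : Odd (n % (4 * a.natAbs)) ↔ Odd n := by
    rw [Nat.odd_iff, Nat.odd_iff, Nat.mod_mod_of_dvd _ ⟨2 * a.natAbs, by ring⟩]
  simp only [h]
  split_ifs with hn
  · rw [← jacobiSym.mod_right a hn]
  · rfl

theorem abs_sum_oddJacobi_le {a : ℤ} (ha0 : a ≠ 0) (ha : ¬ IsSquare a) (Y : ℕ) :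
    |∑ n ∈ Finset.Icc 1 Y, oddJacobi a n| ≤ 4 * a.natAbs := by
  obtain ⟨b, hbodd, hb⟩ := exists_odd_jacobiSym_eq_neg_one ha0 ha
  have hq : 4 * a.natAbs ≠ 0 := by simpa using ha0
  have : NeZero (4 * a.natAbs) := ⟨hq⟩
  have hcop : Nat.Coprime b (4 * a.natAbs) := by
    refine Nat.Coprime.mul_right ?_ ?_
    · exact Nat.Coprime.pow_right 2 (Nat.coprime_two_right.mpr hbodd)
    · have h1 : jacobiSym a b ≠ 0 := by rw [hb]; norm_num
      have : NeZero b := ⟨hbodd.pos.ne'⟩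
      rw [ne_eq, jacobiSym.eq_zero_iff_not_coprime, not_not] at h1
      rw [Nat.coprime_comm]
      simpa [Int.gcd] using h1
  have key : ∀ n : ℕ, oddJacobi a ((n : ZMod (4 * a.natAbs)).val) = oddJacobi a n := fun n => by
    rw [ZMod.val_natCast, oddJacobi_mod_right a]
  have := abs_sum_Icc_le_of_unit (4 * a.natAbs) (fun x => oddJacobi a x.val)
    (fun x => abs_oddJacobi_le_one _ _) (ZMod.unitOfCoprime b hcop) (fun x => by
      have h1 : ((ZMod.unitOfCoprime b hcop : (ZMod (4 * a.natAbs))ˣ) : ZMod (4 * a.natAbs)) * x =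
          ((b * x.val : ℕ) : ZMod (4 * a.natAbs)) := by simp
      have h2 : oddJacobi a b = -1 := by simp [oddJacobi, hbodd, hb]
      simp only [h1, key, oddJacobi_mul_right, h2]
      ring) Y
  simp only [key] at this
  exact_mod_cast this

open scoped NumberTheorySymbols in
theorem abs_sum_jacobiSym_left_le {q : ℕ} (hq : Odd q) (hsq : ¬ IsSquare q) (Y : ℕ) :
    |∑ n ∈ Finset.Icc 1 Y, (J((n : ℤ) | q) : ℝ)| ≤ q := by
  obtain ⟨b, hb4, hb⟩ := exists_jacobiSym_eq_neg_one_of_not_isSquare hsq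
  rw [jacobiSym.quadratic_reciprocity_one_mod_four' hq hb4] at hb
  have : NeZero q := ⟨hq.pos.ne'⟩
  have hcop : Nat.Coprime b q := by
    have h1 : jacobiSym b q ≠ 0 := by rw [hb]; norm_num
    rw [ne_eq, jacobiSym.eq_zero_iff_not_coprime, not_not] at h1
    simpa using h1
  have key : ∀ n : ℕ, J(((n : ZMod q).val : ℤ) | q) = J((n : ℤ) | q) := fun n => by
    rw [ZMod.val_natCast, jacobiSym.mod_left (n : ℤ)]
    push_cast; rfl
  have := abs_sum_Icc_le_of_unit q (fun x => (J((x.val : ℤ) | q) : ℝ))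
    (fun x => abs_jacobiSym_le_one _ _) (ZMod.unitOfCoprime b hcop) (fun x => by
      have h1 : ((ZMod.unitOfCoprime b hcop : (ZMod q)ˣ) : ZMod q) * x =
          ((b * x.val : ℕ) : ZMod q) := by simp
      simp only [h1, key]
      push_cast
      rw [jacobiSym.mul_left, hb]
      push_cast; ring) Y
  simpa only [key] using this

theorem not_isSquare_mul_of_squarefree {m n : ℕ} (hm : Squarefree m) (hn : Squarefree n)
    (h : m ≠ n) : ¬ IsSquare (m * n) := by
  rintro ⟨r, hr⟩
  have h1 : m ∣ r := (hm.dvd_pow_iff_dvd two_ne_zero).mp ⟨n, by rw [hr]; ring⟩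
  have h2 : n ∣ r := (hn.dvd_pow_iff_dvd two_ne_zero).mp ⟨m, by rw [sq, ← hr]; ring⟩
  have hm0 := Nat.pos_of_ne_zero hm.ne_zero
  have hn0 := Nat.pos_of_ne_zero hn.ne_zero
  have hr0 : 0 < r := Nat.pos_of_ne_zero (by rintro rfl; simp at hr; omega)
  have h3 := Nat.le_of_dvd hr0 h1
  have h4 := Nat.le_of_dvd hr0 h2
  apply h
  nlinarith

/-! ### Bilinear sums of Jacobi symbols -/

open scoped NumberTheorySymbols in
/-- A bilinear sum of Jacobi symbols over a box saves a power of its shorter side. Whichever of the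
two variables is the longer one plays the role of the character variable. -/
theorem jacobi_bilinear_pow_eight_le (M N X : ℕ) (Z : ℝ) (hZ : 0 < Z) (hZM : Z ≤ M) (hZN : Z ≤ N)
    (hMX : M ≤ X) (hNX : N ≤ X) (α β : ℕ → ℝ) (hα : ∀ m, |α m| ≤ 1) (hβ : ∀ n, |β n| ≤ 1)
    (hα' : ∀ m, α m ≠ 0 → Squarefree m) (hβ' : ∀ n, β n ≠ 0 → Odd n ∧ Squarefree n) :
    (∑ m ∈ Finset.Icc 1 M, ∑ n ∈ Finset.Icc 1 N, α m * β n * (J((m : ℤ) | n) : ℝ)) ^ 8 * Z ≤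
      5 * ((M : ℝ) * N) ^ 8 * (1 + 4 * Real.log X) ^ 64 := by
  classical
  have hM0 : (0 : ℝ) < M := hZ.trans_le hZM
  have hN0 : (0 : ℝ) < N := hZ.trans_le hZN
  have hMpos : 0 < M := by exact_mod_cast hM0
  have hNpos : 0 < N := by exact_mod_cast hN0
  rcases le_total M N with h | h
  · set S := (Finset.Icc 1 M).filter Squarefree with hS
    have h1 := bilinear_pow_eight_le M N h S (Finset.filter_subset _ _)
      (fun m n => oddJacobi m n) (fun m n => abs_oddJacobi_le_one _ _)
      (fun m a b => oddJacobi_mul_right _ _ _)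
      (fun m hm m' hm' hne Y => by
        simp only [hS, Finset.mem_filter, Finset.mem_Icc] at hm hm'
        simp only [← oddJacobi_mul_left]
        have h2 : ((m : ℤ) * m') ≠ 0 := by
          have := hm.1.1; have := hm'.1.1; positivity
        have h3 : ¬ IsSquare ((m : ℤ) * m') := by
          have := not_isSquare_mul_of_squarefree hm.2 hm'.2 hne
          rw [← Int.isSquare_natCast_iff] at this
          exact_mod_cast this
        refine (abs_sum_oddJacobi_le h2 h3 Y).trans ?_
        rw [Int.natAbs_mul, Int.natAbs_natCast, Int.natAbs_natCast]
        have h4 : (m : ℝ) ≤ M := by exact_mod_cast hm.1.2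
        have h5 : (m' : ℝ) ≤ M := by exact_mod_cast hm'.1.2
        push_cast
        rw [sq]; gcongr) α β hα hβ
    have h6 : ∑ m ∈ S, ∑ n ∈ Finset.Icc 1 N, α m * β n * oddJacobi m n =
        ∑ m ∈ Finset.Icc 1 M, ∑ n ∈ Finset.Icc 1 N, α m * β n * (J((m : ℤ) | n) : ℝ) := by
      rw [hS, Finset.sum_filter]
      refine Finset.sum_congr rfl fun m _ => ?_
      split_ifs with hm
      · refine Finset.sum_congr rfl fun n _ => ?_
        by_cases hn : β n = 0
        · simp [hn]
        · simp [oddJacobi, (hβ' n hn).1]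
      · have : α m = 0 := by by_contra h; exact hm (hα' m h)
        simp [this]
    rw [← h6]
    have hlog : Real.log N ≤ Real.log X := Real.log_le_log hN0 (by exact_mod_cast hNX)
    have hlog0 : 0 ≤ Real.log N := Real.log_natCast_nonneg N
    calc _ ≤ (5 * (M : ℝ) ^ 7 * (N : ℝ) ^ 8 * (1 + 4 * Real.log N) ^ 64) * M := by gcongr
      _ = 5 * ((M : ℝ) * N) ^ 8 * (1 + 4 * Real.log N) ^ 64 := by ring
      _ ≤ _ := by gcongr
  · set S := (Finset.Icc 1 N).filter (fun n => Odd n ∧ Squarefree n) with hS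
    have h1 := bilinear_pow_eight_le N M h S (Finset.filter_subset _ _)
      (fun n m => (J((m : ℤ) | n) : ℝ)) (fun m n => abs_jacobiSym_le_one _ _)
      (fun m a b => by push_cast; rw [jacobiSym.mul_left]; push_cast; rfl)
      (fun m hm m' hm' hne Y => by
        simp only [hS, Finset.mem_filter, Finset.mem_Icc] at hm hm'
        have h2 : ∀ n : ℕ, (J((n : ℤ) | m) : ℝ) * J((n : ℤ) | m') = J((n : ℤ) | m * m') := by
          intro n
          rw [jacobiSym.mul_right' _ (by omega) (by omega)]; push_cast; rfl
        simp only [h2]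
        refine (abs_sum_jacobiSym_left_le (hm.2.1.mul hm'.2.1)
          (not_isSquare_mul_of_squarefree hm.2.2 hm'.2.2 hne) Y).trans ?_
        have h4 : (m : ℝ) ≤ N := by exact_mod_cast hm.1.2
        have h5 : (m' : ℝ) ≤ N := by exact_mod_cast hm'.1.2
        push_cast
        have : (m : ℝ) * m' ≤ N * N := by gcongr
        nlinarith) β α hβ hα
    have h6 : ∑ n ∈ S, ∑ m ∈ Finset.Icc 1 M, β n * α m * (J((m : ℤ) | n) : ℝ) =
        ∑ m ∈ Finset.Icc 1 M, ∑ n ∈ Finset.Icc 1 N, α m * β n * (J((m : ℤ) | n) : ℝ) := by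
      rw [Finset.sum_comm (s := Finset.Icc 1 M), hS, Finset.sum_filter]
      refine Finset.sum_congr rfl fun n _ => ?_
      split_ifs with hn
      · exact Finset.sum_congr rfl fun m _ => by ring
      · have : β n = 0 := by by_contra h; exact hn (hβ' n h)
        simp [this]
    rw [← h6]
    have hlog : Real.log M ≤ Real.log X := Real.log_le_log hM0 (by exact_mod_cast hMX)
    have hlog0 : 0 ≤ Real.log M := Real.log_natCast_nonneg M
    calc _ ≤ (5 * (N : ℝ) ^ 7 * (M : ℝ) ^ 8 * (1 + 4 * Real.log M) ^ 64) * N := by gcongr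
      _ = 5 * ((M : ℝ) * N) ^ 8 * (1 + 4 * Real.log M) ^ 64 := by ring
      _ ≤ _ := by gcongr

/-! ### Mean values of functions supported on squarefree integers -/

/-- **Mean values from logarithmic mean values.** For a nonnegative function on squarefree integers
that does not grow when a prime factor is added, write `log x = log (x / n) + log n` and expand
`log n` as the sum of `log p` over `p ∣ n`; Chebyshev's bound for `θ` finishes the proof. -/
theorem log_mul_sum_le (f : ℕ → ℝ) (hf : ∀ n, 0 ≤ f n) (hsq : ∀ n, f n ≠ 0 → Squarefree n)
    (hmul : ∀ m p : ℕ, p.Prime → f (m * p) ≤ f m) (x : ℕ) :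
    Real.log x * ∑ n ∈ Finset.Icc 1 x, f n ≤ 3 * x * ∑ n ∈ Finset.Icc 1 x, f n * (n : ℝ)⁻¹ := by
  have h1 : ∑ n ∈ Finset.Icc 1 x, f n * (Real.log x - Real.log n) ≤
      x * ∑ n ∈ Finset.Icc 1 x, f n * (n : ℝ)⁻¹ := by
    rw [Finset.mul_sum]
    refine Finset.sum_le_sum fun n hn => ?_
    obtain ⟨hn1, hn2⟩ := Finset.mem_Icc.mp hn
    have hn0 : (0 : ℝ) < n := by exact_mod_cast hn1
    have hx0 : (0 : ℝ) < x := by exact_mod_cast hn1.trans hn2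
    have : Real.log x - Real.log n ≤ x * (n : ℝ)⁻¹ := by
      rw [← Real.log_div hx0.ne' hn0.ne', ← div_eq_mul_inv]
      exact (Real.log_le_sub_one_of_pos (by positivity)).trans (by linarith)
    calc _ ≤ f n * (x * (n : ℝ)⁻¹) := mul_le_mul_of_nonneg_left this (hf n)
      _ = _ := by ring
  have h2 : ∑ n ∈ Finset.Icc 1 x, f n * Real.log n ≤
      2 * x * ∑ n ∈ Finset.Icc 1 x, f n * (n : ℝ)⁻¹ := by
    have h3 : ∀ n ∈ Finset.Icc 1 x, f n * Real.log n ≤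
        ∑ q ∈ n.divisorsAntidiagonal, if q.2.Prime then f q.1 * Real.log q.2 else 0 := by
      intro n hn
      have hn0 : n ≠ 0 := by have := (Finset.mem_Icc.mp hn).1; omega
      by_cases hfn : f n = 0
      · rw [hfn, zero_mul]
        refine Finset.sum_nonneg fun q _ => ?_
        split_ifs
        · exact mul_nonneg (hf _) (Real.log_natCast_nonneg _)
        · exact le_rfl
      · have hlog : Real.log n = ∑ d ∈ n.divisors, if d.Prime then Real.log d else 0 := by
          rw [← Finset.sum_filter]
          have : n.divisors.filter Nat.Prime = n.primeFactors := by
            ext p; simp [Nat.mem_primeFactors]; tauto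
          rw [this]
          conv_lhs => rw [← Nat.prod_primeFactors_of_squarefree (hsq n hfn)]
          push_cast
          rw [Real.log_prod (fun p hp => by
            have := (Nat.prime_of_mem_primeFactors hp).ne_zero; exact_mod_cast this)]
        rw [hlog, ← Nat.sum_divisorsAntidiagonal' (fun _ d => if d.Prime then Real.log d else 0),
          Finset.mul_sum]
        refine Finset.sum_le_sum fun q hq => ?_
        split_ifs with hp
        · refine mul_le_mul_of_nonneg_right ?_ (Real.log_natCast_nonneg _)
          rw [← (Nat.mem_divisorsAntidiagonal.mp hq).1]
          exact hmul _ _ hp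
        · simp
    refine (Finset.sum_le_sum h3).trans ?_
    rw [sum_divisorsAntidiagonal_Icc x
      (fun q => if q.2.Prime then f q.1 * Real.log q.2 else 0), Finset.mul_sum]
    refine Finset.sum_le_sum fun m hm => ?_
    have hm0 : (0 : ℝ) < m := by exact_mod_cast (Finset.mem_Icc.mp hm).1
    have h4 : ∑ b ∈ Finset.Icc 1 (x / m), (if b.Prime then f m * Real.log b else 0) =
        f m * Chebyshev.theta ((x / m : ℕ) : ℝ) := by
      rw [Chebyshev.theta, Nat.floor_natCast, Finset.sum_filter, Finset.mul_sum]
      refine Finset.sum_congr rfl fun b _ => ?_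
      split_ifs <;> simp
    rw [h4]
    have h5 : Chebyshev.theta ((x / m : ℕ) : ℝ) ≤ 2 * x * (m : ℝ)⁻¹ := by
      refine (Chebyshev.theta_le_log4_mul_x (by positivity)).trans ?_
      have h6 : ((x / m : ℕ) : ℝ) ≤ x / m := Nat.cast_div_le
      have h7 : Real.log 4 ≤ 2 := by
        rw [show (4 : ℝ) = 2 ^ 2 by norm_num, Real.log_pow]
        have := Real.log_two_lt_d9
        push_cast; linarith
      rw [mul_assoc, ← div_eq_mul_inv]
      gcongr
    calc f m * Chebyshev.theta ((x / m : ℕ) : ℝ) ≤ f m * (2 * x * (m : ℝ)⁻¹) :=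
          mul_le_mul_of_nonneg_left h5 (hf m)
      _ = _ := by ring
  have h8 : Real.log x * ∑ n ∈ Finset.Icc 1 x, f n =
      ∑ n ∈ Finset.Icc 1 x, f n * (Real.log x - Real.log n) +
        ∑ n ∈ Finset.Icc 1 x, f n * Real.log n := by
    rw [Finset.mul_sum, ← Finset.sum_add_distrib]
    exact Finset.sum_congr rfl fun n _ => by ring
  rw [h8]
  linarith

/-! ### Integers all of whose odd prime factors split -/

/-- `a` is a nonzero square modulo every odd prime factor of `m`. -/
def OddRes (a : ℤ) (m : ℕ) : Prop := ∀ p : ℕ, p.Prime → p ∣ m → p ≠ 2 → jacobiSym a p = 1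

theorem OddRes.of_dvd {a : ℤ} {m n : ℕ} (h : OddRes a n) (hmn : m ∣ n) : OddRes a m :=
  fun p hp hpm hp2 => h p hp (hpm.trans hmn) hp2

theorem OddRes.mul {a : ℤ} {m n : ℕ} (hm : OddRes a m) (hn : OddRes a n) : OddRes a (m * n) :=
  fun p hp hpm hp2 => (hp.dvd_mul.mp hpm).elim (fun h => hm p hp h hp2) fun h => hn p hp h hp2

theorem OddRes.jacobiSym_eq_one {a : ℤ} {m : ℕ} (h : OddRes a m) (hm : Odd m) :
    jacobiSym a m = 1 := by
  induction m using induction_on_primes with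
  | zero => simp at hm
  | one => simp
  | prime_mul p m hp ih =>
    rw [Nat.odd_mul] at hm
    rw [jacobiSym.mul_right' a hp.ne_zero hm.2.pos.ne', ih (h.of_dvd (Dvd.intro_left _ rfl)) hm.2,
      h p hp (Dvd.intro _ rfl) (by rintro rfl; exact absurd hm.1 (by decide)), one_mul]

/-- `n ↦ oddJacobi a n` as an arithmetic function. -/
noncomputable def oddJacobiFun (a : ℤ) : ArithmeticFunction ℝ := ⟨oddJacobi a, by simp [oddJacobi]⟩

theorem isMultiplicative_oddJacobiFun (a : ℤ) : (oddJacobiFun a).IsMultiplicative :=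
  ⟨by simp [oddJacobiFun, oddJacobi], fun _ => oddJacobi_mul_right a _ _⟩

theorem oddJacobi_pow_right (a : ℤ) (m k : ℕ) : oddJacobi a (m ^ k) = oddJacobi a m ^ k := by
  induction k with
  | zero => simp [oddJacobi]
  | succ k ih => rw [pow_succ, oddJacobi_mul_right, ih, pow_succ]

theorem sum_divisors_oddJacobi_nonneg (a : ℤ) (n : ℕ) : 0 ≤ ∑ d ∈ n.divisors, oddJacobi a d := by
  have key : ∀ n, ((ArithmeticFunction.zeta : ArithmeticFunction ℝ) * oddJacobiFun a) n =
      ∑ d ∈ n.divisors, oddJacobi a d := fun n => ArithmeticFunction.coe_zeta_mul_apply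
  have hm : ((ArithmeticFunction.zeta : ArithmeticFunction ℝ) * oddJacobiFun a).IsMultiplicative :=
    ArithmeticFunction.isMultiplicative_zeta.natCast.mul (isMultiplicative_oddJacobiFun a)
  induction n using Nat.recOnPosPrimePosCoprime with
  | zero => simp
  | one => simp [oddJacobi]
  | prime_pow p k hp hk =>
    rw [Nat.sum_divisors_prime_pow hp]
    simp only [oddJacobi_pow_right]
    have h3 : oddJacobi a p = 0 ∨ oddJacobi a p = 1 ∨ oddJacobi a p = -1 := by
      unfold oddJacobi
      split_ifs
      · exact_mod_cast jacobiSym.trichotomy a p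
      · simp
    rcases h3 with h | h | h
    · rw [h]; exact Finset.sum_nonneg fun _ _ => by positivity
    · rw [h]; exact Finset.sum_nonneg fun _ _ => by positivity
    · rw [h, neg_one_geom_sum]; split_ifs <;> simp
  | coprime m n hm1 hn1 hmn ihm ihn =>
    rw [← key, hm.map_mul_of_coprime hmn, key, key]
    exact mul_nonneg ihm ihn

/-- Partial summation against `1 / n`. -/
theorem abs_sum_Ioc_mul_inv_le (c : ℕ → ℝ) (B : ℝ) (hB : ∀ n, |∑ i ∈ Finset.Icc 1 n, c i| ≤ B)
    {q y : ℕ} (hqy : q ≤ y) :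
    |∑ n ∈ Finset.Ioc q y, c n * (n : ℝ)⁻¹ - (∑ i ∈ Finset.Icc 1 y, c i) * ((y : ℝ) + 1)⁻¹| ≤
      B * (2 * ((q : ℝ) + 1)⁻¹ - ((y : ℝ) + 1)⁻¹) := by
  induction y, hqy using Nat.le_induction with
  | base =>
    have h : (0 : ℝ) ≤ ((q : ℝ) + 1)⁻¹ := by positivity
    simp only [Finset.Ioc_self, Finset.sum_empty, zero_sub, abs_neg, abs_mul, abs_of_nonneg h]
    have := mul_le_mul_of_nonneg_right (hB q) h
    linarith
  | succ y hqy ih =>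
    have h1 : ∑ n ∈ Finset.Ioc q (y + 1), c n * (n : ℝ)⁻¹ =
        ∑ n ∈ Finset.Ioc q y, c n * (n : ℝ)⁻¹ + c (y + 1) * ((y : ℝ) + 1)⁻¹ := by
      rw [Finset.sum_Ioc_succ_top hqy]; push_cast; rfl
    have h2 : ∑ i ∈ Finset.Icc 1 (y + 1), c i = ∑ i ∈ Finset.Icc 1 y, c i + c (y + 1) :=
      Finset.sum_Icc_succ_top (by omega) _
    have h3 : (0 : ℝ) ≤ ((y : ℝ) + 1)⁻¹ - ((y : ℝ) + 1 + 1)⁻¹ := by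
      rw [sub_nonneg]; gcongr; linarith
    have h4 := mul_le_mul_of_nonneg_right (hB (y + 1)) h3
    rw [← abs_of_nonneg h3, ← abs_mul, abs_of_nonneg h3] at h4
    have h5 : ∑ n ∈ Finset.Ioc q (y + 1), c n * (n : ℝ)⁻¹ -
        (∑ i ∈ Finset.Icc 1 (y + 1), c i) * (((y + 1 : ℕ) : ℝ) + 1)⁻¹ =
        (∑ n ∈ Finset.Ioc q y, c n * (n : ℝ)⁻¹ -
          (∑ i ∈ Finset.Icc 1 y, c i) * ((y : ℝ) + 1)⁻¹) +
        (∑ i ∈ Finset.Icc 1 (y + 1), c i) * (((y : ℝ) + 1)⁻¹ - ((y : ℝ) + 1 + 1)⁻¹) := by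
      rw [h1, h2]; push_cast; ring
    rw [h5]
    refine (abs_add_le _ _).trans ((add_le_add ih h4).trans (le_of_eq ?_))
    push_cast; ring

theorem abs_sum_oddJacobi_mul_inv_le {a : ℤ} (ha0 : a ≠ 0) (ha : ¬ IsSquare a) (y : ℕ) :
    |∑ n ∈ Finset.Icc 1 y, oddJacobi a n * (n : ℝ)⁻¹| ≤ 3 + Real.log (4 * a.natAbs) := by
  set q := 4 * a.natAbs with hq
  have hB : ∀ n, |∑ i ∈ Finset.Icc 1 n, oddJacobi a i| ≤ q := fun n => by
    simpa [hq] using abs_sum_oddJacobi_le ha0 ha n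
  have htriv : ∀ y, |∑ n ∈ Finset.Icc 1 y, oddJacobi a n * (n : ℝ)⁻¹| ≤ 1 + Real.log y := by
    intro y
    refine (Finset.abs_sum_le_sum_abs _ _).trans (le_trans ?_ (sum_inv_Icc_le y))
    refine Finset.sum_le_sum fun n _ => ?_
    rw [abs_mul, abs_of_nonneg (by positivity : (0 : ℝ) ≤ (n : ℝ)⁻¹)]
    exact mul_le_of_le_one_left (by positivity) (abs_oddJacobi_le_one _ _)
  have hqr : (4 * (a.natAbs : ℝ)) = (q : ℝ) := by rw [hq]; push_cast; rfl
  rw [hqr]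
  by_cases h : y ≤ q
  · refine (htriv y).trans ?_
    rcases Nat.eq_zero_or_pos y with h0 | h0
    · subst h0
      have := Real.log_natCast_nonneg q
      simp; linarith
    · have := Real.log_le_log (by exact_mod_cast h0 : (0 : ℝ) < y) (by exact_mod_cast h : (y : ℝ) ≤ q)
      linarith
  · have hqy : q ≤ y := by omega
    have h1 := abs_sum_Ioc_mul_inv_le (oddJacobi a) q hB hqy
    have h2 : ∑ n ∈ Finset.Icc 1 y, oddJacobi a n * (n : ℝ)⁻¹ =
        ∑ n ∈ Finset.Icc 1 q, oddJacobi a n * (n : ℝ)⁻¹ +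
          ∑ n ∈ Finset.Ioc q y, oddJacobi a n * (n : ℝ)⁻¹ := by
      have := Finset.sum_Ioc_consecutive (fun n => oddJacobi a n * (n : ℝ)⁻¹) (Nat.zero_le q) hqy
      simpa only [← Finset.Icc_add_one_left_eq_Ioc, zero_add] using this.symm
    have h3 : |(∑ i ∈ Finset.Icc 1 y, oddJacobi a i) * ((y : ℝ) + 1)⁻¹| ≤
        q * ((y : ℝ) + 1)⁻¹ := by
      rw [abs_mul, abs_of_nonneg (by positivity : (0 : ℝ) ≤ ((y : ℝ) + 1)⁻¹)]
      exact mul_le_mul_of_nonneg_right (hB y) (by positivity)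
    have h4 : (q : ℝ) * ((q : ℝ) + 1)⁻¹ ≤ 1 := by
      rw [← div_eq_mul_inv, div_le_one (by positivity)]; linarith
    have h5 := htriv q
    rw [h2]
    rw [abs_le] at *
    constructor <;> nlinarith

theorem sum_oddRes_inv_le_two_mul (a : ℤ) (E : ℕ) [DecidablePred (OddRes a)] :
    ∑ m ∈ Finset.Icc 1 E with OddRes a m, (m : ℝ)⁻¹ ≤
      2 * ∑ m ∈ Finset.Icc 1 E with OddRes a m ∧ Odd m, (m : ℝ)⁻¹ := by
  have h1 : ∑ m ∈ Finset.Icc 1 E with OddRes a m, (m : ℝ)⁻¹ =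
      ∑ m ∈ Finset.Icc 1 E with OddRes a m ∧ Odd m, (m : ℝ)⁻¹ +
      ∑ m ∈ Finset.Icc 1 E with OddRes a m ∧ ¬ Odd m, (m : ℝ)⁻¹ := by
    rw [← Finset.filter_filter, ← Finset.filter_filter, Finset.sum_filter_add_sum_filter_not]
  have h2 : ∑ m ∈ Finset.Icc 1 E with OddRes a m ∧ ¬ Odd m, (m : ℝ)⁻¹ ≤
      ∑ m ∈ Finset.Icc 1 E with OddRes a m, ((2 * m : ℕ) : ℝ)⁻¹ := by
    rw [← Finset.sum_image (f := fun m : ℕ => (m : ℝ)⁻¹) (g := fun m => 2 * m)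
      (by intro x _ y _ h; simpa using h)]
    refine Finset.sum_le_sum_of_subset_of_nonneg ?_ fun _ _ _ => by positivity
    intro m hm
    simp only [Finset.mem_filter, Finset.mem_Icc, Nat.not_odd_iff_even] at hm
    obtain ⟨⟨h3, h4⟩, h5, k, rfl⟩ := hm
    refine Finset.mem_image.mpr ⟨k, ?_, by ring⟩
    simp only [Finset.mem_filter, Finset.mem_Icc]
    exact ⟨⟨by omega, by omega⟩, h5.of_dvd ⟨2, by ring⟩⟩
  have h3 : ∑ m ∈ Finset.Icc 1 E with OddRes a m, ((2 * m : ℕ) : ℝ)⁻¹ =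
      2⁻¹ * ∑ m ∈ Finset.Icc 1 E with OddRes a m, (m : ℝ)⁻¹ := by
    rw [Finset.mul_sum]
    exact Finset.sum_congr rfl fun m _ => by push_cast; rw [mul_inv]
  linarith

/-- The logarithmic mean of the integers whose odd prime factors split in the quadratic field of
`√a`: its square is at most a partial sum of the Dirichlet series of `ζ(s) L(s, χ_a)` at `s = 1`,
and an upper bound for `L(1, χ_a)` is all that is needed. -/
theorem sq_sum_oddRes_inv_le {a : ℤ} (ha0 : a ≠ 0) (ha : ¬ IsSquare a) (E : ℕ)
    [DecidablePred (OddRes a)] :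
    (∑ m ∈ Finset.Icc 1 E with OddRes a m, (m : ℝ)⁻¹) ^ 2 ≤
      4 * ((1 + 2 * Real.log E) * (3 + Real.log (4 * a.natAbs))) := by
  set g : ℕ → ℝ := fun m => if OddRes a m ∧ Odd m then (m : ℝ)⁻¹ else 0 with hg
  have hg0 : ∀ m, 0 ≤ g m := fun m => by simp only [hg]; split_ifs <;> positivity
  have h1 := sum_oddRes_inv_le_two_mul a E
  rw [Finset.sum_filter (fun m => OddRes a m ∧ Odd m)] at h1
  have h2 := sum_mul_sum_le_sum_divisorsAntidiagonal E g g hg0 hg0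
  have h3 : ∀ n ∈ Finset.Icc 1 (E ^ 2), ∑ q ∈ n.divisorsAntidiagonal, g q.1 * g q.2 ≤
      ∑ q ∈ n.divisorsAntidiagonal, (q.1 : ℝ)⁻¹ * (oddJacobi a q.2 * (q.2 : ℝ)⁻¹) := by
    intro n hn
    have h4 : ∑ q ∈ n.divisorsAntidiagonal, (q.1 : ℝ)⁻¹ * (oddJacobi a q.2 * (q.2 : ℝ)⁻¹) =
        (∑ d ∈ n.divisors, oddJacobi a d) * (n : ℝ)⁻¹ := by
      rw [← Nat.sum_divisorsAntidiagonal' (fun _ d => oddJacobi a d), Finset.sum_mul]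
      refine Finset.sum_congr rfl fun q hq => ?_
      rw [← (Nat.mem_divisorsAntidiagonal.mp hq).1]
      push_cast; rw [mul_inv]; ring
    by_cases h5 : OddRes a n ∧ Odd n
    · refine Finset.sum_le_sum fun q hq => ?_
      obtain ⟨h6, h7⟩ := Nat.mem_divisorsAntidiagonal.mp hq
      have h8 : Odd q.1 ∧ Odd q.2 := by rw [← Nat.odd_mul, h6]; exact h5.2
      have h9 : OddRes a q.1 := h5.1.of_dvd (Dvd.intro _ h6)
      have h10 : OddRes a q.2 := h5.1.of_dvd (Dvd.intro_left _ h6)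
      simp [hg, h8, h9, h10, oddJacobi, h10.jacobiSym_eq_one h8.2]
    · rw [h4]
      have h6 : ∑ q ∈ n.divisorsAntidiagonal, g q.1 * g q.2 = 0 := by
        refine Finset.sum_eq_zero fun q hq => ?_
        by_contra h7
        simp only [hg, mul_eq_zero, not_or, ite_eq_right_iff, not_forall] at h7
        obtain ⟨⟨h8, -⟩, ⟨h9, -⟩⟩ := h7
        apply h5
        rw [← (Nat.mem_divisorsAntidiagonal.mp hq).1]
        exact ⟨h8.1.mul h9.1, h8.2.mul h9.2⟩
      rw [h6]
      exact mul_nonneg (sum_divisors_oddJacobi_nonneg a n) (by positivity)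
  have h4 := h2.trans (Finset.sum_le_sum h3)
  rw [sum_divisorsAntidiagonal_Icc (E ^ 2)
    (fun q => (q.1 : ℝ)⁻¹ * (oddJacobi a q.2 * (q.2 : ℝ)⁻¹)), ← sq] at h4
  have h5 : ∑ x ∈ Finset.Icc 1 (E ^ 2), ∑ b ∈ Finset.Icc 1 (E ^ 2 / x),
      (x : ℝ)⁻¹ * (oddJacobi a b * (b : ℝ)⁻¹) ≤
      (1 + 2 * Real.log E) * (3 + Real.log (4 * a.natAbs)) := by
    have hpos : 0 ≤ 3 + Real.log (4 * a.natAbs) :=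
      (abs_nonneg _).trans (abs_sum_oddJacobi_mul_inv_le ha0 ha 0)
    calc _ ≤ ∑ x ∈ Finset.Icc 1 (E ^ 2), (x : ℝ)⁻¹ * (3 + Real.log (4 * a.natAbs)) := by
          refine Finset.sum_le_sum fun x _ => ?_
          rw [← Finset.mul_sum]
          exact mul_le_mul_of_nonneg_left
            ((le_abs_self _).trans (abs_sum_oddJacobi_mul_inv_le ha0 ha _)) (by positivity)
      _ = (∑ x ∈ Finset.Icc 1 (E ^ 2), (x : ℝ)⁻¹) * (3 + Real.log (4 * a.natAbs)) := by
          rw [Finset.sum_mul]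
      _ ≤ _ := by
          refine mul_le_mul_of_nonneg_right ((sum_inv_Icc_le _).trans (le_of_eq ?_)) hpos
          push_cast; rw [Real.log_pow]; push_cast; rfl
  have h6 : 0 ≤ ∑ m ∈ Finset.Icc 1 E with OddRes a m, (m : ℝ)⁻¹ :=
    Finset.sum_nonneg fun _ _ => by positivity
  calc _ ≤ (2 * ∑ m ∈ Finset.Icc 1 E, g m) ^ 2 := by gcongr
    _ = 4 * (∑ m ∈ Finset.Icc 1 E, g m) ^ 2 := by ring
    _ ≤ _ := by linarith

/-! ### Squarefree smooth integers -/

theorem sum_prime_inv_block_le (k : ℕ) (hk : 1 ≤ k) :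
    ∑ p ∈ (Finset.Ioc (2 ^ k) (2 ^ (k + 1)) : Finset ℕ) with p.Prime, (p : ℝ)⁻¹ ≤ 4 * (k : ℝ)⁻¹ := by
  have hl2 : 0 < Real.log 2 := Real.log_pos (by norm_num)
  have hk0 : (0 : ℝ) < k := by exact_mod_cast hk
  have h1 : ∀ p ∈ (Finset.Ioc (2 ^ k) (2 ^ (k + 1)) : Finset ℕ),
      (p : ℝ)⁻¹ ≤ Real.log p * ((2 : ℝ) ^ k * (k * Real.log 2))⁻¹ := by
    intro p hp
    have hp1 : (2 : ℝ) ^ k ≤ p := by exact_mod_cast (Finset.mem_Ioc.mp hp).1.le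
    have hp0 : (0 : ℝ) < p := lt_of_lt_of_le (by positivity) hp1
    have hlog : k * Real.log 2 ≤ Real.log p := by
      rw [← Real.log_pow]; exact Real.log_le_log (by positivity) hp1
    rw [mul_inv]
    calc (p : ℝ)⁻¹ ≤ ((2 : ℝ) ^ k)⁻¹ := by gcongr
      _ = ((2 : ℝ) ^ k)⁻¹ * 1 := by ring
      _ ≤ ((2 : ℝ) ^ k)⁻¹ * (Real.log p * (k * Real.log 2)⁻¹) := by
          gcongr
          rw [← div_eq_mul_inv, le_div_iff₀ (by positivity)]; linarith
      _ = _ := by ring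
  calc _ ≤ ∑ p ∈ (Finset.Ioc (2 ^ k) (2 ^ (k + 1)) : Finset ℕ) with p.Prime,
        Real.log p * ((2 : ℝ) ^ k * (k * Real.log 2))⁻¹ :=
        Finset.sum_le_sum fun p hp => h1 p (Finset.mem_filter.mp hp).1
    _ = (∑ p ∈ (Finset.Ioc (2 ^ k) (2 ^ (k + 1)) : Finset ℕ) with p.Prime, Real.log p) *
        ((2 : ℝ) ^ k * (k * Real.log 2))⁻¹ := by rw [Finset.sum_mul]
    _ ≤ Chebyshev.theta ((2 ^ (k + 1) : ℕ) : ℝ) * ((2 : ℝ) ^ k * (k * Real.log 2))⁻¹ := by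
        gcongr
        rw [Chebyshev.theta, Nat.floor_natCast]
        refine Finset.sum_le_sum_of_subset_of_nonneg ?_ fun p _ _ => Real.log_natCast_nonneg p
        exact Finset.filter_subset_filter _ (Finset.Ioc_subset_Ioc_left (Nat.zero_le _))
    _ ≤ (Real.log 4 * ((2 ^ (k + 1) : ℕ) : ℝ)) * ((2 : ℝ) ^ k * (k * Real.log 2))⁻¹ := by
        gcongr
        exact Chebyshev.theta_le_log4_mul_x (by positivity)
    _ = 4 * (k : ℝ)⁻¹ := by
        rw [show (4 : ℝ) = 2 ^ 2 by norm_num, Real.log_pow]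
        push_cast
        field_simp
        ring

theorem sum_prime_inv_le (k : ℕ) :
    ∑ p ∈ (Finset.Ioc 0 (2 ^ (k + 1)) : Finset ℕ) with p.Prime, (p : ℝ)⁻¹ ≤
      1 + 4 * ∑ i ∈ Finset.Icc 1 k, (i : ℝ)⁻¹ := by
  induction k with
  | zero =>
    have : (Finset.Ioc 0 (2 ^ (0 + 1))).filter Nat.Prime = {2} := by decide
    rw [this]; norm_num
  | succ k ih =>
    have h1 := sum_prime_inv_block_le (k + 1) (by omega)
    rw [Finset.sum_Icc_succ_top (by omega)]
    rw [Finset.sum_filter] at *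
    rw [← Finset.sum_Ioc_consecutive _ (Nat.zero_le (2 ^ (k + 1)))
      (Nat.pow_le_pow_right (by norm_num) (by omega) : 2 ^ (k + 1) ≤ 2 ^ (k + 1 + 1))]
    linarith

/-- `n ↦ 1 / n` as an arithmetic function. -/
noncomputable def invFun : ArithmeticFunction ℝ := ⟨fun n => (n : ℝ)⁻¹, by simp⟩

theorem isMultiplicative_invFun : invFun.IsMultiplicative :=
  ⟨by simp [invFun], fun {m n} _ => by simp [invFun, mul_comm]⟩

/-- The squarefree integers composed of primes up to `2 ^ k` have a reciprocal sum bounded by a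
power of `k`. -/
theorem sum_divisors_primorial_inv_le (k : ℕ) (hk : 1 ≤ k) :
    ∑ u ∈ (primorial (2 ^ k)).divisors, (u : ℝ)⁻¹ ≤ Real.exp 5 * (k : ℝ) ^ 4 := by
  obtain ⟨j, rfl⟩ := Nat.exists_eq_add_of_le' hk
  have h1 := isMultiplicative_invFun.prodPrimeFactors_one_add_of_squarefree (squarefree_primorial (2 ^ (j + 1)))
  simp only [invFun, ArithmeticFunction.coe_mk] at h1
  rw [← h1]
  have h2 : (primorial (2 ^ (j + 1))).primeFactors =
      (Finset.Ioc 0 (2 ^ (j + 1))).filter Nat.Prime := by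
    ext p
    simp only [Nat.mem_primeFactors, Finset.mem_filter, Finset.mem_Ioc]
    constructor
    · rintro ⟨hp, h, -⟩; exact ⟨⟨hp.pos, hp.dvd_primorial_iff.mp h⟩, hp⟩
    · rintro ⟨⟨-, h⟩, hp⟩; exact ⟨hp, hp.dvd_primorial_iff.mpr h, primorial_ne_zero _⟩
  rw [h2]
  calc _ ≤ ∏ p ∈ (Finset.Ioc 0 (2 ^ (j + 1)) : Finset ℕ) with p.Prime, Real.exp ((p : ℝ)⁻¹) :=
        Finset.prod_le_prod (fun _ _ => by positivity) fun p _ => by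
          have := Real.add_one_le_exp ((p : ℝ)⁻¹); linarith
    _ = Real.exp (∑ p ∈ (Finset.Ioc 0 (2 ^ (j + 1)) : Finset ℕ) with p.Prime, (p : ℝ)⁻¹) :=
        (Real.exp_sum _ _).symm
    _ ≤ Real.exp (5 + 4 * Real.log ((j + 1 : ℕ) : ℝ)) := by
        refine Real.exp_le_exp.mpr ?_
        have h3 := sum_prime_inv_le j
        have h4 := sum_inv_Icc_le j
        have h5 : Real.log j ≤ Real.log ((j + 1 : ℕ) : ℝ) := by
          rcases Nat.eq_zero_or_pos j with h | h
          · simp [h]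
          · exact Real.log_le_log (by exact_mod_cast h) (by push_cast; linarith)
        linarith
    _ = _ := by
        rw [Real.exp_add, mul_comm 4, Real.exp_mul, Real.exp_log (by positivity)]
        norm_cast

/-! ### Weights that detect large prime factors -/

/-- The weight `2 ^ (-#{p ∣ n : p ∤ P})`. -/
noncomputable def roughWeight (P n : ℕ) : ℝ := (2 ^ (n.primeFactors.filter (¬ · ∣ P)).card)⁻¹

theorem roughWeight_nonneg (P n : ℕ) : 0 ≤ roughWeight P n := by unfold roughWeight; positivity

theorem roughWeight_le_one (P n : ℕ) : roughWeight P n ≤ 1 :=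
  inv_le_one_of_one_le₀ (one_le_pow₀ (by norm_num))

theorem roughWeight_anti (P : ℕ) {m n : ℕ} (hn : n ≠ 0) (hmn : m ∣ n) :
    roughWeight P n ≤ roughWeight P m := by
  unfold roughWeight
  gcongr
  · norm_num
  · exact Nat.primeFactors_mono hmn hn

theorem roughWeight_mul_le (P : ℕ) {m n : ℕ} (hm : m ≠ 0) (hn : n ≠ 0) :
    roughWeight P m * roughWeight P n ≤ roughWeight P (m * n) := by
  unfold roughWeight
  rw [← mul_inv, ← pow_add, Nat.primeFactors_mul hm hn, Finset.filter_union]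
  gcongr
  · norm_num
  · exact Finset.card_union_le _ _

open Classical in
/-- The function `n ↦ 2 ^ (-#{p ∣ n : p ∤ P})` on the squarefree integers whose odd prime factors
split in the quadratic field of `√a` (for `a = 1`: on all squarefree integers). -/
noncomputable def splitWeight (P : ℕ) (a : ℤ) (n : ℕ) : ℝ :=
  if Squarefree n ∧ OddRes a n then roughWeight P n else 0

theorem splitWeight_nonneg (P : ℕ) (a : ℤ) (n : ℕ) : 0 ≤ splitWeight P a n := by
  unfold splitWeight; split_ifs; exacts [roughWeight_nonneg _ _, le_rfl]

theorem log_mul_sum_splitWeight_le (P : ℕ) (a : ℤ) (x : ℕ) :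
    Real.log x * ∑ n ∈ Finset.Icc 1 x, splitWeight P a n ≤
      3 * x * ∑ n ∈ Finset.Icc 1 x, splitWeight P a n * (n : ℝ)⁻¹ := by
  refine log_mul_sum_le _ (splitWeight_nonneg P a) (fun n hn => ?_) (fun m p hp => ?_) x
  · unfold splitWeight at hn
    by_contra h
    exact hn (if_neg fun h' => h h'.1)
  · unfold splitWeight
    by_cases h : Squarefree (m * p) ∧ OddRes a (m * p)
    · rw [if_pos h, if_pos ⟨h.1.of_mul_left, h.2.of_dvd (Dvd.intro _ rfl)⟩]
      exact roughWeight_anti P h.1.ne_zero (Dvd.intro _ rfl)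
    · rw [if_neg h]
      split_ifs
      exacts [roughWeight_nonneg _ _, le_rfl]

theorem card_filter_squarefree_divisors {n : ℕ} (hn : n ≠ 0) :
    (n.divisors.filter Squarefree).card = 2 ^ n.primeFactors.card := by
  have := Nat.sum_divisors_filter_squarefree hn (f := fun _ => (1 : ℕ))
  simp only [Finset.sum_const, smul_eq_mul, mul_one, Finset.card_powerset] at this
  rw [this]
  congr 2
  ext p
  simp only [Multiset.mem_toFinset]
  rw [UniqueFactorizationMonoid.mem_normalizedFactors_iff hn, Nat.mem_primeFactors,
    ← Nat.prime_iff]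
  tauto

theorem two_pow_card_mul_roughWeight {P n : ℕ} (hP : Squarefree P) (hn : n ≠ 0) :
    2 ^ n.primeFactors.card * roughWeight P n = (n.divisors.filter (· ∣ P)).card := by
  have h1 : n.divisors.filter (· ∣ P) = (Nat.gcd n P).divisors.filter Squarefree := by
    ext d
    simp only [Finset.mem_filter, Nat.mem_divisors, Nat.dvd_gcd_iff]
    constructor
    · rintro ⟨⟨h, -⟩, h'⟩
      exact ⟨⟨⟨h, h'⟩, Nat.gcd_ne_zero_left hn⟩, hP.squarefree_of_dvd h'⟩
    · rintro ⟨⟨⟨h, h'⟩, -⟩, -⟩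
      exact ⟨⟨h, hn⟩, h'⟩
  have h2 : (Nat.gcd n P).primeFactors = n.primeFactors.filter (· ∣ P) := by
    ext p
    simp only [Nat.mem_primeFactors, Finset.mem_filter, Nat.dvd_gcd_iff]
    constructor
    · rintro ⟨hp, h, -⟩; exact ⟨⟨hp, h.1, hn⟩, h.2⟩
    · rintro ⟨⟨hp, h, -⟩, h'⟩; exact ⟨hp, ⟨h, h'⟩, Nat.gcd_ne_zero_left hn⟩
  rw [h1, card_filter_squarefree_divisors (Nat.gcd_ne_zero_left hn), h2, roughWeight,
    ← Finset.card_filter_add_card_filter_not (s := n.primeFactors) (· ∣ P), pow_add]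
  push_cast
  field_simp

/-- The convolution square of `splitWeight` is dominated by a convolution of the indicator of the
divisors of `P` with the indicator of the integers with split odd prime factors. -/
theorem sq_sum_splitWeight_le {P : ℕ} (hP : Squarefree P) (a : ℤ) (E : ℕ)
    [DecidablePred (OddRes a)] :
    (∑ n ∈ Finset.Icc 1 E, splitWeight P a n * (n : ℝ)⁻¹) ^ 2 ≤
      (∑ u ∈ P.divisors, (u : ℝ)⁻¹) *
        ∑ v ∈ Finset.Icc 1 (E ^ 2) with OddRes a v, (v : ℝ)⁻¹ := by
  classical
  set g : ℕ → ℝ := fun n => splitWeight P a n * (n : ℝ)⁻¹ with hg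
  have hg0 : ∀ n, 0 ≤ g n := fun n => mul_nonneg (splitWeight_nonneg _ _ _) (by positivity)
  set F : ℕ × ℕ → ℝ := fun q =>
    if q.1 ∣ P ∧ OddRes a q.2 then (q.1 : ℝ)⁻¹ * (q.2 : ℝ)⁻¹ else 0 with hF
  have hF0 : ∀ q, 0 ≤ F q := fun q => by simp only [hF]; split_ifs <;> positivity
  have h1 : ∀ n ∈ Finset.Icc 1 (E ^ 2), ∑ q ∈ n.divisorsAntidiagonal, g q.1 * g q.2 ≤
      ∑ q ∈ n.divisorsAntidiagonal, F q := by
    intro n hn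
    have hn0 : n ≠ 0 := by have := (Finset.mem_Icc.mp hn).1; omega
    by_cases hres : OddRes a n
    · have h2 : ∀ q ∈ n.divisorsAntidiagonal, g q.1 * g q.2 ≤
          if Squarefree q.1 then roughWeight P n * (n : ℝ)⁻¹ else 0 := by
        intro q hq
        obtain ⟨h3, -⟩ := Nat.mem_divisorsAntidiagonal.mp hq
        have hq1 : q.1 ≠ 0 := by rintro h; simp [h] at h3; omega
        have hq2 : q.2 ≠ 0 := by rintro h; simp [h] at h3; omega
        have h4 := roughWeight_nonneg P q.1
        have h5 := roughWeight_nonneg P q.2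
        have h6 : splitWeight P a q.2 ≤ roughWeight P q.2 := by
          unfold splitWeight; split_ifs; exacts [le_rfl, h5]
        split_ifs with hs
        · have h7 : splitWeight P a q.1 ≤ roughWeight P q.1 := by
            unfold splitWeight; split_ifs; exacts [le_rfl, h4]
          have h8 := roughWeight_mul_le P hq1 hq2
          rw [h3] at h8
          calc g q.1 * g q.2 = (splitWeight P a q.1 * splitWeight P a q.2) * (n : ℝ)⁻¹ := by
                simp only [hg]; rw [← h3]; push_cast; rw [mul_inv]; ring
            _ ≤ roughWeight P n * (n : ℝ)⁻¹ := by
                refine mul_le_mul_of_nonneg_right (le_trans ?_ h8) (by positivity)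
                exact mul_le_mul h7 h6 (splitWeight_nonneg _ _ _) h4
        · simp [hg, splitWeight, hs]
      have h9 : ∑ q ∈ n.divisorsAntidiagonal, F q =
          ((n.divisors.filter (· ∣ P)).card : ℝ) * (n : ℝ)⁻¹ := by
        rw [Finset.card_filter]
        push_cast
        rw [← Nat.sum_divisorsAntidiagonal (fun d _ => if d ∣ P then (1 : ℝ) else 0),
          Finset.sum_mul]
        refine Finset.sum_congr rfl fun q hq => ?_
        obtain ⟨h3, -⟩ := Nat.mem_divisorsAntidiagonal.mp hq
        have : OddRes a q.2 := hres.of_dvd (Dvd.intro_left _ h3)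
        simp only [hF, this, and_true]
        split_ifs
        · rw [← h3]; push_cast; rw [mul_inv]; ring
        · simp
      refine (Finset.sum_le_sum h2).trans (le_of_eq ?_)
      rw [h9, ← two_pow_card_mul_roughWeight hP hn0,
        Nat.sum_divisorsAntidiagonal
          (fun d _ => if Squarefree d then roughWeight P n * (n : ℝ)⁻¹ else 0),
        ← Finset.sum_filter, Finset.sum_const, card_filter_squarefree_divisors hn0, nsmul_eq_mul]
      push_cast; ring
    · have h2 : ∑ q ∈ n.divisorsAntidiagonal, g q.1 * g q.2 = 0 := by
        refine Finset.sum_eq_zero fun q hq => ?_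
        by_contra h
        have h3 : OddRes a q.1 := by
          by_contra h'; simp [hg, splitWeight, h'] at h
        have h4 : OddRes a q.2 := by
          by_contra h'; simp [hg, splitWeight, h'] at h
        exact hres ((Nat.mem_divisorsAntidiagonal.mp hq).1 ▸ h3.mul h4)
      rw [h2]
      exact Finset.sum_nonneg fun q _ => hF0 q
  calc _ = (∑ n ∈ Finset.Icc 1 E, g n) * ∑ n ∈ Finset.Icc 1 E, g n := sq _
    _ ≤ _ := sum_mul_sum_le_sum_divisorsAntidiagonal E g g hg0 hg0
    _ ≤ _ := Finset.sum_le_sum h1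
    _ ≤ ∑ u ∈ Finset.Icc 1 (E ^ 2), ∑ v ∈ Finset.Icc 1 (E ^ 2), F (u, v) :=
        sum_divisorsAntidiagonal_le _ F hF0
    _ = (∑ u ∈ Finset.Icc 1 (E ^ 2) with u ∣ P, (u : ℝ)⁻¹) *
        ∑ v ∈ Finset.Icc 1 (E ^ 2) with OddRes a v, (v : ℝ)⁻¹ := by
        rw [Finset.sum_filter, Finset.sum_filter, Finset.sum_mul_sum]
        refine Finset.sum_congr rfl fun u _ => Finset.sum_congr rfl fun v _ => ?_
        simp only [hF]
        by_cases h1 : u ∣ P <;> by_cases h2 : OddRes a v <;> simp [h1, h2]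
    _ ≤ _ := by
        refine mul_le_mul_of_nonneg_right ?_ (Finset.sum_nonneg fun _ _ => by positivity)
        refine Finset.sum_le_sum_of_subset_of_nonneg ?_ fun _ _ _ => by positivity
        intro u hu
        exact Nat.mem_divisors.mpr ⟨(Finset.mem_filter.mp hu).2, hP.ne_zero⟩

/-! ### Detecting residue conditions at the large primes by characters -/

/-- The Jacobi symbol `(a / n)` restricted to `n` coprime to `P`, as an arithmetic function. -/
noncomputable def roughJacobi (P : ℕ) (a : ℤ) : ArithmeticFunction ℝ :=
  ⟨fun n => if n.Coprime P then oddJacobi a n else 0, by simp [oddJacobi]⟩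

theorem roughJacobi_apply (P : ℕ) (a : ℤ) (n : ℕ) :
    roughJacobi P a n = if n.Coprime P then oddJacobi a n else 0 := rfl

theorem abs_roughJacobi_le_one (P : ℕ) (a : ℤ) (n : ℕ) : |roughJacobi P a n| ≤ 1 := by
  rw [roughJacobi_apply]
  split_ifs
  · exact abs_oddJacobi_le_one a n
  · simp

theorem isMultiplicative_roughJacobi (P : ℕ) (a : ℤ) : (roughJacobi P a).IsMultiplicative := by
  refine ⟨by simp [roughJacobi_apply, oddJacobi], fun {m n} _ => ?_⟩
  simp only [roughJacobi_apply, oddJacobi_mul_right]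
  by_cases h1 : m.Coprime P
  · by_cases h2 : n.Coprime P
    · rw [if_pos (Nat.Coprime.mul_left h1 h2), if_pos h1, if_pos h2]
    · rw [if_neg (fun h => h2 (Nat.Coprime.coprime_mul_left h)), if_neg h2, mul_zero]
  · rw [if_neg (fun h => h1 (Nat.Coprime.coprime_mul_right h)), if_neg h1, zero_mul]

theorem sum_divisors_roughJacobi_nonneg (P : ℕ) (a : ℤ) {n : ℕ} (hn : Squarefree n) :
    0 ≤ ∑ d ∈ n.divisors, roughJacobi P a d := by
  rw [← (isMultiplicative_roughJacobi P a).prodPrimeFactors_one_add_of_squarefree hn]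
  refine Finset.prod_nonneg fun p _ => ?_
  linarith [(abs_le.mp (abs_roughJacobi_le_one P a p)).1]

theorem roughWeight_mul_sum_divisors_roughJacobi {P : ℕ} (hP : 2 ∣ P) {a : ℤ} {n : ℕ}
    (hn : Squarefree n) (h : OddRes a n) :
    roughWeight P n * ∑ d ∈ n.divisors, roughJacobi P a d = 1 := by
  have h1 : ∀ p ∈ n.primeFactors, 1 + roughJacobi P a p = if ¬ p ∣ P then 2 else 1 := by
    intro p hp
    have hp' := Nat.prime_of_mem_primeFactors hp
    rw [roughJacobi_apply]
    simp only [hp'.coprime_iff_not_dvd]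
    by_cases hpP : p ∣ P
    · simp [hpP]
    · have hp2 : p ≠ 2 := by rintro rfl; exact hpP hP
      simp only [hpP, not_false_eq_true, if_true]
      rw [oddJacobi, if_pos (hp'.odd_of_ne_two hp2), h p hp' (Nat.dvd_of_mem_primeFactors hp) hp2]
      norm_num
  rw [← (isMultiplicative_roughJacobi P a).prodPrimeFactors_one_add_of_squarefree hn,
    Finset.prod_congr rfl h1, Finset.prod_ite, roughWeight]
  simp

/-! ### Pairs with both entries large -/

open scoped NumberTheorySymbols in
/-- The bilinear bound for coefficients supported beyond `z`, where `δ = z ^ (-1/8)`. -/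
theorem abs_jacobi_bilinear_le {z M N X : ℕ} {δ : ℝ} (hz : 0 < z) (hδ : 0 < δ) (hδz : δ ^ 8 * z = 1)
    (hMX : M ≤ X) (hNX : N ≤ X) (α β : ℕ → ℝ) (hα : ∀ m, |α m| ≤ 1) (hβ : ∀ n, |β n| ≤ 1)
    (hα' : ∀ m, α m ≠ 0 → Squarefree m ∧ z < m)
    (hβ' : ∀ n, β n ≠ 0 → (Odd n ∧ Squarefree n) ∧ z < n) :
    |∑ m ∈ Finset.Icc 1 M, ∑ n ∈ Finset.Icc 1 N, α m * β n * (J((m : ℤ) | n) : ℝ)| ≤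
      2 * (1 + 4 * Real.log X) ^ 8 * δ * M * N := by
  have hX0 : 0 ≤ Real.log X := Real.log_natCast_nonneg X
  by_cases hM : z ≤ M
  · by_cases hN : z ≤ N
    · have h1 := jacobi_bilinear_pow_eight_le M N X z (by exact_mod_cast hz) (by exact_mod_cast hM)
        (by exact_mod_cast hN) hMX hNX α β hα hβ (fun m h => (hα' m h).1) fun n h => (hβ' n h).1
      set S := ∑ m ∈ Finset.Icc 1 M, ∑ n ∈ Finset.Icc 1 N, α m * β n * (J((m : ℤ) | n) : ℝ)
      have h2 : |S| ^ 8 ≤ (2 * (1 + 4 * Real.log X) ^ 8 * δ * M * N) ^ 8 := by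
        rw [(by decide : Even 8).pow_abs]
        calc S ^ 8 = (S ^ 8 * z) * δ ^ 8 := by linear_combination (-S ^ 8) * hδz
          _ ≤ (5 * ((M : ℝ) * N) ^ 8 * (1 + 4 * Real.log X) ^ 64) * δ ^ 8 := by gcongr
          _ ≤ (256 * ((M : ℝ) * N) ^ 8 * (1 + 4 * Real.log X) ^ 64) * δ ^ 8 := by
              gcongr; norm_num
          _ = _ := by ring
      exact le_of_pow_le_pow_left₀ (by norm_num) (by positivity) h2
    · have h0 : ∑ m ∈ Finset.Icc 1 M, ∑ n ∈ Finset.Icc 1 N, α m * β n * (J((m : ℤ) | n) : ℝ) = 0 :=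
        Finset.sum_eq_zero fun m _ => Finset.sum_eq_zero fun n hn => by
          have : β n = 0 := by
            by_contra h
            have := (hβ' n h).2
            have := (Finset.mem_Icc.mp hn).2
            omega
          simp [this]
      rw [h0, abs_zero]; positivity
  · have h0 : ∑ m ∈ Finset.Icc 1 M, ∑ n ∈ Finset.Icc 1 N, α m * β n * (J((m : ℤ) | n) : ℝ) = 0 :=
      Finset.sum_eq_zero fun m hm => Finset.sum_eq_zero fun n _ => by
        have : α m = 0 := by
          by_contra h
          have := (hα' m h).2
          have := (Finset.mem_Icc.mp hm).2
          omega
        simp [this]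
    rw [h0, abs_zero]; positivity

theorem squarefree_mul_mul_iff {x m n y : ℕ} (h : Nat.Coprime m n) :
    Squarefree (x * m * (n * y)) ↔ Squarefree (x * y * m) ∧ Squarefree (x * y * n) := by
  rw [show x * m * (n * y) = x * y * m * n by ring]
  constructor
  · intro h1
    exact ⟨h1.of_mul_left, h1.squarefree_of_dvd ⟨m, by ring⟩⟩
  · rintro ⟨h1, h2⟩
    rw [Nat.squarefree_mul_iff] at h2
    rw [Nat.squarefree_mul_iff]
    exact ⟨Nat.Coprime.mul_left h2.1 h, h1, h2.2.2⟩

theorem lt_of_coprime_primorial {z n : ℕ} (h : n.Coprime (primorial z)) (hn : 1 < n) : z < n := by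
  by_contra h1
  have h2 := Nat.minFac_prime hn.ne'
  have h3 : n.minFac ∣ primorial z :=
    h2.dvd_primorial_iff.mpr ((Nat.minFac_le (by omega)).trans (not_lt.mp h1))
  exact h2.one_lt.ne' (Nat.eq_one_of_dvd_coprimes h n.minFac_dvd h3)

/-- The contribution of factorisations `D = xm`, `e = ny` to the expansion into characters of the
conditions `(sD / p) = 1` for `p ∣ e` and `(te / p) = 1` for `p ∣ D`. -/
noncomputable def crossTerm (P : ℕ) (s t : ℤ) (u v : ℕ → ℝ) (x m n y : ℕ) : ℝ :=
  if Squarefree (x * m * (n * y)) then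
    u (x * m) * v (n * y) * roughJacobi P (s * ((x * m : ℕ) : ℤ)) n *
      roughJacobi P (t * ((n * y : ℕ) : ℤ)) x
  else 0

theorem crossTerm_symm (P : ℕ) (s t : ℤ) (u v : ℕ → ℝ) (x m n y : ℕ) :
    crossTerm P s t u v x m n y = crossTerm P t s v u n y x m := by
  unfold crossTerm
  rw [mul_comm (x * m) (n * y)]
  split_ifs <;> ring

/-- For fixed `x` and `y` the cross terms depend on `m` and `n` jointly only through the symbol
`(m / n)`. -/
theorem abs_sum_crossTerm_le {z M N X : ℕ} {δ : ℝ} (hz : 2 ≤ z) (hδ : 0 < δ)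
    (hδz : δ ^ 8 * z = 1) (hMX : M ≤ X) (hNX : N ≤ X) (s t : ℤ) (u v : ℕ → ℝ)
    (hu : ∀ n, |u n| ≤ 1) (hv : ∀ n, |v n| ≤ 1) (x y : ℕ) :
    |∑ m ∈ Finset.Icc 1 M, ∑ n ∈ Finset.Icc 1 N,
        if 1 < n ∧ z < m then crossTerm (primorial z) s t u v x m n y else 0| ≤
      2 * (1 + 4 * Real.log X) ^ 8 * δ * M * N := by
  classical
  set P := primorial z with hP
  have hP2 : 2 ∣ P := Nat.prime_two.dvd_primorial_iff.mpr hz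
  set α : ℕ → ℝ := fun m => if z < m ∧ Squarefree (x * y * m) then u (x * m) else 0 with hα
  set β : ℕ → ℝ := fun n => if 1 < n ∧ n.Coprime P ∧ Squarefree (x * y * n) then
    v (n * y) * oddJacobi (s * x) n * roughJacobi P (t * ((n * y : ℕ) : ℤ)) x else 0 with hβ
  have hodd : ∀ n : ℕ, n.Coprime P → Odd n := fun n hn =>
    Nat.coprime_two_right.mp (Nat.Coprime.coprime_dvd_right hP2 hn)
  have key : ∀ m n : ℕ, (if 1 < n ∧ z < m then crossTerm P s t u v x m n y else 0) =
      α m * β n * (jacobiSym m n : ℝ) := by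
    intro m n
    by_cases h1 : 1 < n
    · by_cases h2 : z < m
      · by_cases h3 : n.Coprime P
        · have h4 : roughJacobi P (s * ((x * m : ℕ) : ℤ)) n =
              oddJacobi (s * x) n * (jacobiSym m n : ℝ) := by
            rw [roughJacobi_apply, if_pos h3, Nat.cast_mul, ← mul_assoc, oddJacobi_mul_left]
            congr 1
            rw [oddJacobi, if_pos (hodd n h3)]
          rw [if_pos ⟨h1, h2⟩, crossTerm, h4]
          by_cases h5 : Nat.Coprime m n
          · simp only [hα, hβ, h1, h2, true_and]
            by_cases h6 : Squarefree (x * y * m)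
            · by_cases h7 : Squarefree (x * y * n)
              · rw [if_pos ((squarefree_mul_mul_iff h5).mpr ⟨h6, h7⟩), if_pos h6, if_pos ⟨h3, h7⟩]; ring
              · rw [if_neg (fun h => h7 ((squarefree_mul_mul_iff h5).mp h).2),
                  if_neg (show ¬ (n.Coprime P ∧ Squarefree (x * y * n)) from fun h => h7 h.2)]
                simp
            · rw [if_neg (fun h => h6 ((squarefree_mul_mul_iff h5).mp h).1), if_neg h6]; simp
          · have : jacobiSym m n = 0 := by
              rw [jacobiSym.eq_zero_iff]
              exact ⟨by omega, by simpa using h5⟩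
            simp [this]
        · have h4 : roughJacobi P (s * ((x * m : ℕ) : ℤ)) n = 0 := by
            rw [roughJacobi_apply, if_neg h3]
          have h5 : β n = 0 := if_neg fun h => h3 h.2.1
          rw [if_pos ⟨h1, h2⟩, crossTerm, h4, h5]
          simp
      · simp [h2, hα]
    · simp [h1, hβ]
  simp only [key]
  refine abs_jacobi_bilinear_le (by omega) hδ hδz hMX hNX α β (fun m => ?_) (fun n => ?_)
    (fun m hm => ?_) fun n hn => ?_
  · simp only [hα]; split_ifs; exacts [hu _, by simp]
  · simp only [hβ]; split_ifs
    · rw [abs_mul, abs_mul]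
      exact mul_le_one₀ (mul_le_one₀ (hv _) (abs_nonneg _) (abs_oddJacobi_le_one _ _))
        (abs_nonneg _) (abs_roughJacobi_le_one _ _ _)
    · simp
  · simp only [hα, ne_eq, ite_eq_right_iff, not_forall] at hm
    obtain ⟨h, -⟩ := hm
    exact ⟨h.2.of_mul_right, h.1⟩
  · simp only [hβ, ne_eq, ite_eq_right_iff, not_forall] at hn
    obtain ⟨h, -⟩ := hn
    exact ⟨⟨hodd n h.2.1, h.2.2.of_mul_right⟩, lt_of_coprime_primorial h.2.1 h.1⟩

theorem sum_divisorsAntidiagonal_swap (n : ℕ) (F : ℕ × ℕ → ℝ) :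
    ∑ q ∈ n.divisorsAntidiagonal, F q.swap = ∑ q ∈ n.divisorsAntidiagonal, F q := by
  conv_rhs => rw [← Nat.map_swap_divisorsAntidiagonal, Finset.sum_map]
  rfl

theorem sum_sum_div_le (A E : ℕ) {Q : ℝ} (hQ : 0 ≤ Q) (F : ℕ → ℕ → ℕ → ℕ → ℝ)
    (h : ∀ x y : ℕ, ∑ m ∈ Finset.Icc 1 (A / x), ∑ n ∈ Finset.Icc 1 (E / y), F x m n y ≤
      Q * (A / x : ℕ) * (E / y : ℕ)) :
    ∑ D ∈ Finset.Icc 1 A, ∑ e ∈ Finset.Icc 1 E, ∑ q ∈ D.divisorsAntidiagonal,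
      ∑ r ∈ e.divisorsAntidiagonal, F q.1 q.2 r.1 r.2 ≤
      Q * A * E * ((1 + Real.log A) * (1 + Real.log E)) := by
  have h1 : ∑ D ∈ Finset.Icc 1 A, ∑ e ∈ Finset.Icc 1 E, ∑ q ∈ D.divisorsAntidiagonal,
      ∑ r ∈ e.divisorsAntidiagonal, F q.1 q.2 r.1 r.2 =
      ∑ x ∈ Finset.Icc 1 A, ∑ y ∈ Finset.Icc 1 E,
        ∑ m ∈ Finset.Icc 1 (A / x), ∑ n ∈ Finset.Icc 1 (E / y), F x m n y := by
    calc _ = ∑ D ∈ Finset.Icc 1 A, ∑ q ∈ D.divisorsAntidiagonal, ∑ e ∈ Finset.Icc 1 E,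
          ∑ r ∈ e.divisorsAntidiagonal, F q.1 q.2 r.2 r.1 := by
          refine Finset.sum_congr rfl fun D _ => ?_
          rw [Finset.sum_comm]
          refine Finset.sum_congr rfl fun q _ => Finset.sum_congr rfl fun e _ => ?_
          exact (sum_divisorsAntidiagonal_swap e fun r => F q.1 q.2 r.2 r.1)
      _ = ∑ x ∈ Finset.Icc 1 A, ∑ m ∈ Finset.Icc 1 (A / x), ∑ e ∈ Finset.Icc 1 E,
          ∑ r ∈ e.divisorsAntidiagonal, F x m r.2 r.1 :=
          sum_divisorsAntidiagonal_Icc A fun q => ∑ e ∈ Finset.Icc 1 E,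
            ∑ r ∈ e.divisorsAntidiagonal, F q.1 q.2 r.2 r.1
      _ = ∑ x ∈ Finset.Icc 1 A, ∑ m ∈ Finset.Icc 1 (A / x), ∑ y ∈ Finset.Icc 1 E,
          ∑ n ∈ Finset.Icc 1 (E / y), F x m n y :=
          Finset.sum_congr rfl fun x _ => Finset.sum_congr rfl fun m _ =>
            sum_divisorsAntidiagonal_Icc E fun r => F x m r.2 r.1
      _ = _ := Finset.sum_congr rfl fun x _ => Finset.sum_comm
  have hdiv : ∀ B x : ℕ, ((B / x : ℕ) : ℝ) ≤ B * (x : ℝ)⁻¹ := fun B x => by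
    rw [← div_eq_mul_inv]; exact Nat.cast_div_le
  have hA0 : 0 ≤ Real.log A := Real.log_natCast_nonneg A
  calc _ ≤ ∑ x ∈ Finset.Icc 1 A, ∑ y ∈ Finset.Icc 1 E,
        Q * (A * (x : ℝ)⁻¹) * (E * (y : ℝ)⁻¹) := by
        rw [h1]
        refine Finset.sum_le_sum fun x _ => Finset.sum_le_sum fun y _ => (h x y).trans ?_
        have := hdiv A x
        have := hdiv E y
        gcongr
    _ = Q * A * E * ((∑ x ∈ Finset.Icc 1 A, (x : ℝ)⁻¹) * ∑ y ∈ Finset.Icc 1 E, (y : ℝ)⁻¹) := by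
        rw [Finset.sum_mul_sum, Finset.mul_sum]
        refine Finset.sum_congr rfl fun x _ => ?_
        rw [Finset.mul_sum]
        exact Finset.sum_congr rfl fun y _ => by ring
    _ ≤ _ := by
        gcongr
        · exact sum_inv_Icc_le A
        · exact sum_inv_Icc_le E

theorem sum_crossTerm_le {z A E X : ℕ} {δ : ℝ} (hz : 2 ≤ z) (hδ : 0 < δ)
    (hδz : δ ^ 8 * z = 1) (hAX : A ≤ X) (hEX : E ≤ X) (s t : ℤ) (u v : ℕ → ℝ)
    (hu : ∀ n, |u n| ≤ 1) (hv : ∀ n, |v n| ≤ 1) (c : ℕ → ℕ → ℝ) (hc : ∀ x y, |c x y| ≤ 1) :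
    ∑ D ∈ Finset.Icc 1 A, ∑ e ∈ Finset.Icc 1 E, ∑ q ∈ D.divisorsAntidiagonal,
      ∑ r ∈ e.divisorsAntidiagonal, c q.1 r.2 *
        (if 1 < r.1 ∧ z < q.2 then crossTerm (primorial z) s t u v q.1 q.2 r.1 r.2 else 0) ≤
      2 * (1 + 4 * Real.log X) ^ 8 * δ * A * E * ((1 + Real.log A) * (1 + Real.log E)) := by
  have hX0 : 0 ≤ Real.log X := Real.log_natCast_nonneg X
  refine sum_sum_div_le A E (by positivity) (fun x m n y => c x y *
    (if 1 < n ∧ z < m then crossTerm (primorial z) s t u v x m n y else 0)) fun x y => ?_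
  simp only [← Finset.mul_sum]
  refine (le_abs_self _).trans ?_
  rw [abs_mul]
  exact (mul_le_of_le_one_left (abs_nonneg _) (hc x y)).trans (abs_sum_crossTerm_le hz hδ hδz
    ((Nat.div_le_self _ _).trans hAX) ((Nat.div_le_self _ _).trans hEX) s t u v hu hv x y)

/-- The factorisations of `D > z` and `e > z` that escape the bilinear bounds are the trivial one
and the one into rough and smooth parts. -/
theorem sum_crossTerm_rest_le {z D e : ℕ} (hD : z < D) (he : z < e) (s t : ℤ) (u v : ℕ → ℝ)
    (hu : 0 ≤ u D) (hv : 0 ≤ v e) :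
    ∑ q ∈ D.divisorsAntidiagonal, ∑ r ∈ e.divisorsAntidiagonal,
      (if ¬ (1 < r.1 ∧ z < q.2) ∧ ¬ (1 < q.1 ∧ z < r.2) then
        crossTerm (primorial z) s t u v q.1 q.2 r.1 r.2 else 0) ≤ 2 * (u D * v e) := by
  classical
  set P := primorial z with hP
  set f : (ℕ × ℕ) × (ℕ × ℕ) → ℝ := fun w =>
    if ¬ (1 < w.2.1 ∧ z < w.1.2) ∧ ¬ (1 < w.1.1 ∧ z < w.2.2) then
      crossTerm P s t u v w.1.1 w.1.2 w.2.1 w.2.2 else 0 with hf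
  have huv : 0 ≤ u D * v e := mul_nonneg hu hv
  have hle : ∀ w ∈ D.divisorsAntidiagonal ×ˢ e.divisorsAntidiagonal, f w ≤ u D * v e := by
    intro w hw
    rw [Finset.mem_product, Nat.mem_divisorsAntidiagonal, Nat.mem_divisorsAntidiagonal] at hw
    simp only [hf]
    split_ifs
    · rw [crossTerm, hw.1.1, hw.2.1]
      split_ifs
      · have h1 := abs_roughJacobi_le_one P (s * (D : ℤ)) w.2.1
        have h2 := abs_roughJacobi_le_one P (t * (e : ℤ)) w.1.1
        have h3 : roughJacobi P (s * (D : ℤ)) w.2.1 * roughJacobi P (t * (e : ℤ)) w.1.1 ≤ 1 := by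
          refine (le_abs_self _).trans ?_
          rw [abs_mul]
          exact mul_le_one₀ h1 (abs_nonneg _) h2
        rw [mul_assoc]
        exact mul_le_of_le_one_right huv h3
      · exact huv
    · exact huv
  -- If the cofactor of a `P`-coprime divisor is at most `z`, it is the greatest common divisor
  -- with `P`.
  have hgcd : ∀ {n a b : ℕ}, a * b = n → Squarefree n → a.Coprime P → b ≤ z → Nat.gcd n P = b := by
    intro n a b hab hn ha hb
    have hbs : Squarefree b := (hab ▸ hn).of_mul_right
    have hbP : b ∣ P := hbs.dvd_primorial.trans (primorial_dvd_primorial hb)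
    rw [← hab, Nat.Coprime.gcd_mul_left_cancel b ha, Nat.gcd_eq_left hbP]
  have hsub : (D.divisorsAntidiagonal ×ˢ e.divisorsAntidiagonal).filter (fun w => f w ≠ 0) ⊆
      {((1, D), (1, e)),
        ((D / Nat.gcd D P, Nat.gcd D P), (e / Nat.gcd e P, Nat.gcd e P))} := by
    rintro ⟨⟨x, m⟩, ⟨n, y⟩⟩ hw
    simp only [Finset.mem_filter, Finset.mem_product, Nat.mem_divisorsAntidiagonal, hf] at hw
    obtain ⟨⟨⟨h1, hD0⟩, ⟨h2, he0⟩⟩, h3⟩ := hw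
    have h4 : ¬ (1 < n ∧ z < m) ∧ ¬ (1 < x ∧ z < y) := by
      by_contra h; exact h3 (if_neg h)
    rw [if_pos h4] at h3
    have hx0 : x ≠ 0 := by rintro rfl; simp at h1; omega
    have hn0 : n ≠ 0 := by rintro rfl; simp at h2; omega
    have hsq : Squarefree (D * e) := by
      by_contra h
      apply h3
      rw [crossTerm, h1, h2, if_neg h]
    rw [crossTerm, h1, h2, if_pos hsq] at h3
    have hnP : n.Coprime P := by
      by_contra h
      apply h3
      rw [roughJacobi_apply P _ n, if_neg h]; simp
    have hxP : x.Coprime P := by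
      by_contra h
      apply h3
      rw [roughJacobi_apply P _ x, if_neg h]; simp
    simp only [Finset.mem_insert, Finset.mem_singleton, Prod.mk.injEq]
    by_cases hm : z < m
    · left
      have hn1 : n = 1 := by
        by_contra h; exact h4.1 ⟨by omega, hm⟩
      subst hn1
      have hy : y = e := by simpa using h2
      have hx1 : x = 1 := by
        by_contra h; exact h4.2 ⟨by omega, by omega⟩
      subst hx1
      exact ⟨⟨rfl, by simpa using h1⟩, rfl, hy⟩
    · right
      have hm' : m ≤ z := not_lt.mp hm
      have hx1 : x ≠ 1 := by rintro rfl; simp at h1; omega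
      have hy' : y ≤ z := by
        by_contra h; exact h4.2 ⟨by omega, by omega⟩
      have hg1 := hgcd h1 hsq.of_mul_left hxP hm'
      have hg2 := hgcd h2 hsq.of_mul_right hnP hy'
      have hm0 : 0 < m := Nat.pos_of_ne_zero (by rintro rfl; simp at h1; omega)
      have hy0 : 0 < y := Nat.pos_of_ne_zero (by rintro rfl; simp at h2; omega)
      rw [hg1, hg2]
      exact ⟨⟨(Nat.div_eq_of_eq_mul_left hm0 h1.symm).symm, rfl⟩,
        (Nat.div_eq_of_eq_mul_left hy0 h2.symm).symm, rfl⟩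
  rw [← Finset.sum_product' (f := fun q r => f (q, r))]
  rw [← Finset.sum_filter_ne_zero]
  calc _ ≤ ((D.divisorsAntidiagonal ×ˢ e.divisorsAntidiagonal).filter
        (fun w => f w ≠ 0)).card • (u D * v e) :=
        Finset.sum_le_card_nsmul _ _ _ fun w hw => hle w (Finset.mem_filter.mp hw).1
    _ ≤ 2 * (u D * v e) := by
        rw [nsmul_eq_mul]
        refine mul_le_mul_of_nonneg_right ?_ huv
        exact_mod_cast (Finset.card_le_card hsub).trans Finset.card_le_two

/-- The local conditions at odd primes on a pair `(D, e)`: `De` is squarefree, `2` and `te` are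
squares modulo every odd `p ∣ D`, and `sD` is a square modulo every odd `p ∣ e`. -/
def LocalCond (s t : ℤ) (D e : ℕ) : Prop :=
  Squarefree (D * e) ∧ OddRes 2 D ∧ OddRes (s * (D : ℤ)) e ∧ OddRes (t * (e : ℤ)) D

theorem oddRes_one (n : ℕ) : OddRes 1 n := fun p _ _ _ => jacobiSym.one_left p

open Classical in
theorem ite_localCond_le {P : ℕ} (hP : 2 ∣ P) (s t : ℤ) (ρ σ : ℕ → ℝ) (hρ : ∀ n, 0 ≤ ρ n)
    (hσ : ∀ n, 0 ≤ σ n) (D e : ℕ) :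
    (if LocalCond s t D e then ρ D * σ e else 0) ≤
      ∑ q ∈ D.divisorsAntidiagonal, ∑ r ∈ e.divisorsAntidiagonal,
        crossTerm P s t (fun n => ρ n * splitWeight P 2 n) (fun n => σ n * splitWeight P 1 n)
          q.1 q.2 r.1 r.2 := by
  have h1 : ∑ q ∈ D.divisorsAntidiagonal, ∑ r ∈ e.divisorsAntidiagonal,
      crossTerm P s t (fun n => ρ n * splitWeight P 2 n) (fun n => σ n * splitWeight P 1 n)
        q.1 q.2 r.1 r.2 =
      if Squarefree (D * e) then (ρ D * splitWeight P 2 D) * (σ e * splitWeight P 1 e) *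
        ((∑ d ∈ e.divisors, roughJacobi P (s * (D : ℤ)) d) *
          ∑ d ∈ D.divisors, roughJacobi P (t * (e : ℤ)) d) else 0 := by
    calc _ = ∑ q ∈ D.divisorsAntidiagonal, ∑ r ∈ e.divisorsAntidiagonal,
          if Squarefree (D * e) then (ρ D * splitWeight P 2 D) * (σ e * splitWeight P 1 e) *
            (roughJacobi P (s * (D : ℤ)) r.1 * roughJacobi P (t * (e : ℤ)) q.1) else 0 := by
          refine Finset.sum_congr rfl fun q hq => Finset.sum_congr rfl fun r hr => ?_
          rw [crossTerm, (Nat.mem_divisorsAntidiagonal.mp hq).1,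
            (Nat.mem_divisorsAntidiagonal.mp hr).1]
          split_ifs <;> ring
      _ = _ := by
          split_ifs
          · rw [← Nat.sum_divisorsAntidiagonal (fun d _ => roughJacobi P (s * (D : ℤ)) d),
              ← Nat.sum_divisorsAntidiagonal (fun d _ => roughJacobi P (t * (e : ℤ)) d),
              Finset.sum_mul_sum, Finset.mul_sum, Finset.sum_comm]
            refine Finset.sum_congr rfl fun q _ => ?_
            rw [Finset.mul_sum]
          · simp
  rw [h1]
  by_cases hsq : Squarefree (D * e)
  · have hDs : Squarefree D := hsq.of_mul_left
    have hes : Squarefree e := hsq.of_mul_right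
    rw [if_pos hsq]
    split_ifs with hc
    · obtain ⟨-, h2, h3, h4⟩ := hc
      have h5 := roughWeight_mul_sum_divisors_roughJacobi hP hDs h4
      have h6 := roughWeight_mul_sum_divisors_roughJacobi hP hes h3
      rw [splitWeight, splitWeight, if_pos ⟨hDs, h2⟩, if_pos ⟨hes, oddRes_one e⟩]
      refine le_of_eq ?_
      linear_combination (-(ρ D * σ e * (roughWeight P e *
        ∑ d ∈ e.divisors, roughJacobi P (s * (D : ℤ)) d))) * h5 - ρ D * σ e * h6
    · exact mul_nonneg (mul_nonneg (mul_nonneg (hρ _) (splitWeight_nonneg _ _ _))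
        (mul_nonneg (hσ _) (splitWeight_nonneg _ _ _)))
        (mul_nonneg (sum_divisors_roughJacobi_nonneg _ _ hes)
          (sum_divisors_roughJacobi_nonneg _ _ hDs))
  · rw [if_neg hsq, if_neg fun h => hsq h.1]

theorem splitWeight_le_one (P : ℕ) (a : ℤ) (n : ℕ) : splitWeight P a n ≤ 1 := by
  unfold splitWeight; split_ifs; exacts [roughWeight_le_one _ _, zero_le_one]

open Classical in
/-- Pairs with both entries larger than `z`: the terms that involve a genuine character are treated
as bilinear sums, and the others contribute at most the product of two mean values. -/
theorem sum_localCond_le {z A E X : ℕ} {δ : ℝ} (hz : 2 ≤ z) (hδ : 0 < δ) (hδz : δ ^ 8 * z = 1)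
    (hAX : A ≤ X) (hEX : E ≤ X) (s t : ℤ) (ρ σ : ℕ → ℝ) (hρ : ∀ n, 0 ≤ ρ n) (hρ1 : ∀ n, ρ n ≤ 1)
    (hσ : ∀ n, 0 ≤ σ n) (hσ1 : ∀ n, σ n ≤ 1) (hρz : ∀ n ≤ z, ρ n = 0) (hσz : ∀ n ≤ z, σ n = 0) :
    ∑ D ∈ Finset.Icc 1 A, ∑ e ∈ Finset.Icc 1 E, (if LocalCond s t D e then ρ D * σ e else 0) ≤
      2 * ((∑ D ∈ Finset.Icc 1 A, ρ D * splitWeight (primorial z) 2 D) *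
        ∑ e ∈ Finset.Icc 1 E, σ e * splitWeight (primorial z) 1 e) +
      4 * (1 + 4 * Real.log X) ^ 8 * δ * A * E * ((1 + Real.log A) * (1 + Real.log E)) := by
  set P := primorial z with hP
  have hP2 : 2 ∣ P := Nat.prime_two.dvd_primorial_iff.mpr hz
  set u : ℕ → ℝ := fun n => ρ n * splitWeight P 2 n with hu
  set v : ℕ → ℝ := fun n => σ n * splitWeight P 1 n with hv
  have hu0 : ∀ n, 0 ≤ u n := fun n => mul_nonneg (hρ n) (splitWeight_nonneg _ _ _)
  have hv0 : ∀ n, 0 ≤ v n := fun n => mul_nonneg (hσ n) (splitWeight_nonneg _ _ _)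
  have hu1 : ∀ n, |u n| ≤ 1 := fun n => by
    rw [abs_of_nonneg (hu0 n)]
    exact mul_le_one₀ (hρ1 n) (splitWeight_nonneg _ _ _) (splitWeight_le_one _ _ _)
  have hv1 : ∀ n, |v n| ≤ 1 := fun n => by
    rw [abs_of_nonneg (hv0 n)]
    exact mul_le_one₀ (hσ1 n) (splitWeight_nonneg _ _ _) (splitWeight_le_one _ _ _)
  set T : ℕ × ℕ → ℕ × ℕ → ℝ := fun q r => crossTerm P s t u v q.1 q.2 r.1 r.2 with hT
  have hsplit : ∀ q r, T q r =
      1 * (if 1 < r.1 ∧ z < q.2 then T q r else 0) +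
      (if 1 < r.1 ∧ z < q.2 then 0 else 1) * (if 1 < q.1 ∧ z < r.2 then T q r else 0) +
      (if ¬ (1 < r.1 ∧ z < q.2) ∧ ¬ (1 < q.1 ∧ z < r.2) then T q r else 0) := by
    intro q r
    by_cases h1 : 1 < r.1 ∧ z < q.2 <;> by_cases h2 : 1 < q.1 ∧ z < r.2 <;> simp [h1, h2]
  have hA := sum_crossTerm_le hz hδ hδz hAX hEX s t u v hu1 hv1 (fun _ _ => 1) (by simp)
  have hB := sum_crossTerm_le hz hδ hδz hEX hAX t s v u hv1 hu1
    (fun n m => if 1 < n ∧ z < m then 0 else 1) (fun n m => by split_ifs <;> simp)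
  have hB' : ∑ D ∈ Finset.Icc 1 A, ∑ e ∈ Finset.Icc 1 E, ∑ q ∈ D.divisorsAntidiagonal,
      ∑ r ∈ e.divisorsAntidiagonal,
      (if 1 < r.1 ∧ z < q.2 then 0 else 1) * (if 1 < q.1 ∧ z < r.2 then T q r else 0) =
      ∑ e ∈ Finset.Icc 1 E, ∑ D ∈ Finset.Icc 1 A, ∑ r ∈ e.divisorsAntidiagonal,
      ∑ q ∈ D.divisorsAntidiagonal, (if 1 < r.1 ∧ z < q.2 then 0 else 1) *
        (if 1 < q.1 ∧ z < r.2 then crossTerm P t s v u r.1 r.2 q.1 q.2 else 0) := by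
    rw [Finset.sum_comm]
    refine Finset.sum_congr rfl fun e _ => Finset.sum_congr rfl fun D _ => ?_
    rw [Finset.sum_comm]
    refine Finset.sum_congr rfl fun r _ => Finset.sum_congr rfl fun q _ => ?_
    simp only [hT]
    rw [crossTerm_symm]
  have hC : ∑ D ∈ Finset.Icc 1 A, ∑ e ∈ Finset.Icc 1 E, ∑ q ∈ D.divisorsAntidiagonal,
      ∑ r ∈ e.divisorsAntidiagonal,
      (if ¬ (1 < r.1 ∧ z < q.2) ∧ ¬ (1 < q.1 ∧ z < r.2) then T q r else 0) ≤
      2 * ((∑ D ∈ Finset.Icc 1 A, u D) * ∑ e ∈ Finset.Icc 1 E, v e) := by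
    rw [Finset.sum_mul_sum, Finset.mul_sum]
    refine Finset.sum_le_sum fun D _ => ?_
    rw [Finset.mul_sum]
    refine Finset.sum_le_sum fun e _ => ?_
    by_cases hD : z < D
    · by_cases he : z < e
      · exact sum_crossTerm_rest_le hD he s t u v (hu0 D) (hv0 e)
      · have hv' : v e = 0 := by simp [hv, hσz e (not_lt.mp he)]
        rw [hv', mul_zero, mul_zero]
        refine (Finset.sum_eq_zero fun q hq => Finset.sum_eq_zero fun r hr => ?_).le
        simp [hT, crossTerm, (Nat.mem_divisorsAntidiagonal.mp hr).1, hv']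
    · have hu' : u D = 0 := by simp [hu, hρz D (not_lt.mp hD)]
      rw [hu', zero_mul, mul_zero]
      refine (Finset.sum_eq_zero fun q hq => Finset.sum_eq_zero fun r hr => ?_).le
      simp [hT, crossTerm, (Nat.mem_divisorsAntidiagonal.mp hq).1, hu']
  calc _ ≤ ∑ D ∈ Finset.Icc 1 A, ∑ e ∈ Finset.Icc 1 E, ∑ q ∈ D.divisorsAntidiagonal,
        ∑ r ∈ e.divisorsAntidiagonal, T q r :=
        Finset.sum_le_sum fun D _ => Finset.sum_le_sum fun e _ =>
          ite_localCond_le hP2 s t ρ σ hρ hσ D e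
    _ = _ := Finset.sum_congr rfl fun D _ => Finset.sum_congr rfl fun e _ =>
          Finset.sum_congr rfl fun q _ => Finset.sum_congr rfl fun r _ => hsplit q r
    _ ≤ _ := by
        simp only [Finset.sum_add_distrib]
        rw [hB']
        have := add_le_add (add_le_add hA hB) hC
        refine this.trans (le_of_eq ?_)
        ring

/-! ### Counting pairs that satisfy the local conditions -/

theorem sum_splitWeight_le (P : ℕ) (a : ℤ) {E Y : ℕ} {L : ℝ} (hL : 0 < L) (hEY : E ≤ Y)
    (hLE : L ≤ 4 * Real.log E) :
    ∑ n ∈ Finset.Icc 1 E, splitWeight P a n ≤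
      12 * E / L * ∑ n ∈ Finset.Icc 1 Y, splitWeight P a n * (n : ℝ)⁻¹ := by
  have h1 := log_mul_sum_splitWeight_le P a E
  have h2 : ∑ n ∈ Finset.Icc 1 E, splitWeight P a n * (n : ℝ)⁻¹ ≤
      ∑ n ∈ Finset.Icc 1 Y, splitWeight P a n * (n : ℝ)⁻¹ :=
    Finset.sum_le_sum_of_subset_of_nonneg (Finset.Icc_subset_Icc_right hEY) fun n _ _ =>
      mul_nonneg (splitWeight_nonneg _ _ _) (by positivity)
  have h3 : 0 ≤ ∑ n ∈ Finset.Icc 1 E, splitWeight P a n :=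
    Finset.sum_nonneg fun n _ => splitWeight_nonneg _ _ _
  rw [div_mul_eq_mul_div, le_div_iff₀ hL]
  calc (∑ n ∈ Finset.Icc 1 E, splitWeight P a n) * L
      ≤ (∑ n ∈ Finset.Icc 1 E, splitWeight P a n) * (4 * Real.log E) := by gcongr
    _ = 4 * (Real.log E * ∑ n ∈ Finset.Icc 1 E, splitWeight P a n) := by ring
    _ ≤ 4 * (3 * E * ∑ n ∈ Finset.Icc 1 E, splitWeight P a n * (n : ℝ)⁻¹) := by gcongr
    _ ≤ 4 * (3 * E * ∑ n ∈ Finset.Icc 1 Y, splitWeight P a n * (n : ℝ)⁻¹) := by gcongr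
    _ = _ := by ring

/-- Every prime divides `0`, so `splitWeight 0 a` is an indicator function. -/
theorem splitWeight_zero_of {a : ℤ} {n : ℕ} (hn : Squarefree n) (h : OddRes a n) :
    splitWeight 0 a n = 1 := by
  simp [splitWeight, hn, h, roughWeight]

theorem sum_splitWeight_zero_le {a : ℤ} (ha0 : a ≠ 0) (ha : ¬ IsSquare a) {E N : ℕ}
    (hN : 0 < Real.log N) (hEN : E ≤ N) (hLE : Real.log N ≤ 4 * Real.log E) :
    ∑ n ∈ Finset.Icc 1 E, splitWeight 0 a n ≤
      24 * E / Real.log N * √((1 + 2 * Real.log N) * (3 + Real.log (4 * a.natAbs))) := by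
  classical
  have h1 := sum_splitWeight_le 0 a hN hEN hLE
  have h2 : ∑ n ∈ Finset.Icc 1 N, splitWeight 0 a n * (n : ℝ)⁻¹ ≤
      ∑ n ∈ Finset.Icc 1 N with OddRes a n, (n : ℝ)⁻¹ := by
    rw [Finset.sum_filter]
    refine Finset.sum_le_sum fun n _ => ?_
    split_ifs with h
    · exact mul_le_of_le_one_left (by positivity) (splitWeight_le_one _ _ _)
    · simp [splitWeight, h]
  have h3 := Real.le_sqrt_of_sq_le (sq_sum_oddRes_inv_le ha0 ha N)
  rw [show (4 : ℝ) * ((1 + 2 * Real.log N) * (3 + Real.log (4 * a.natAbs))) =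
    2 ^ 2 * ((1 + 2 * Real.log N) * (3 + Real.log (4 * a.natAbs))) by norm_num,
    Real.sqrt_mul (by norm_num), Real.sqrt_sq (by norm_num)] at h3
  calc _ ≤ 12 * E / Real.log N * (2 * √((1 + 2 * Real.log N) * (3 + Real.log (4 * a.natAbs)))) :=
        h1.trans (by gcongr; exact h2.trans h3)
    _ = _ := by ring

theorem log_le_four_mul_log_div {N D : ℕ} (hD : 1 ≤ D)
    (h : Real.log D + Real.log 2 ≤ 3 / 4 * Real.log N) :
    Real.log N ≤ 4 * Real.log (N / D : ℕ) := by
  have hl2 : 0 < Real.log 2 := Real.log_pos (by norm_num)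
  have hD0 : (0 : ℝ) < D := by exact_mod_cast hD
  have hlD : 0 ≤ Real.log D := Real.log_natCast_nonneg D
  have hN0 : (0 : ℝ) < N := by
    rcases Nat.eq_zero_or_pos N with h0 | h0
    · subst h0; simp at h; linarith
    · exact_mod_cast h0
  have hDN : D ≤ N := by
    have : Real.log D < Real.log N := by linarith
    exact_mod_cast ((Real.log_lt_log_iff hD0 hN0).mp this).le
  have h1 : 1 ≤ N / D := (Nat.one_le_div_iff hD).mpr hDN
  have h2 : (N : ℝ) ≤ 2 * D * (N / D : ℕ) := by
    have h3 := Nat.lt_mul_div_succ N hD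
    have h4 : N ≤ 2 * D * (N / D) := by nlinarith
    exact_mod_cast h4
  have h5 : (0 : ℝ) < (N / D : ℕ) := by exact_mod_cast h1
  have h6 := Real.log_le_log hN0 h2
  rw [Real.log_mul (by positivity) h5.ne', Real.log_mul (by norm_num) hD0.ne'] at h6
  linarith

theorem sum_Icc_sum_Icc_div_comm (N : ℕ) (F : ℕ → ℕ → ℝ) :
    ∑ a ∈ Finset.Icc 1 N, ∑ b ∈ Finset.Icc 1 (N / a), F a b =
      ∑ b ∈ Finset.Icc 1 N, ∑ a ∈ Finset.Icc 1 (N / b), F a b := by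
  rw [← sum_divisorsAntidiagonal_Icc N fun q => F q.1 q.2,
    ← sum_divisorsAntidiagonal_Icc N fun q => F q.2 q.1]
  exact Finset.sum_congr rfl fun n _ => (sum_divisorsAntidiagonal_swap n fun q => F q.1 q.2).symm

/-- Summing a bound `c N / a` over `a ≤ z`. -/
theorem sum_small_le {N z : ℕ} {c : ℝ} (hc : 0 ≤ c) (g : ℕ → ℕ → ℝ)
    (hg : ∀ a, 1 ≤ a → a ≤ z → ∑ b ∈ Finset.Icc 1 (N / a), g a b ≤ c * (N / a : ℕ)) :
    ∑ a ∈ Finset.Icc 1 N, ∑ b ∈ Finset.Icc 1 (N / a), (if a ≤ z then g a b else 0) ≤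
      c * N * (1 + Real.log z) := by
  calc _ = ∑ a ∈ Finset.Icc 1 N with a ≤ z, ∑ b ∈ Finset.Icc 1 (N / a), g a b := by
        rw [Finset.sum_filter]
        refine Finset.sum_congr rfl fun a _ => ?_
        split_ifs <;> simp
    _ ≤ ∑ a ∈ Finset.Icc 1 N with a ≤ z, c * N * (a : ℝ)⁻¹ := by
        refine Finset.sum_le_sum fun a ha => ?_
        simp only [Finset.mem_filter, Finset.mem_Icc] at ha
        refine (hg a ha.1.1 ha.2).trans ?_
        rw [mul_assoc, ← div_eq_mul_inv]
        exact mul_le_mul_of_nonneg_left Nat.cast_div_le hc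
    _ ≤ ∑ a ∈ Finset.Icc 1 z, c * N * (a : ℝ)⁻¹ := by
        refine Finset.sum_le_sum_of_subset_of_nonneg ?_ fun _ _ _ => by positivity
        intro a ha
        simp only [Finset.mem_filter, Finset.mem_Icc] at ha ⊢
        exact ⟨ha.1.1, ha.2⟩
    _ ≤ _ := by
        rw [← Finset.mul_sum]
        exact mul_le_mul_of_nonneg_left (sum_inv_Icc_le z) (by positivity)

theorem sum_two_pow_le (I y : ℕ) :
    ∑ i ∈ Finset.range I with 2 ^ i ≤ y, (2 : ℝ) ^ i ≤ 2 * y := by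
  rcases Nat.eq_zero_or_pos y with h | h
  · subst h; simp
  · calc _ ≤ ∑ i ∈ Finset.range (Nat.log 2 y + 1), (2 : ℝ) ^ i := by
          refine Finset.sum_le_sum_of_subset_of_nonneg ?_ fun _ _ _ => by positivity
          intro i hi
          have h1 := Nat.le_log_of_pow_le (by norm_num) (Finset.mem_filter.mp hi).2
          exact Finset.mem_range.mpr (by omega)
      _ = 2 ^ (Nat.log 2 y + 1) - 1 := by rw [geom_sum_eq (by norm_num)]; norm_num
      _ ≤ _ := by
          have h1 : 2 ^ Nat.log 2 y ≤ y := Nat.pow_log_le_self 2 h.ne'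
          have h2 : (2 : ℝ) ^ Nat.log 2 y ≤ y := by exact_mod_cast h1
          rw [pow_succ]; linarith

theorem sum_dyadic_block_le (I D : ℕ) (hD : 1 ≤ D) :
    ∑ i ∈ Finset.range I, (if 2 ^ i ≤ D ∧ D < 2 ^ (i + 1) then ((2 : ℝ) ^ i)⁻¹ else 0) ≤
      2 * (D : ℝ)⁻¹ := by
  have h1 : ∀ i, (2 ^ i ≤ D ∧ D < 2 ^ (i + 1)) ↔ Nat.log 2 D = i := fun i => by
    rw [Nat.log_eq_iff (Or.inr ⟨by norm_num, by omega⟩)]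
  simp only [h1]
  have h2 : ((2 : ℝ) ^ Nat.log 2 D)⁻¹ ≤ 2 * (D : ℝ)⁻¹ := by
    have h3 := Nat.lt_pow_succ_log_self (by norm_num : 1 < 2) D
    have h4 : (D : ℝ) ≤ 2 ^ Nat.log 2 D * 2 := by rw [← pow_succ]; exact_mod_cast h3.le
    have hD0 : (0 : ℝ) < D := by exact_mod_cast hD
    rw [← div_eq_mul_inv, le_div_iff₀ hD0, inv_mul_le_iff₀ (by positivity)]
    exact h4
  rw [Finset.sum_ite_eq]
  split_ifs
  · exact h2
  · positivity

/-- The dyadic pieces of a hyperbolic sum, each bounded by a product of two mean values of which at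
least one is taken over a long interval. -/
theorem sum_dyadic_splitWeight_le (P : ℕ) {N : ℕ} (hN : 14 ≤ Real.log N) :
    ∑ i ∈ Finset.range (Nat.log 2 N + 1),
      (∑ D ∈ Finset.Icc 1 (2 ^ (i + 1)),
        (if 2 ^ i ≤ D ∧ D < 2 ^ (i + 1) then splitWeight P 2 D else 0)) *
        ∑ e ∈ Finset.Icc 1 (N / 2 ^ i), splitWeight P 1 e ≤
      72 * N / Real.log N * ((∑ n ∈ Finset.Icc 1 N, splitWeight P 1 n * (n : ℝ)⁻¹) *
        ∑ n ∈ Finset.Icc 1 (2 * N), splitWeight P 2 n * (n : ℝ)⁻¹) := by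
  set L := Real.log N with hL
  have hL0 : 0 < L := by linarith
  have hN0 : 0 < N := Nat.pos_of_ne_zero (by rintro rfl; simp at hL; linarith)
  have hl2 : 0 < Real.log 2 := Real.log_pos (by norm_num)
  have hl2' : Real.log 2 < 1 := by linarith [Real.log_two_lt_d9]
  set V1 := ∑ n ∈ Finset.Icc 1 N, splitWeight P 1 n * (n : ℝ)⁻¹ with hV1
  set V2 := ∑ n ∈ Finset.Icc 1 (2 * N), splitWeight P 2 n * (n : ℝ)⁻¹ with hV2
  have hV1' : 0 ≤ V1 :=
    Finset.sum_nonneg fun n _ => mul_nonneg (splitWeight_nonneg _ _ _) (by positivity)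
  have hV2' : 0 ≤ V2 :=
    Finset.sum_nonneg fun n _ => mul_nonneg (splitWeight_nonneg _ _ _) (by positivity)
  set F : ℕ → ℝ := fun i => ∑ D ∈ Finset.Icc 1 (2 ^ (i + 1)),
    (if 2 ^ i ≤ D ∧ D < 2 ^ (i + 1) then splitWeight P 2 D else 0) with hF
  set H : ℕ → ℝ := fun i => ∑ e ∈ Finset.Icc 1 (N / 2 ^ i), splitWeight P 1 e with hH
  have hF0 : ∀ i, 0 ≤ F i := fun i => Finset.sum_nonneg fun D _ => by
    split_ifs; exacts [splitWeight_nonneg _ _ _, le_rfl]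
  have hH0 : ∀ i, 0 ≤ H i := fun i => Finset.sum_nonneg fun D _ => splitWeight_nonneg _ _ _
  have hiN : ∀ i ∈ Finset.range (Nat.log 2 N + 1), 2 ^ i ≤ N := fun i hi =>
    (Nat.pow_le_pow_right (by norm_num) (by have := Finset.mem_range.mp hi; omega)).trans
      (Nat.pow_log_le_self 2 hN0.ne')
  have hstep : ∀ i ∈ Finset.range (Nat.log 2 N + 1), F i * H i ≤
      12 * N / L * V1 * (F i * ((2 : ℝ) ^ i)⁻¹) + 24 / L * V2 * ((2 : ℝ) ^ i * H i) := by
    intro i hi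
    have hA : 0 ≤ 12 * N / L * V1 * (F i * ((2 : ℝ) ^ i)⁻¹) := by
      have := hF0 i; positivity
    have hB : 0 ≤ 24 / L * V2 * ((2 : ℝ) ^ i * H i) := by
      have := hH0 i; positivity
    by_cases h : i * Real.log 2 ≤ L / 2
    · have h1 : L ≤ 4 * Real.log (N / 2 ^ i : ℕ) := by
        refine log_le_four_mul_log_div Nat.one_le_two_pow ?_
        push_cast; rw [Real.log_pow]; linarith
      have h2 : H i ≤ 12 * (N / 2 ^ i : ℕ) / L * V1 :=
        sum_splitWeight_le P 1 hL0 (Nat.div_le_self _ _) h1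
      have h3 : ((N / 2 ^ i : ℕ) : ℝ) ≤ N * ((2 : ℝ) ^ i)⁻¹ := by
        rw [← div_eq_mul_inv]
        exact Nat.cast_div_le.trans (by push_cast; rfl)
      calc F i * H i ≤ F i * (12 * (N * ((2 : ℝ) ^ i)⁻¹) / L * V1) := by
            refine mul_le_mul_of_nonneg_left (h2.trans ?_) (hF0 i)
            gcongr
        _ = 12 * N / L * V1 * (F i * ((2 : ℝ) ^ i)⁻¹) := by ring
        _ ≤ _ := by linarith
    · have h1 : L ≤ 4 * Real.log (2 ^ (i + 1) : ℕ) := by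
        push_cast; rw [Real.log_pow]; push_cast; nlinarith
      have h2 : F i ≤ 12 * (2 ^ (i + 1) : ℕ) / L * V2 := by
        refine le_trans ?_ (sum_splitWeight_le P 2 hL0 ?_ h1)
        · refine Finset.sum_le_sum fun D _ => ?_
          split_ifs; exacts [le_rfl, splitWeight_nonneg _ _ _]
        · rw [pow_succ, mul_comm]; exact Nat.mul_le_mul_left 2 (hiN i hi)
      calc F i * H i ≤ (12 * (2 ^ (i + 1) : ℕ) / L * V2) * H i :=
            mul_le_mul_of_nonneg_right h2 (hH0 i)
        _ = 24 / L * V2 * ((2 : ℝ) ^ i * H i) := by push_cast; ring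
        _ ≤ _ := by linarith
  have hFsum : ∑ i ∈ Finset.range (Nat.log 2 N + 1), F i * ((2 : ℝ) ^ i)⁻¹ ≤ 2 * V2 := by
    calc _ ≤ ∑ i ∈ Finset.range (Nat.log 2 N + 1), ∑ D ∈ Finset.Icc 1 (2 * N), splitWeight P 2 D *
          (if 2 ^ i ≤ D ∧ D < 2 ^ (i + 1) then ((2 : ℝ) ^ i)⁻¹ else 0) := by
          refine Finset.sum_le_sum fun i hi => ?_
          rw [hF, Finset.sum_mul]
          refine le_trans (le_of_eq (Finset.sum_congr rfl fun D _ => ?_))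
            (Finset.sum_le_sum_of_subset_of_nonneg (Finset.Icc_subset_Icc_right ?_) fun D _ _ => ?_)
          · split_ifs <;> simp
          · rw [pow_succ, mul_comm]; exact Nat.mul_le_mul_left 2 (hiN i hi)
          · have := splitWeight_nonneg P 2 D
            split_ifs <;> positivity
      _ = ∑ D ∈ Finset.Icc 1 (2 * N), splitWeight P 2 D *
          ∑ i ∈ Finset.range (Nat.log 2 N + 1),
            (if 2 ^ i ≤ D ∧ D < 2 ^ (i + 1) then ((2 : ℝ) ^ i)⁻¹ else 0) := by
          rw [Finset.sum_comm]
          exact Finset.sum_congr rfl fun D _ => by rw [Finset.mul_sum]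
      _ ≤ ∑ D ∈ Finset.Icc 1 (2 * N), splitWeight P 2 D * (2 * (D : ℝ)⁻¹) :=
          Finset.sum_le_sum fun D hD => mul_le_mul_of_nonneg_left
            (sum_dyadic_block_le _ D (Finset.mem_Icc.mp hD).1) (splitWeight_nonneg _ _ _)
      _ = 2 * V2 := by
          rw [hV2, Finset.mul_sum]
          exact Finset.sum_congr rfl fun D _ => by ring
  have hHsum : ∑ i ∈ Finset.range (Nat.log 2 N + 1), (2 : ℝ) ^ i * H i ≤ 2 * N * V1 := by
    calc _ = ∑ i ∈ Finset.range (Nat.log 2 N + 1), ∑ e ∈ Finset.Icc 1 N, splitWeight P 1 e *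
          (if 2 ^ i ≤ N / e then (2 : ℝ) ^ i else 0) := by
          refine Finset.sum_congr rfl fun i _ => ?_
          have h1 : Finset.Icc 1 (N / 2 ^ i) = (Finset.Icc 1 N).filter fun e => 2 ^ i ≤ N / e := by
            ext e
            simp only [Finset.mem_Icc, Finset.mem_filter, Nat.le_div_iff_mul_le (Nat.two_pow_pos i)]
            constructor
            · rintro ⟨h1, h2⟩
              refine ⟨⟨h1, ?_⟩, ?_⟩
              · exact (Nat.le_mul_of_pos_right e (Nat.two_pow_pos i)).trans h2
              · rw [Nat.le_div_iff_mul_le h1, mul_comm]; exact h2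
            · rintro ⟨⟨h1, h2⟩, h3⟩
              rw [Nat.le_div_iff_mul_le h1, mul_comm] at h3
              exact ⟨h1, h3⟩
          rw [hH]
          simp only [h1]
          rw [Finset.sum_filter, Finset.mul_sum]
          refine Finset.sum_congr rfl fun e _ => ?_
          split_ifs <;> ring
      _ = ∑ e ∈ Finset.Icc 1 N, splitWeight P 1 e *
          ∑ i ∈ Finset.range (Nat.log 2 N + 1) with 2 ^ i ≤ N / e, (2 : ℝ) ^ i := by
          rw [Finset.sum_comm]
          exact Finset.sum_congr rfl fun e _ => by rw [Finset.sum_filter, Finset.mul_sum]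
      _ ≤ ∑ e ∈ Finset.Icc 1 N, splitWeight P 1 e * (2 * (N * (e : ℝ)⁻¹)) := by
          refine Finset.sum_le_sum fun e _ => mul_le_mul_of_nonneg_left
            ((sum_two_pow_le _ _).trans ?_) (splitWeight_nonneg _ _ _)
          rw [← div_eq_mul_inv]
          gcongr
          exact Nat.cast_div_le
      _ = _ := by
          rw [hV1, Finset.mul_sum]
          exact Finset.sum_congr rfl fun e _ => by ring
  calc _ ≤ ∑ i ∈ Finset.range (Nat.log 2 N + 1), (12 * N / L * V1 * (F i * ((2 : ℝ) ^ i)⁻¹) +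
        24 / L * V2 * ((2 : ℝ) ^ i * H i)) := Finset.sum_le_sum hstep
    _ = 12 * N / L * V1 * ∑ i ∈ Finset.range (Nat.log 2 N + 1), F i * ((2 : ℝ) ^ i)⁻¹ +
        24 / L * V2 * ∑ i ∈ Finset.range (Nat.log 2 N + 1), (2 : ℝ) ^ i * H i := by
        rw [Finset.sum_add_distrib, ← Finset.mul_sum, ← Finset.mul_sum]
    _ ≤ 12 * N / L * V1 * (2 * V2) + 24 / L * V2 * (2 * N * V1) := by gcongr
    _ = _ := by ring

/-- The product of the two logarithmic means has order at most `(log N) ^ (3/4)`, up to the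
contribution of the primes dividing `P`. -/
theorem sq_sum_mul_sum_splitWeight_le {P N : ℕ} (hP : Squarefree P) {u : ℝ} (hu : 1 ≤ u)
    (hN : Real.log N = u ^ 32) :
    (∑ n ∈ Finset.Icc 1 N, splitWeight P 1 n * (n : ℝ)⁻¹) *
      ∑ n ∈ Finset.Icc 1 (2 * N), splitWeight P 2 n * (n : ℝ)⁻¹ ≤
      8 * (∑ v ∈ P.divisors, (v : ℝ)⁻¹) * u ^ 24 := by
  classical
  set S := ∑ v ∈ P.divisors, (v : ℝ)⁻¹ with hS
  have hS0 : 0 ≤ S := Finset.sum_nonneg fun _ _ => by positivity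
  have hu0 : 0 < u := by linarith
  have hu32 : 1 ≤ u ^ 32 := one_le_pow₀ hu
  have hN0 : (N : ℝ) ≠ 0 := by
    intro h
    rw [h, Real.log_zero] at hN; linarith
  have hl2 : Real.log 2 < 1 := by linarith [Real.log_two_lt_d9]
  have h1 := sq_sum_splitWeight_le hP 1 N
  have h2 := sq_sum_splitWeight_le hP 2 (2 * N)
  have h3 : ∑ v ∈ Finset.Icc 1 (N ^ 2) with OddRes 1 v, (v : ℝ)⁻¹ ≤ 3 * u ^ 32 := by
    calc _ ≤ ∑ v ∈ Finset.Icc 1 (N ^ 2), (v : ℝ)⁻¹ :=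
          Finset.sum_le_sum_of_subset_of_nonneg (Finset.filter_subset _ _)
            fun _ _ _ => by positivity
      _ ≤ 1 + Real.log ((N ^ 2 : ℕ) : ℝ) := sum_inv_Icc_le _
      _ = 1 + 2 * u ^ 32 := by push_cast; rw [Real.log_pow, hN]; push_cast; ring
      _ ≤ _ := by linarith
  have hns : ¬ IsSquare (2 : ℤ) := by
    rintro ⟨r, hr⟩
    have h5 : r ≤ 1 := by nlinarith
    have h6 : -1 ≤ r := by nlinarith
    interval_cases r <;> omega
  have h4 : ∑ v ∈ Finset.Icc 1 ((2 * N) ^ 2) with OddRes 2 v, (v : ℝ)⁻¹ ≤ 16 * u ^ 16 := by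
    have h5 := sq_sum_oddRes_inv_le two_ne_zero hns ((2 * N) ^ 2)
    refine le_of_sq_le_sq (h5.trans ?_) (by positivity)
    have h6 : Real.log (((2 * N) ^ 2 : ℕ) : ℝ) = 2 * (Real.log 2 + u ^ 32) := by
      push_cast
      rw [Real.log_pow, Real.log_mul (by norm_num) hN0, hN]; push_cast; ring
    have h7 : Real.log (4 * ((2 : ℤ).natAbs : ℝ)) = 3 * Real.log 2 := by
      rw [show (4 * ((2 : ℤ).natAbs : ℝ)) = 2 ^ 3 by norm_num, Real.log_pow]; norm_num
    rw [h6, h7]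
    have hl20 : 0 < Real.log 2 := Real.log_pos (by norm_num)
    calc 4 * ((1 + 2 * (2 * (Real.log 2 + u ^ 32))) * (3 + 3 * Real.log 2))
        ≤ 4 * ((1 + 2 * (2 * (1 + u ^ 32))) * (3 + 3 * 1)) := by gcongr
      _ ≤ 4 * ((9 * u ^ 32) * 6) := by nlinarith
      _ ≤ _ := by nlinarith
  set V1 := ∑ n ∈ Finset.Icc 1 N, splitWeight P 1 n * (n : ℝ)⁻¹
  set V2 := ∑ n ∈ Finset.Icc 1 (2 * N), splitWeight P 2 n * (n : ℝ)⁻¹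
  refine le_of_sq_le_sq ?_ (by positivity)
  calc (V1 * V2) ^ 2 = V1 ^ 2 * V2 ^ 2 := by ring
    _ ≤ (S * (3 * u ^ 32)) * (S * (16 * u ^ 16)) := by
        gcongr
        · exact h1.trans (by gcongr)
        · exact h2.trans (by gcongr)
    _ = 48 * (S ^ 2 * u ^ 48) := by ring
    _ ≤ 64 * (S ^ 2 * u ^ 48) := by gcongr; norm_num
    _ = _ := by ring

theorem not_isSquare_sign_mul {s : ℤ} (hs : s = 1 ∨ s = -1) {D : ℕ} (hD : Squarefree D)
    (h1 : s * (D : ℤ) ≠ 1) : ¬ IsSquare (s * (D : ℤ)) := by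
  have hD0 : (0 : ℤ) < D := by exact_mod_cast Nat.pos_of_ne_zero hD.ne_zero
  rcases hs with rfl | rfl
  · have h2 : D ≠ 1 := by rintro rfl; simp at h1
    have h3 := not_isSquare_mul_of_squarefree hD squarefree_one h2
    rw [one_mul, Int.isSquare_natCast_iff]
    simpa using h3
  · rintro ⟨r, hr⟩
    nlinarith [mul_self_nonneg r]

open Classical in
theorem sum_large_pairs_le_sum_dyadic (N z : ℕ) (s t : ℤ) :
    ∑ D ∈ Finset.Icc 1 N, ∑ e ∈ Finset.Icc 1 (N / D),
      (if (z < D ∧ z < e) ∧ LocalCond s t D e then (1 : ℝ) else 0) ≤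
    ∑ i ∈ Finset.range (Nat.log 2 N + 1), ∑ D ∈ Finset.Icc 1 (2 ^ (i + 1)),
      ∑ e ∈ Finset.Icc 1 (N / 2 ^ i), (if LocalCond s t D e then
        (if (2 ^ i ≤ D ∧ D < 2 ^ (i + 1)) ∧ z < D then (1 : ℝ) else 0) *
          (if z < e then (1 : ℝ) else 0) else 0) := by
  set h : ℕ → ℕ → ℝ := fun i D => ∑ e ∈ Finset.Icc 1 (N / 2 ^ i), (if LocalCond s t D e then
        (if (2 ^ i ≤ D ∧ D < 2 ^ (i + 1)) ∧ z < D then (1 : ℝ) else 0) *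
          (if z < e then (1 : ℝ) else 0) else 0) with hh
  have h0 : ∀ i D, 0 ≤ h i D := fun i D => Finset.sum_nonneg fun e _ => by
    split_ifs <;> norm_num
  have h1 : ∀ D ∈ Finset.Icc 1 N, ∑ e ∈ Finset.Icc 1 (N / D),
      (if (z < D ∧ z < e) ∧ LocalCond s t D e then (1 : ℝ) else 0) ≤
      ∑ i ∈ Finset.range (Nat.log 2 N + 1), h i D := by
    intro D hD
    obtain ⟨hD1, hDN⟩ := Finset.mem_Icc.mp hD
    have hlog : 2 ^ Nat.log 2 D ≤ D := Nat.pow_log_le_self 2 (by omega)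
    have hlog' : D < 2 ^ (Nat.log 2 D + 1) := Nat.lt_pow_succ_log_self (by norm_num) D
    have hmem : Nat.log 2 D ∈ Finset.range (Nat.log 2 N + 1) :=
      Finset.mem_range.mpr (by have := Nat.log_mono_right (b := 2) hDN; omega)
    refine le_trans ?_ (Finset.single_le_sum (f := fun i => h i D) (fun i _ => h0 i D) hmem)
    calc _ ≤ ∑ e ∈ Finset.Icc 1 (N / 2 ^ Nat.log 2 D),
          (if (z < D ∧ z < e) ∧ LocalCond s t D e then (1 : ℝ) else 0) := by
          refine Finset.sum_le_sum_of_subset_of_nonneg ?_ fun _ _ _ => by split_ifs <;> norm_num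
          exact Finset.Icc_subset_Icc_right (Nat.div_le_div_left hlog (Nat.two_pow_pos _))
      _ ≤ _ := by
          refine le_of_eq (Finset.sum_congr rfl fun e _ => ?_)
          by_cases c1 : z < D <;> by_cases c2 : z < e <;> by_cases c3 : LocalCond s t D e <;>
            simp [c1, c2, c3, hlog, hlog']
  calc _ ≤ ∑ D ∈ Finset.Icc 1 N, ∑ i ∈ Finset.range (Nat.log 2 N + 1), h i D :=
        Finset.sum_le_sum h1
    _ = ∑ i ∈ Finset.range (Nat.log 2 N + 1), ∑ D ∈ Finset.Icc 1 N, h i D := Finset.sum_comm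
    _ ≤ _ := by
        refine Finset.sum_le_sum fun i _ => ?_
        rw [← Finset.sum_filter_ne_zero]
        refine Finset.sum_le_sum_of_subset_of_nonneg ?_ fun D _ _ => h0 i D
        intro D hD
        obtain ⟨h2, h3⟩ := Finset.mem_filter.mp hD
        have h4 : D < 2 ^ (i + 1) := by
          by_contra h5
          apply h3
          exact Finset.sum_eq_zero fun e _ => by simp [h5]
        exact Finset.mem_Icc.mpr ⟨(Finset.mem_Icc.mp h2).1, h4.le⟩

open Classical in
/-- Pairs with both entries larger than `z = 2 ^ (8 j)`. -/
theorem sum_large_pairs_le {N j : ℕ} {u : ℝ} (hu : 1 ≤ u) (hN : Real.log N = u ^ 32)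
    (hj : 1 ≤ j) (hjN : 14 * (j : ℝ) ≤ u ^ 32) (s t : ℤ) :
    ∑ D ∈ Finset.Icc 1 N, ∑ e ∈ Finset.Icc 1 (N / D),
      (if (2 ^ (8 * j) < D ∧ 2 ^ (8 * j) < e) ∧ LocalCond s t D e then (1 : ℝ) else 0) ≤
      10 ^ 10 * N * (j ^ 4 / u ^ 8 + u ^ 352 / 2 ^ j) := by
  set z := 2 ^ (8 * j) with hz
  set P := primorial z with hP
  set L := u ^ 32 with hL
  have hu0 : 0 < u := by linarith
  have hj1 : (1 : ℝ) ≤ j := by exact_mod_cast hj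
  have hL14 : 14 ≤ L := by linarith
  have hNpos : 0 < N := Nat.pos_of_ne_zero (by rintro rfl; simp at hN; linarith)
  have hN0 : (0 : ℝ) < N := by exact_mod_cast hNpos
  have hl2 : Real.log 2 < 1 := by linarith [Real.log_two_lt_d9]
  have hl2' : 1 / 2 < Real.log 2 := by linarith [Real.log_two_gt_d9]
  have hz2 : 2 ≤ z := by
    calc 2 = 2 ^ 1 := rfl
      _ ≤ _ := Nat.pow_le_pow_right (by norm_num) (by omega)
  set δ : ℝ := (2 ^ j)⁻¹ with hδ
  have hδ0 : 0 < δ := by positivity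
  have hδz : δ ^ 8 * (z : ℝ) = 1 := by
    rw [hδ, hz]; push_cast
    rw [inv_pow, ← pow_mul, mul_comm j 8]
    exact inv_mul_cancel₀ (by positivity)
  have hlogX : Real.log ((2 * N : ℕ) : ℝ) ≤ 2 * L := by
    push_cast; rw [Real.log_mul (by norm_num) hN0.ne', hN]; linarith
  set σ : ℕ → ℝ := fun e => if z < e then (1 : ℝ) else 0 with hσ
  set ρ : ℕ → ℕ → ℝ := fun i D =>
    if (2 ^ i ≤ D ∧ D < 2 ^ (i + 1)) ∧ z < D then (1 : ℝ) else 0 with hρ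
  have hstep : ∀ i ∈ Finset.range (Nat.log 2 N + 1), ∑ D ∈ Finset.Icc 1 (2 ^ (i + 1)),
      ∑ e ∈ Finset.Icc 1 (N / 2 ^ i), (if LocalCond s t D e then ρ i D * σ e else 0) ≤
      2 * ((∑ D ∈ Finset.Icc 1 (2 ^ (i + 1)),
        (if 2 ^ i ≤ D ∧ D < 2 ^ (i + 1) then splitWeight P 2 D else 0)) *
        ∑ e ∈ Finset.Icc 1 (N / 2 ^ i), splitWeight P 1 e) +
      72 * 9 ^ 8 * N * δ * L ^ 10 := by
    intro i hi
    have hiN : 2 ^ i ≤ N :=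
      (Nat.pow_le_pow_right (by norm_num) (by have := Finset.mem_range.mp hi; omega)).trans
        (Nat.pow_log_le_self 2 hNpos.ne')
    have hAX : 2 ^ (i + 1) ≤ 2 * N := by
      rw [pow_succ, mul_comm]; exact Nat.mul_le_mul_left 2 hiN
    have hEX : N / 2 ^ i ≤ 2 * N := (Nat.div_le_self _ _).trans (by omega)
    have hlogle : ∀ A : ℕ, A ≤ 2 * N → Real.log A ≤ 2 * L := fun A hA => by
      rcases Nat.eq_zero_or_pos A with h | h
      · subst h; simp; linarith
      · exact (Real.log_le_log (by exact_mod_cast h) (by exact_mod_cast hA)).trans hlogX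
    have h1 := sum_localCond_le hz2 hδ0 hδz hAX hEX s t (ρ i) σ
      (fun n => by simp only [hρ]; split_ifs <;> norm_num)
      (fun n => by simp only [hρ]; split_ifs <;> norm_num)
      (fun n => by simp only [hσ]; split_ifs <;> norm_num)
      (fun n => by simp only [hσ]; split_ifs <;> norm_num)
      (fun n hn => by simp only [hρ]; exact if_neg fun h => absurd h.2 (by omega))
      (fun n hn => by simp only [hσ]; exact if_neg (by omega))
    refine h1.trans (add_le_add ?_ ?_)
    · have h2 : ∑ D ∈ Finset.Icc 1 (2 ^ (i + 1)), ρ i D * splitWeight P 2 D ≤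
          ∑ D ∈ Finset.Icc 1 (2 ^ (i + 1)),
            (if 2 ^ i ≤ D ∧ D < 2 ^ (i + 1) then splitWeight P 2 D else 0) := by
        refine Finset.sum_le_sum fun D _ => ?_
        have := splitWeight_nonneg P 2 D
        simp only [hρ]
        by_cases c1 : 2 ^ i ≤ D ∧ D < 2 ^ (i + 1)
        · by_cases c2 : z < D <;> simp [c1, c2, this]
        · rw [if_neg c1, if_neg fun h => c1 h.1, zero_mul]
      have h3 : ∑ e ∈ Finset.Icc 1 (N / 2 ^ i), σ e * splitWeight P 1 e ≤
          ∑ e ∈ Finset.Icc 1 (N / 2 ^ i), splitWeight P 1 e := by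
        refine Finset.sum_le_sum fun e _ => ?_
        have := splitWeight_nonneg P 1 e
        simp only [hσ]
        split_ifs <;> simp [this]
      have h4 : 0 ≤ ∑ e ∈ Finset.Icc 1 (N / 2 ^ i), σ e * splitWeight P 1 e :=
        Finset.sum_nonneg fun e _ => mul_nonneg (by simp only [hσ]; split_ifs <;> norm_num)
          (splitWeight_nonneg _ _ _)
      have h5 : 0 ≤ ∑ D ∈ Finset.Icc 1 (2 ^ (i + 1)),
          (if 2 ^ i ≤ D ∧ D < 2 ^ (i + 1) then splitWeight P 2 D else 0) :=
        Finset.sum_nonneg fun D _ => by split_ifs; exacts [splitWeight_nonneg _ _ _, le_rfl]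
      exact mul_le_mul_of_nonneg_left (mul_le_mul h2 h3 h4 h5) (by norm_num)
    · have h2 : ((2 ^ (i + 1) : ℕ) : ℝ) * (N / 2 ^ i : ℕ) ≤ 2 * N := by
        have h3 : 2 ^ (i + 1) * (N / 2 ^ i) ≤ 2 * N := by
          rw [pow_succ, mul_comm (2 ^ i) 2, mul_assoc]
          exact Nat.mul_le_mul_left 2 (Nat.mul_div_le N (2 ^ i))
        exact_mod_cast h3
      have h4 := hlogle _ hAX
      have h5 := hlogle _ hEX
      have h6 : 0 ≤ Real.log (2 ^ (i + 1) : ℕ) := Real.log_natCast_nonneg _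
      have h7 : 0 ≤ Real.log (N / 2 ^ i : ℕ) := Real.log_natCast_nonneg _
      have h8 : 0 ≤ Real.log (2 * N : ℕ) := Real.log_natCast_nonneg _
      calc 4 * (1 + 4 * Real.log (2 * N : ℕ)) ^ 8 * δ * (2 ^ (i + 1) : ℕ) * (N / 2 ^ i : ℕ) *
            ((1 + Real.log (2 ^ (i + 1) : ℕ)) * (1 + Real.log (N / 2 ^ i : ℕ)))
          = 4 * (1 + 4 * Real.log (2 * N : ℕ)) ^ 8 * δ *
            (((2 ^ (i + 1) : ℕ) : ℝ) * (N / 2 ^ i : ℕ)) *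
            ((1 + Real.log (2 ^ (i + 1) : ℕ)) * (1 + Real.log (N / 2 ^ i : ℕ))) := by ring
        _ ≤ 4 * (9 * L) ^ 8 * δ * (2 * N) * ((3 * L) * (3 * L)) := by
            gcongr <;> linarith
        _ = _ := by ring
  have hcount : ((Nat.log 2 N + 1 : ℕ) : ℝ) ≤ 3 * L := by
    have h1 := Real.natLog_le_logb N 2
    rw [Real.logb, hN] at h1
    have h2 : L / Real.log ((2 : ℕ) : ℝ) ≤ 2 * L := by
      rw [div_le_iff₀ (by push_cast; linarith)]
      push_cast; nlinarith
    push_cast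
    linarith
  have hS : ∑ v ∈ P.divisors, (v : ℝ)⁻¹ ≤ 10 ^ 6 * (j : ℝ) ^ 4 := by
    refine (sum_divisors_primorial_inv_le (8 * j) (by omega)).trans ?_
    have h1 : Real.exp 5 ≤ 243 := by
      have := Real.exp_one_lt_d9
      calc Real.exp 5 = Real.exp 1 ^ 5 := by rw [← Real.exp_nat_mul]; norm_num
        _ ≤ 3 ^ 5 := by gcongr; linarith
        _ = 243 := by norm_num
    push_cast
    calc Real.exp 5 * (8 * (j : ℝ)) ^ 4 ≤ 243 * (8 * (j : ℝ)) ^ 4 := by gcongr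
      _ = 995328 * (j : ℝ) ^ 4 := by ring
      _ ≤ _ := by gcongr; norm_num
  have hmain := sum_dyadic_splitWeight_le P (N := N) (by rw [hN]; exact hL14)
  have hV := sq_sum_mul_sum_splitWeight_le (P := P) (N := N) (squarefree_primorial _) hu hN
  have hmain' : ∑ i ∈ Finset.range (Nat.log 2 N + 1),
      (∑ D ∈ Finset.Icc 1 (2 ^ (i + 1)),
        (if 2 ^ i ≤ D ∧ D < 2 ^ (i + 1) then splitWeight P 2 D else 0)) *
        ∑ e ∈ Finset.Icc 1 (N / 2 ^ i), splitWeight P 1 e ≤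
      576 * 10 ^ 6 * N * (j ^ 4 / u ^ 8) := by
    refine hmain.trans ?_
    rw [hN]
    calc _ ≤ 72 * N / L * (8 * (10 ^ 6 * (j : ℝ) ^ 4) * u ^ 24) := by
          refine mul_le_mul_of_nonneg_left (hV.trans ?_) (by positivity)
          gcongr
      _ = _ := by rw [hL]; field_simp; ring
  calc _ ≤ _ := sum_large_pairs_le_sum_dyadic N z s t
    _ ≤ ∑ i ∈ Finset.range (Nat.log 2 N + 1), (2 * ((∑ D ∈ Finset.Icc 1 (2 ^ (i + 1)),
        (if 2 ^ i ≤ D ∧ D < 2 ^ (i + 1) then splitWeight P 2 D else 0)) *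
        ∑ e ∈ Finset.Icc 1 (N / 2 ^ i), splitWeight P 1 e) +
      72 * 9 ^ 8 * N * δ * L ^ 10) := Finset.sum_le_sum hstep
    _ = 2 * ∑ i ∈ Finset.range (Nat.log 2 N + 1), ((∑ D ∈ Finset.Icc 1 (2 ^ (i + 1)),
        (if 2 ^ i ≤ D ∧ D < 2 ^ (i + 1) then splitWeight P 2 D else 0)) *
        ∑ e ∈ Finset.Icc 1 (N / 2 ^ i), splitWeight P 1 e) +
      ((Nat.log 2 N + 1 : ℕ) : ℝ) * (72 * 9 ^ 8 * N * δ * L ^ 10) := by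
        rw [Finset.sum_add_distrib, ← Finset.mul_sum, Finset.sum_const, Finset.card_range,
          nsmul_eq_mul]
    _ ≤ 2 * (576 * 10 ^ 6 * N * (j ^ 4 / u ^ 8)) +
        (3 * L) * (72 * 9 ^ 8 * N * δ * L ^ 10) := by gcongr
    _ = 1152 * 10 ^ 6 * N * (j ^ 4 / u ^ 8) + 216 * 9 ^ 8 * N * (u ^ 352 / 2 ^ j) := by
        rw [hL, hδ]; ring
    _ ≤ 10 ^ 10 * N * (j ^ 4 / u ^ 8) + 10 ^ 10 * N * (u ^ 352 / 2 ^ j) := by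
        gcongr <;> norm_num
    _ = _ := by ring

open Classical in
/-- The number of pairs `(D, e)` with `De ≤ N` and `sD ≠ 1` that satisfy the local conditions. Let
`z = 2 ^ (8 j)`. For `D ≤ z` the condition at the primes dividing `e`, and for `e ≤ z` the splitting
of the primes dividing `D` in `ℚ(√2)`, save a factor `(log N) ^ (1/2)`, up to a power of `j`. -/
theorem sum_localCond_ne_one_le {N j : ℕ} {u : ℝ} (hu : 1 ≤ u) (hN : Real.log N = u ^ 32)
    (hj : 1 ≤ j) (hjN : 14 * (j : ℝ) ≤ u ^ 32) {s : ℤ} (hs : s = 1 ∨ s = -1) (t : ℤ) :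
    ∑ D ∈ Finset.Icc 1 N, ∑ e ∈ Finset.Icc 1 (N / D),
      (if LocalCond s t D e ∧ s * (D : ℤ) ≠ 1 then (1 : ℝ) else 0) ≤
      2 * 10 ^ 10 * N * (j ^ 4 / u ^ 8 + u ^ 352 / 2 ^ j) := by
  set z := 2 ^ (8 * j) with hz
  set L := u ^ 32 with hL
  have hu0 : 0 < u := by linarith
  have hj1 : (1 : ℝ) ≤ j := by exact_mod_cast hj
  have hL14 : 14 ≤ L := by linarith
  have hl2 : Real.log 2 < 0.7 := by linarith [Real.log_two_lt_d9]
  have hl20 : 0 < Real.log 2 := Real.log_pos (by norm_num)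
  have hlogz : Real.log z ≤ 6 * j := by
    rw [hz]; push_cast; rw [Real.log_pow]; push_cast; nlinarith
  have hz1 : 1 ≤ z := Nat.one_le_two_pow
  have hlogle : ∀ a : ℕ, 1 ≤ a → a ≤ z → Real.log a ≤ 6 * j := fun a h1 h2 =>
    (Real.log_le_log (by exact_mod_cast h1) (by exact_mod_cast h2)).trans hlogz
  have hlong : ∀ a : ℕ, 1 ≤ a → a ≤ z → Real.log N ≤ 4 * Real.log (N / a : ℕ) := fun a h1 h2 => by
    refine log_le_four_mul_log_div h1 ?_
    have := hlogle a h1 h2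
    rw [hN]; linarith
  have hsqrt : ∀ y : ℝ, y ≤ 2 + 6 * j → √((1 + 2 * Real.log N) * (3 + y)) ≤ 6 * u ^ 16 * j := by
    intro y hy
    refine Real.sqrt_le_iff.mpr ⟨by positivity, ?_⟩
    rw [hN]
    calc (1 + 2 * L) * (3 + y) ≤ (1 + 2 * L) * (3 + (2 + 6 * j)) := by gcongr
      _ ≤ (3 * L) * (11 * j) := by gcongr <;> linarith
      _ ≤ 36 * L * (j * j) := by
          nlinarith [mul_nonneg (by linarith : (0 : ℝ) ≤ L)
            (by nlinarith : (0 : ℝ) ≤ (j : ℝ) * j - j)]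
      _ = _ := by rw [hL]; ring
  have hlN : 0 < Real.log N := by rw [hN]; linarith
  have hcount : ∀ (a : ℤ) (E : ℕ), a ≠ 0 → ¬ IsSquare a → Real.log (4 * a.natAbs) ≤ 2 + 6 * j →
      E ≤ N → Real.log N ≤ 4 * Real.log E →
      ∑ n ∈ Finset.Icc 1 E, splitWeight 0 a n ≤ 144 * j / u ^ 16 * E := by
    intro a E ha0 ha hla hEN hLE
    refine (sum_splitWeight_zero_le ha0 ha hlN hEN hLE).trans ?_
    calc _ ≤ 24 * E / Real.log N * (6 * u ^ 16 * j) := by gcongr; exact hsqrt _ hla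
      _ = _ := by rw [hN, hL]; field_simp; ring
  have hc0 : 0 ≤ 144 * (j : ℝ) / u ^ 16 := by positivity
  set I : ℕ → ℕ → ℝ := fun D e => if LocalCond s t D e ∧ s * (D : ℤ) ≠ 1 then (1 : ℝ) else 0 with hI
  have hI0 : ∀ D e, 0 ≤ I D e := fun D e => by simp only [hI]; split_ifs <;> norm_num
  have hlog4 : Real.log 4 ≤ 2 := by
    rw [show (4 : ℝ) = 2 ^ 2 by norm_num, Real.log_pow]; push_cast; linarith
  have hR1 : ∑ D ∈ Finset.Icc 1 N, ∑ e ∈ Finset.Icc 1 (N / D), (if D ≤ z then I D e else 0) ≤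
      144 * j / u ^ 16 * N * (1 + Real.log z) := by
    refine sum_small_le hc0 I fun D hD1 hDz => ?_
    by_cases h : Squarefree D ∧ s * (D : ℤ) ≠ 1
    · have hnat : (s * (D : ℤ)).natAbs = D := by
        rcases hs with rfl | rfl <;> simp
      refine le_trans (Finset.sum_le_sum fun e _ => ?_) (hcount (s * (D : ℤ)) (N / D) ?_
        (not_isSquare_sign_mul hs h.1 h.2) ?_ (Nat.div_le_self _ _) (hlong D hD1 hDz))
      · simp only [hI]
        split_ifs with hc
        · rw [splitWeight_zero_of hc.1.1.of_mul_right hc.1.2.2.1]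
        · exact splitWeight_nonneg _ _ _
      · intro h0
        rw [h0] at hnat
        simp at hnat
        omega
      · rw [hnat, Real.log_mul (by norm_num) (by positivity)]
        linarith [hlogle D hD1 hDz]
    · rw [Finset.sum_eq_zero]
      · positivity
      · intro e _
        simp only [hI]
        exact if_neg fun hc => h ⟨hc.1.1.of_mul_left, hc.2⟩
  have hR2 : ∑ D ∈ Finset.Icc 1 N, ∑ e ∈ Finset.Icc 1 (N / D), (if e ≤ z then I D e else 0) ≤
      144 * j / u ^ 16 * N * (1 + Real.log z) := by
    rw [sum_Icc_sum_Icc_div_comm N fun D e => if e ≤ z then I D e else 0]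
    refine sum_small_le hc0 (fun e D => I D e) fun e he1 hez => ?_
    refine le_trans (Finset.sum_le_sum fun D _ => ?_) (hcount 2 (N / e) two_ne_zero
      (by simpa using not_isSquare_sign_mul (Or.inl rfl) Nat.squarefree_two (by norm_num)) ?_
      (Nat.div_le_self _ _) (hlong e he1 hez))
    · simp only [hI]
      split_ifs with hc
      · rw [splitWeight_zero_of hc.1.1.of_mul_left hc.1.2.1]
      · exact splitWeight_nonneg _ _ _
    · rw [show (4 * ((2 : ℤ).natAbs : ℝ)) = 4 * 2 by norm_num,
        Real.log_mul (by norm_num) (by norm_num)]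
      linarith
  have hR3 := sum_large_pairs_le hu hN hj hjN s t
  have hsmall : 144 * j / u ^ 16 * N * (1 + Real.log z) ≤ 1008 * N * (j ^ 4 / u ^ 8) := by
    have hjj : (j : ℝ) ^ 2 ≤ (j : ℝ) ^ 4 := pow_le_pow_right₀ hj1 (by norm_num)
    have huu : u ^ 8 ≤ u ^ 16 := pow_le_pow_right₀ hu (by norm_num)
    calc _ ≤ 144 * j / u ^ 16 * N * (7 * j) := by gcongr; linarith
      _ = 1008 * N * (j ^ 2 / u ^ 16) := by ring
      _ ≤ _ := by gcongr
  have hsplit : ∀ D e, I D e ≤ (if D ≤ z then I D e else 0) + (if e ≤ z then I D e else 0) +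
      (if (z < D ∧ z < e) ∧ LocalCond s t D e then (1 : ℝ) else 0) := by
    intro D e
    have h0 := hI0 D e
    by_cases c1 : D ≤ z
    · rw [if_pos c1]; split_ifs <;> linarith
    · by_cases c2 : e ≤ z
      · rw [if_pos c2]; split_ifs <;> linarith
      · rw [if_neg c1, if_neg c2, zero_add, zero_add]
        simp only [hI]
        split_ifs with c3 c4 c5
        · exact le_rfl
        · exact absurd ⟨⟨not_le.mp c1, not_le.mp c2⟩, c3.1⟩ c4
        · norm_num
        · exact le_rfl
  have hpos : 0 ≤ (N : ℝ) * (u ^ 352 / 2 ^ j) := by positivity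
  have hpos' : 0 ≤ (N : ℝ) * (j ^ 4 / u ^ 8) := by positivity
  calc _ ≤ ∑ D ∈ Finset.Icc 1 N, ∑ e ∈ Finset.Icc 1 (N / D),
        ((if D ≤ z then I D e else 0) + (if e ≤ z then I D e else 0) +
          (if (z < D ∧ z < e) ∧ LocalCond s t D e then (1 : ℝ) else 0)) :=
        Finset.sum_le_sum fun D _ => Finset.sum_le_sum fun e _ => hsplit D e
    _ ≤ _ := by
        simp only [Finset.sum_add_distrib]
        have := add_le_add (add_le_add (hR1.trans hsmall) (hR2.trans hsmall)) hR3
        refine this.trans ?_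
        nlinarith

theorem tendsto_div_pow_add_pow_div_two_rpow :
    Tendsto (fun u : ℝ => 16 / u ^ 4 + u ^ 352 / (2 : ℝ) ^ u) atTop (𝓝 0) := by
  have h1 : Tendsto (fun u : ℝ => 16 / u ^ 4) atTop (𝓝 0) :=
    Tendsto.div_atTop tendsto_const_nhds (tendsto_pow_atTop (by norm_num))
  have hl2 : 0 < Real.log 2 := Real.log_pos (by norm_num)
  have h2 : Tendsto (fun u : ℝ => u ^ 352 / (2 : ℝ) ^ u) atTop (𝓝 0) := by
    have h3 := (Real.tendsto_pow_mul_exp_neg_atTop_nhds_zero 352).comp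
      (tendsto_id.const_mul_atTop hl2)
    have h4 := h3.const_mul ((Real.log 2 ^ 352)⁻¹)
    rw [mul_zero] at h4
    refine h4.congr fun u => ?_
    simp only [Function.comp, id]
    rw [Real.rpow_def_of_pos (by norm_num), mul_pow, Real.exp_neg]
    field_simp
  simpa using h1.add h2

open Classical in
/-- Pairs satisfying the local conditions with `sD ≠ 1` and `De ≤ N` are rare. -/
theorem tendsto_sum_localCond_div {s : ℤ} (hs : s = 1 ∨ s = -1) (t : ℤ) :
    Tendsto (fun N : ℕ => (∑ D ∈ Finset.Icc 1 N, ∑ e ∈ Finset.Icc 1 (N / D),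
      (if LocalCond s t D e ∧ s * (D : ℤ) ≠ 1 then (1 : ℝ) else 0)) / N) atTop (𝓝 0) := by
  have hu : Tendsto (fun N : ℕ => (Real.log N) ^ (1 / 32 : ℝ)) atTop atTop :=
    (tendsto_rpow_atTop (by norm_num)).comp
      (Real.tendsto_log_atTop.comp tendsto_natCast_atTop_atTop)
  have h1 := (tendsto_div_pow_add_pow_div_two_rpow.comp hu).const_mul (2 * 10 ^ 10 : ℝ)
  rw [mul_zero] at h1
  refine squeeze_zero' (Eventually.of_forall fun N => ?_) ?_ h1
  · exact div_nonneg (Finset.sum_nonneg fun D _ => Finset.sum_nonneg fun e _ => by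
      split_ifs <;> norm_num) (by positivity)
  filter_upwards [hu.eventually_ge_atTop 2, eventually_ge_atTop 1] with N hu2 hN1
  set u := (Real.log N) ^ (1 / 32 : ℝ) with hudef
  have hlog : Real.log N = u ^ 32 := by
    rw [hudef, ← Real.rpow_natCast, ← Real.rpow_mul (Real.log_natCast_nonneg N)]
    norm_num
  have hN0 : (0 : ℝ) < N := by exact_mod_cast hN1
  have hj1 : 1 ≤ ⌈u⌉₊ := Nat.one_le_ceil_iff.mpr (by linarith)
  have hjle : (⌈u⌉₊ : ℝ) ≤ 2 * u := by
    have := Nat.ceil_lt_add_one (by linarith : 0 ≤ u)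
    linarith
  have hj14 : 14 * (⌈u⌉₊ : ℝ) ≤ u ^ 32 := by
    have h2 : (2 : ℝ) ^ 31 ≤ u ^ 31 := by gcongr
    have h3 : 28 * u ≤ u ^ 31 * u := by gcongr; linarith
    calc 14 * (⌈u⌉₊ : ℝ) ≤ 28 * u := by linarith
      _ ≤ u ^ 31 * u := h3
      _ = _ := by ring
  have h2 := sum_localCond_ne_one_le (by linarith) hlog hj1 hj14 hs t
  rw [div_le_iff₀ hN0]
  refine h2.trans ?_
  simp only [Function.comp]
  have h3 : (⌈u⌉₊ : ℝ) ^ 4 / u ^ 8 ≤ 16 / u ^ 4 := by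
    calc (⌈u⌉₊ : ℝ) ^ 4 / u ^ 8 ≤ (2 * u) ^ 4 / u ^ 8 := by gcongr
      _ = _ := by field_simp; norm_num
  have h4 : u ^ 352 / 2 ^ ⌈u⌉₊ ≤ u ^ 352 / (2 : ℝ) ^ u := by
    gcongr
    rw [← Real.rpow_natCast]
    exact Real.rpow_le_rpow_of_exponent_le (by norm_num) (Nat.le_ceil u)
  calc 2 * 10 ^ 10 * N * ((⌈u⌉₊ : ℝ) ^ 4 / u ^ 8 + u ^ 352 / 2 ^ ⌈u⌉₊)
      ≤ 2 * 10 ^ 10 * N * (16 / u ^ 4 + u ^ 352 / (2 : ℝ) ^ u) := by gcongr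
    _ = _ := by ring

/-! ### Local solubility at odd primes -/

namespace BinaryQuartic

/-- A point over `ℚ_p` can be scaled to have integral coordinates, one of the first two being `1`. -/
theorem HasPoint.exists_padicInt {p : ℕ} [Fact p.Prime] {A B C : ℤ}
    (h : HasPoint ℚ_[p] ⟨A, 0, B, 0, C⟩) :
    ∃ x y z : ℤ_[p], (x = 1 ∨ y = 1) ∧
      z ^ 2 = (A : ℤ_[p]) * x ^ 4 + B * x ^ 2 * y ^ 2 + C * y ^ 4 := by
  obtain ⟨x, y, z, hxy, hz⟩ := h
  simp only [eval, Int.cast_zero, zero_mul, add_zero] at hz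
  have integral : ∀ (w : ℚ_[p]) (v : ℤ_[p]), w ^ 2 = v → ‖w‖ ≤ 1 := by
    intro w v hw
    have h1 : ‖w‖ ^ 2 ≤ 1 := by rw [← norm_pow, hw]; exact v.2
    exact (sq_le_one_iff₀ (norm_nonneg w)).mp h1
  rcases le_total ‖y‖ ‖x‖ with hle | hle
  · have hx : x ≠ 0 := by
      rintro rfl
      rw [norm_zero] at hle
      have : y = 0 := norm_le_zero_iff.mp hle
      simp [this] at hxy
    have hY : ‖y / x‖ ≤ 1 := by
      rw [norm_div]; exact div_le_one_of_le₀ hle (norm_nonneg x)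
    set Y : ℤ_[p] := ⟨y / x, hY⟩ with hYdef
    have hYc : (Y : ℚ_[p]) = y / x := rfl
    have hZ : (z / x ^ 2) ^ 2 =
        ((A * 1 ^ 4 + B * 1 ^ 2 * Y ^ 2 + C * Y ^ 4 : ℤ_[p]) : ℚ_[p]) := by
      push_cast
      rw [hYc, div_pow, hz]
      field_simp
    refine ⟨1, Y, ⟨z / x ^ 2, integral _ _ hZ⟩, Or.inl rfl, ?_⟩
    exact Subtype.ext hZ
  · have hy : y ≠ 0 := by
      rintro rfl
      rw [norm_zero] at hle
      have : x = 0 := norm_le_zero_iff.mp hle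
      simp [this] at hxy
    have hX : ‖x / y‖ ≤ 1 := by
      rw [norm_div]; exact div_le_one_of_le₀ hle (norm_nonneg y)
    set X : ℤ_[p] := ⟨x / y, hX⟩ with hXdef
    have hXc : (X : ℚ_[p]) = x / y := rfl
    have hZ : (z / y ^ 2) ^ 2 =
        ((A * X ^ 4 + B * X ^ 2 * 1 ^ 2 + C * 1 ^ 4 : ℤ_[p]) : ℚ_[p]) := by
      push_cast
      rw [hXc, div_pow, hz]
      field_simp
    refine ⟨X, 1, ⟨z / y ^ 2, integral _ _ hZ⟩, Or.inr rfl, ?_⟩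
    exact Subtype.ext hZ

end BinaryQuartic

theorem PadicInt.toZMod_eq_zero_iff_dvd {p : ℕ} [Fact p.Prime] (x : ℤ_[p]) :
    PadicInt.toZMod x = 0 ↔ (p : ℤ_[p]) ∣ x := by
  rw [← RingHom.mem_ker, PadicInt.ker_toZMod, PadicInt.maximalIdeal_eq_span_p,
    Ideal.mem_span_singleton]

theorem jacobiSym_eq_one_of_isSquare {p : ℕ} [Fact p.Prime] {a : ℤ} (ha : (a : ZMod p) ≠ 0)
    (h : IsSquare (a : ZMod p)) : jacobiSym a p = 1 := by
  rw [← jacobiSym.legendreSym.to_jacobiSym]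
  exact (legendreSym.eq_one_iff p ha).mpr h

/-- If `p` exactly divides `e` and `a (x⁴ + 6 κ e x² y² + e² y⁴)` represents a square over `ℚ_p`,
then `a` is a square modulo `p`. -/
theorem isSquare_of_hasPoint_of_dvd_right {p : ℕ} [Fact p.Prime] {a e κ : ℤ} (hpe : (p : ℤ) ∣ e)
    (hpe2 : ¬ (p : ℤ) * p ∣ e)
    (h : BinaryQuartic.HasPoint ℚ_[p] ⟨a, 0, 6 * κ * a * e, 0, a * e ^ 2⟩) :
    IsSquare (a : ZMod p) := by
  obtain ⟨x, y, z, hxy, hz⟩ := h.exists_padicInt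
  obtain ⟨e', rfl⟩ := hpe
  have hp0 : (p : ℤ_[p]) ≠ 0 := by exact_mod_cast (Fact.out : p.Prime).ne_zero
  have he' : (e' : ZMod p) ≠ 0 := by
    rw [Ne, ZMod.intCast_zmod_eq_zero_iff_dvd]
    exact fun h => hpe2 (mul_dvd_mul_left _ h)
  have hmod := congrArg (PadicInt.toZMod (p := p)) hz
  simp only [map_add, map_mul, map_pow, map_intCast, Int.cast_mul, Int.cast_natCast, Int.cast_pow,
    CharP.cast_eq_zero, zero_mul, mul_zero, ne_eq, OfNat.ofNat_ne_zero, not_false_eq_true,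
    zero_pow, add_zero, map_natCast] at hmod
  by_cases hx : PadicInt.toZMod x = 0
  · have hy : y = 1 := hxy.resolve_left (by rintro rfl; simp at hx)
    subst hy
    obtain ⟨X, rfl⟩ := (PadicInt.toZMod_eq_zero_iff_dvd x).mp hx
    have hpz : (p : ℤ_[p]) ∣ z := by
      refine PadicInt.prime_p.dvd_of_dvd_pow (n := 2) ?_
      rw [hz]; push_cast
      exact ⟨a * (p ^ 3 * X ^ 4 + 6 * κ * p ^ 2 * e' * X ^ 2 + p * e' ^ 2), by ring⟩
    obtain ⟨Z, rfl⟩ := hpz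
    have h1 : Z ^ 2 = a * (p ^ 2 * X ^ 4 + 6 * κ * p * e' * X ^ 2 + e' ^ 2) := by
      refine mul_left_cancel₀ (pow_ne_zero 2 hp0) ?_
      push_cast at hz
      linear_combination hz
    have h2 := congrArg (PadicInt.toZMod (p := p)) h1
    simp only [map_add, map_mul, map_pow, map_intCast, map_natCast, CharP.cast_eq_zero, zero_mul,
      mul_zero, ne_eq, OfNat.ofNat_ne_zero, not_false_eq_true, zero_pow, zero_add] at h2
    refine ⟨PadicInt.toZMod Z / e', ?_⟩
    field_simp
    linear_combination -h2
  · refine ⟨PadicInt.toZMod z / PadicInt.toZMod x ^ 2, ?_⟩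
    field_simp
    linear_combination -hmod

/-- If `p` is odd, exactly divides `a`, does not divide `e`, and
`a (x⁴ + 6 κ e x² y² + e² y⁴)` with `κ = ±1` represents a square over `ℚ_p`, then the quartic has a
zero modulo `p`; completing the square in two ways shows that `2` and `-κ e` are squares. -/
theorem isSquare_of_hasPoint_of_dvd_left {p : ℕ} [Fact p.Prime] (hp2 : p ≠ 2) {a e κ : ℤ}
    (hκ : κ ^ 2 = 1) (hpa : (p : ℤ) ∣ a) (hpa2 : ¬ (p : ℤ) * p ∣ a) (hpe : ¬ (p : ℤ) ∣ e)
    (h : BinaryQuartic.HasPoint ℚ_[p] ⟨a, 0, 6 * κ * a * e, 0, a * e ^ 2⟩) :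
    IsSquare (2 : ZMod p) ∧ IsSquare ((-κ * e : ℤ) : ZMod p) := by
  obtain ⟨x, y, z, hxy, hz⟩ := h.exists_padicInt
  obtain ⟨a', rfl⟩ := hpa
  have hp0 : (p : ℤ_[p]) ≠ 0 := by exact_mod_cast (Fact.out : p.Prime).ne_zero
  have ha' : (a' : ZMod p) ≠ 0 := by
    rw [Ne, ZMod.intCast_zmod_eq_zero_iff_dvd]
    exact fun h => hpa2 (mul_dvd_mul_left _ h)
  have he : (e : ZMod p) ≠ 0 := by rwa [Ne, ZMod.intCast_zmod_eq_zero_iff_dvd]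
  have h2 : (2 : ZMod p) ≠ 0 := by
    intro h
    have h' : ((2 : ℕ) : ZMod p) = 0 := by exact_mod_cast h
    rw [ZMod.natCast_eq_zero_iff] at h'
    exact hp2 ((Nat.prime_dvd_prime_iff_eq Fact.out Nat.prime_two).mp h')
  have hκ' : (κ : ZMod p) ^ 2 = 1 := by exact_mod_cast congrArg (Int.cast : ℤ → ZMod p) hκ
  have hpz : (p : ℤ_[p]) ∣ z := by
    refine PadicInt.prime_p.dvd_of_dvd_pow (n := 2) ?_
    rw [hz]; push_cast
    exact ⟨a' * (x ^ 4 + 6 * κ * e * x ^ 2 * y ^ 2 + e ^ 2 * y ^ 4), by ring⟩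
  obtain ⟨Z, rfl⟩ := hpz
  have h1 : p * Z ^ 2 = a' * (x ^ 4 + 6 * κ * e * x ^ 2 * y ^ 2 + e ^ 2 * y ^ 4) := by
    refine mul_left_cancel₀ hp0 ?_
    push_cast at hz
    linear_combination hz
  have h3 := congrArg (PadicInt.toZMod (p := p)) h1
  simp only [map_add, map_mul, map_pow, map_intCast, map_natCast, CharP.cast_eq_zero, zero_mul,
    map_ofNat] at h3
  have hg := (mul_eq_zero.mp h3.symm).resolve_left ha'
  have hxy' : PadicInt.toZMod x ≠ 0 ∨ PadicInt.toZMod y ≠ 0 := by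
    rcases hxy with rfl | rfl
    · left; simp
    · right; simp
  set X := PadicInt.toZMod x
  set Y := PadicInt.toZMod y
  have hY : Y ≠ 0 := by
    intro hY
    have hX := hxy'.resolve_right (not_not.mpr hY)
    rw [hY] at hg
    simp at hg
    exact hX hg
  have hX : X ≠ 0 := by
    intro hX
    rw [hX] at hg
    simp at hg
    exact hg.elim he hY
  constructor
  · refine ⟨(X ^ 2 + 3 * κ * e * Y ^ 2) / (2 * e * Y ^ 2), ?_⟩
    field_simp
    linear_combination -hg - 9 * (e : ZMod p) ^ 2 * Y ^ 4 * hκ'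
  · refine ⟨(X ^ 2 + κ * e * Y ^ 2) / (2 * X * Y), ?_⟩
    push_cast
    field_simp
    linear_combination -hg - (e : ZMod p) ^ 2 * Y ^ 4 * hκ'

/-- The local conditions at odd primes satisfied by a locally soluble form
`a (x⁴ + 6 κ e x² y² + e² y⁴)`, where `a = sD`. -/
theorem localCond_of_hasPoint {s κ : ℤ} (hs : s = 1 ∨ s = -1) (hκ : κ ^ 2 = 1) {D e : ℕ}
    (hDe : Squarefree (D * e))
    (h : ∀ (p : ℕ) [Fact p.Prime], BinaryQuartic.HasPoint ℚ_[p]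
      ⟨s * D, 0, 6 * κ * (s * D) * e, 0, (s * D) * (e : ℤ) ^ 2⟩) :
    LocalCond s (-κ) D e := by
  have hD := hDe.of_mul_left
  have he := hDe.of_mul_right
  have hcop := Nat.coprime_of_squarefree_mul hDe
  have hsdvd : ∀ m : ℤ, m ∣ s * D ↔ m ∣ D := fun m => by
    rcases hs with rfl | rfl <;> simp
  have hnot : ∀ {p n : ℕ}, p.Prime → Squarefree n → ¬ (p : ℤ) * p ∣ (n : ℤ) := by
    intro p n hp hn hdvd
    exact hp.not_isUnit (hn p (by exact_mod_cast hdvd))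
  have hleft : ∀ p : ℕ, p.Prime → p ∣ D → p ≠ 2 →
      jacobiSym 2 p = 1 ∧ jacobiSym (-κ * (e : ℤ)) p = 1 := by
    intro p hp hpD hp2
    have := Fact.mk hp
    have hpe : ¬ (p : ℤ) ∣ (e : ℤ) := by
      intro hdvd
      exact hp.ne_one (Nat.eq_one_of_dvd_coprimes hcop hpD (by exact_mod_cast hdvd))
    obtain ⟨h1, h2⟩ := isSquare_of_hasPoint_of_dvd_left hp2 hκ
      ((hsdvd _).mpr (by exact_mod_cast hpD)) (fun hdvd => hnot hp hD ((hsdvd _).mp hdvd)) hpe (h p)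
    constructor
    · refine jacobiSym_eq_one_of_isSquare ?_ (by exact_mod_cast h1)
      rw [Ne, ZMod.intCast_zmod_eq_zero_iff_dvd]
      intro hdvd
      exact hp2 ((Nat.prime_dvd_prime_iff_eq hp Nat.prime_two).mp (by exact_mod_cast hdvd))
    · refine jacobiSym_eq_one_of_isSquare ?_ h2
      rw [Ne, ZMod.intCast_zmod_eq_zero_iff_dvd]
      rcases sq_eq_one_iff.mp hκ with rfl | rfl <;> simpa using hpe
  refine ⟨hDe, fun p hp hpD hp2 => (hleft p hp hpD hp2).1, fun p hp hpe hp2 => ?_,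
    fun p hp hpD hp2 => (hleft p hp hpD hp2).2⟩
  have := Fact.mk hp
  refine jacobiSym_eq_one_of_isSquare ?_ (isSquare_of_hasPoint_of_dvd_right
    (by exact_mod_cast hpe) (hnot hp he) (h p))
  rw [Ne, ZMod.intCast_zmod_eq_zero_iff_dvd, hsdvd]
  intro hdvd
  exact hp.ne_one (Nat.eq_one_of_dvd_coprimes hcop (by exact_mod_cast hdvd) hpe)

/-! ### Counting the forms -/

namespace BinaryQuartic

theorem HasPoint.of_rat {f : BinaryQuartic} (h : f.HasPoint ℚ) (K : Type*) [Field K] [CharZero K] :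
    f.HasPoint K := by
  obtain ⟨x, y, z, hxy, hz⟩ := h
  refine ⟨x, y, z, ?_, ?_⟩
  · simpa using hxy
  · have := congrArg (fun q : ℚ => (q : K)) hz
    simpa [eval] using this

theorem Fsol_subset_Fls (B M : ℤ) : Fsol B M ⊆ Fls B M :=
  fun _ hf => ⟨hf.1, hf.2.of_rat ℝ, fun p _ => hf.2.of_rat ℚ_[p]⟩

/-- The form with leading coefficient `1` has the rational point `(1 : 0 : 1)`. -/
theorem one_le_ncard_Fsol (B : ℤ) {M : ℤ} (hM : M ≠ 0) : 1 ≤ (Fsol B M).ncard := by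
  refine (Set.ncard_pos ((F_finite B hM).subset fun _ h => h.1)).mpr ?_
  refine ⟨⟨1, 0, B, 0, M⟩, ⟨⟨1, M, rfl, one_mul M⟩, fun p hp => ?_⟩, 1, 0, 1, by simp, by simp [eval]⟩
  have : emultiplicity (p : ℤ) 1 = 0 := by
    rw [emultiplicity_eq_zero]
    intro h
    exact hp.ne_one (by simpa using Int.natAbs_dvd_natAbs.mpr h)
  simp [this]

theorem ncard_Fsol_le_ncard_Fls (B : ℤ) {M : ℤ} (hM : M ≠ 0) :
    (Fsol B M).ncard ≤ (Fls B M).ncard :=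
  Set.ncard_le_ncard (Fsol_subset_Fls B M) ((F_finite B hM).subset fun _ h => h.1)

/-- The shape of a form in `𝓕^{6εn}_{n²}`: its leading coefficient is `sD` with `D ∣ n`, and with
`n = De` the form is `sD (x⁴ + 6 ε s e x² y² + e² y⁴)`. -/
theorem exists_of_mem_F {n : ℕ} (hn : n ≠ 0) {ε : ℤ} {f : BinaryQuartic}
    (hf : f ∈ F (6 * ε * n) ((n : ℤ) ^ 2)) :
    ∃ s : ℤ, (s = 1 ∨ s = -1) ∧ ∃ D e : ℕ, D * e = n ∧
      f = ⟨s * D, 0, 6 * (ε * s) * (s * D) * e, 0, (s * D) * (e : ℤ) ^ 2⟩ := by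
  obtain ⟨⟨a, c, rfl, hac⟩, hord⟩ := hf
  have ha : a ≠ 0 := by
    rintro rfl
    simp only [zero_mul] at hac
    exact hn (by exact_mod_cast (pow_eq_zero_iff two_ne_zero).mp hac.symm)
  have hsq : Squarefree a.natAbs := by
    rw [Nat.squarefree_iff_prime_squarefree]
    intro p hp hdvd
    have h1 : (p : ℤ) ^ 2 ∣ a := by
      rw [sq, ← Int.natAbs_dvd_natAbs]
      simpa [Int.natAbs_mul] using hdvd
    have h2 : ((2 : ℕ) : ℕ∞) ≤ emultiplicity (p : ℤ) a := pow_dvd_iff_le_emultiplicity.mp h1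
    exact absurd (h2.trans (hord p hp)) (by decide)
  have hdvd : a.natAbs ∣ n := by
    refine (hsq.dvd_pow_iff_dvd two_ne_zero).mp ?_
    have : a ∣ (n : ℤ) ^ 2 := ⟨c, hac.symm⟩
    simpa [Int.natAbs_pow] using Int.natAbs_dvd_natAbs.mpr this
  obtain ⟨e, he⟩ := hdvd
  refine ⟨a.sign, ?_, a.natAbs, e, he.symm, ?_⟩
  · rcases lt_or_gt_of_ne ha with h | h
    · exact Or.inr (Int.sign_eq_neg_one_of_neg h)
    · exact Or.inl (Int.sign_eq_one_of_pos h)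
  · have hsgn : a.sign * (a.natAbs : ℤ) = a := Int.sign_mul_natAbs a
    have hs2 : a.sign * a.sign = 1 := by
      rcases lt_or_gt_of_ne ha with h | h
      · simp [Int.sign_eq_neg_one_of_neg h]
      · simp [Int.sign_eq_one_of_pos h]
    have hn' : (n : ℤ) = a.sign * a * e := by
      have h1 : a.sign * a = (a.natAbs : ℤ) := by
        nth_rewrite 2 [← hsgn]
        rw [← mul_assoc, hs2, one_mul]
      rw [h1]; exact_mod_cast he
    have hc : c = a * (e : ℤ) ^ 2 := by
      apply mul_left_cancel₀ ha
      rw [hac, hn']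
      linear_combination (a ^ 2 * (e : ℤ) ^ 2) * hs2
    rw [hsgn, hc, hn']
    congr 1
    ring

open Classical in
/-- A locally soluble form in `𝓕^{6εn}_{n²}` has leading coefficient `1` or is counted by a pair
satisfying the local conditions. -/
theorem ncard_Fls_le {n : ℕ} (hn : Squarefree n) {ε : ℤ} (hε : ε = 1 ∨ ε = -1) :
    ((Fls (6 * ε * n) ((n : ℤ) ^ 2)).ncard : ℝ) ≤ 1 + ∑ s ∈ ({1, -1} : Finset ℤ),
      ∑ q ∈ n.divisorsAntidiagonal,
        (if LocalCond s (-(ε * s)) q.1 q.2 ∧ s * (q.1 : ℤ) ≠ 1 then (1 : ℝ) else 0) := by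
  set T : Finset (ℤ × ℕ × ℕ) := (({1, -1} : Finset ℤ) ×ˢ n.divisorsAntidiagonal).filter
    (fun w => LocalCond w.1 (-(ε * w.1)) w.2.1 w.2.2 ∧ w.1 * (w.2.1 : ℤ) ≠ 1) with hT
  let g : ℤ × ℕ × ℕ → BinaryQuartic := fun w =>
    ⟨w.1 * w.2.1, 0, 6 * (ε * w.1) * (w.1 * w.2.1) * w.2.2, 0, (w.1 * w.2.1) * (w.2.2 : ℤ) ^ 2⟩
  have hsub : Fls (6 * ε * n) ((n : ℤ) ^ 2) ⊆
      ((insert ⟨1, 0, 6 * ε * n, 0, (n : ℤ) ^ 2⟩ (T.image g) : Finset BinaryQuartic) :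
        Set BinaryQuartic) := by
    rintro f ⟨hF, -, hloc⟩
    obtain ⟨s, hs, D, e, hDe, rfl⟩ := exists_of_mem_F hn.ne_zero hF
    rw [Finset.coe_insert, Set.mem_insert_iff]
    by_cases h1 : s * (D : ℤ) = 1
    · left
      obtain ⟨⟨a, c, hac, hM⟩, -⟩ := hF
      simp only [BinaryQuartic.mk.injEq] at hac
      rw [← hac.1, h1, one_mul] at hM
      ext <;> simp only
      · exact h1
      · exact hac.2.2.1
      · exact hac.2.2.2.2.trans hM
    · right
      have hκ : (ε * s) ^ 2 = 1 := by
        rcases hε with rfl | rfl <;> rcases hs with rfl | rfl <;> norm_num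
      have hcond := localCond_of_hasPoint hs hκ (hDe ▸ hn) hloc
      rw [Finset.coe_image]
      refine ⟨(s, D, e), ?_, rfl⟩
      simp only [hT, Finset.coe_filter, Finset.mem_product, Set.mem_ofPred_eq,
        Nat.mem_divisorsAntidiagonal, Finset.mem_insert, Finset.mem_singleton]
      exact ⟨⟨hs, hDe, hn.ne_zero⟩, hcond, h1⟩
  have hcard : (Fls (6 * ε * n) ((n : ℤ) ^ 2)).ncard ≤ T.card + 1 := by
    refine (Set.ncard_le_ncard hsub (Finset.finite_toSet _)).trans ?_
    rw [Set.ncard_coe_finset]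
    exact (Finset.card_insert_le _ _).trans (Nat.add_le_add_right Finset.card_image_le 1)
  have hTsum : (T.card : ℝ) = ∑ s ∈ ({1, -1} : Finset ℤ), ∑ q ∈ n.divisorsAntidiagonal,
        (if LocalCond s (-(ε * s)) q.1 q.2 ∧ s * (q.1 : ℤ) ≠ 1 then (1 : ℝ) else 0) := by
    rw [hT, Finset.card_filter, Finset.sum_product]
    push_cast
    rfl
  rw [← hTsum, add_comm]
  exact_mod_cast hcard

end BinaryQuartic

/-! ### Squarefree integers have positive lower density -/

theorem sum_inv_sq_Icc_two_le {K : ℕ} (hK : 2 ≤ K) :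
    ∑ k ∈ Finset.Icc 2 K, 1 / (k : ℝ) ^ 2 ≤ 3 / 4 - 1 / (K : ℝ) := by
  induction K, hK using Nat.le_induction with
  | base => norm_num
  | succ K hK ih =>
    rw [Finset.sum_Icc_succ_top (by lia)]
    have hK' : (2 : ℝ) ≤ K := by exact_mod_cast hK
    have : 1 / ((K : ℝ) + 1) ^ 2 ≤ 1 / K - 1 / ((K : ℝ) + 1) := by
      rw [div_sub_div _ _ (by positivity) (by positivity),
        div_le_div_iff₀ (by positivity) (by positivity)]
      nlinarith
    push_cast
    linarith

/-- At least a quarter of the integers up to `K` are squarefree. -/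
theorem div_four_le_card_squarefree (K : ℕ) :
    (K : ℝ) / 4 ≤ (((Finset.Icc 1 K).filter Squarefree).card : ℝ) := by
  have hsplit := Finset.card_filter_add_card_filter_not (s := Finset.Icc 1 K) Squarefree
  rw [Nat.card_Icc, Nat.add_sub_cancel] at hsplit
  have hnot : (((Finset.Icc 1 K).filter fun n => ¬ Squarefree n).card : ℝ) ≤ K * (3 / 4) := by
    have hsub : ((Finset.Icc 1 K).filter fun n => ¬ Squarefree n) ⊆
        (Finset.Icc 2 K).biUnion fun k => (Finset.Ioc 0 K).filter (k ^ 2 ∣ ·) := by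
      intro n hn
      rw [Finset.mem_filter, Finset.mem_Icc, Nat.squarefree_iff_prime_squarefree] at hn
      obtain ⟨⟨h1, h2⟩, h3⟩ := hn
      push Not at h3
      obtain ⟨p, hp, hpn⟩ := h3
      have hle := Nat.le_of_dvd h1 hpn
      simp only [Finset.mem_biUnion, Finset.mem_filter, Finset.mem_Icc, Finset.mem_Ioc]
      exact ⟨p, ⟨hp.two_le, by nlinarith [hp.two_le]⟩, ⟨h1, h2⟩, by rwa [sq]⟩
    have h1 : (((Finset.Icc 1 K).filter fun n => ¬ Squarefree n).card : ℝ) ≤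
        ∑ k ∈ Finset.Icc 2 K, K * (1 / (k : ℝ) ^ 2) := by
      refine (Nat.cast_le.mpr ((Finset.card_le_card hsub).trans Finset.card_biUnion_le)).trans ?_
      push_cast
      refine Finset.sum_le_sum fun k _ => ?_
      rw [Nat.Ioc_filter_dvd_card_eq_div, mul_one_div]
      exact_mod_cast Nat.cast_div_le (α := ℝ) (m := K) (n := k ^ 2)
    refine h1.trans ?_
    rw [← Finset.mul_sum]
    refine mul_le_mul_of_nonneg_left ?_ K.cast_nonneg
    rcases le_or_gt 2 K with h | h
    · have := sum_inv_sq_Icc_two_le h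
      have h0 : (0 : ℝ) ≤ 1 / (K : ℝ) := by positivity
      linarith
    · rw [Finset.Icc_eq_empty (by lia)]
      norm_num
  have : (((Finset.Icc 1 K).filter Squarefree).card : ℝ) +
      (((Finset.Icc 1 K).filter fun n => ¬ Squarefree n).card : ℝ) = K := by exact_mod_cast hsplit
  linarith

/-! ### Conclusion -/

namespace BinaryQuartic

theorem tendsto_sum_Fsol_div_sum_Fls_nat {ε : ℤ} (hε : ε = 1 ∨ ε = -1) :
    Tendsto (fun K : ℕ =>
      (∑ n ∈ (Finset.Icc 1 K).filter Squarefree,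
        ((Fsol (6 * ε * (n : ℤ)) ((n : ℤ) ^ 2)).ncard : ℝ)) /
      (∑ n ∈ (Finset.Icc 1 K).filter Squarefree,
        ((Fls (6 * ε * (n : ℤ)) ((n : ℤ) ^ 2)).ncard : ℝ))) atTop (𝓝 1) := by
  classical
  -- the number of pairs with `sD ≠ 1` that satisfy the local conditions
  let c : ℤ → ℕ → ℝ := fun s K => ∑ D ∈ Finset.Icc 1 K, ∑ e ∈ Finset.Icc 1 (K / D),
    (if LocalCond s (-(ε * s)) D e ∧ s * (D : ℤ) ≠ 1 then (1 : ℝ) else 0)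
  have hc : Tendsto (fun K : ℕ => 1 - 4 * (c 1 K / K + c (-1) K / K)) atTop (𝓝 1) := by
    have := ((tendsto_sum_localCond_div (s := 1) (Or.inl rfl) (-(ε * 1))).add
      (tendsto_sum_localCond_div (s := -1) (Or.inr rfl) (-(ε * -1)))).const_mul 4
    rw [add_zero, mul_zero] at this
    simpa only [sub_zero] using this.const_sub 1
  have hne : ∀ {K n : ℕ}, n ∈ (Finset.Icc 1 K).filter Squarefree → ((n : ℤ) ^ 2) ≠ 0 := by
    intro K n hn
    exact pow_ne_zero 2 (by exact_mod_cast (Finset.mem_filter.mp hn).2.ne_zero)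
  have hle : ∀ K : ℕ, (∑ n ∈ (Finset.Icc 1 K).filter Squarefree,
        ((Fsol (6 * ε * (n : ℤ)) ((n : ℤ) ^ 2)).ncard : ℝ)) ≤
      ∑ n ∈ (Finset.Icc 1 K).filter Squarefree,
        ((Fls (6 * ε * (n : ℤ)) ((n : ℤ) ^ 2)).ncard : ℝ) := fun K =>
    Finset.sum_le_sum fun n hn => Nat.cast_le.mpr (ncard_Fsol_le_ncard_Fls _ (hne hn))
  refine tendsto_of_tendsto_of_tendsto_of_le_of_le' hc tendsto_const_nhds ?_
    (Eventually.of_forall fun K => div_le_one_of_le₀ (hle K) (by positivity))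
  filter_upwards [eventually_ge_atTop 1] with K hK
  set M : ℝ := (((Finset.Icc 1 K).filter Squarefree).card : ℝ) with hM
  set A := ∑ n ∈ (Finset.Icc 1 K).filter Squarefree,
    ((Fsol (6 * ε * (n : ℤ)) ((n : ℤ) ^ 2)).ncard : ℝ) with hA
  set B := ∑ n ∈ (Finset.Icc 1 K).filter Squarefree,
    ((Fls (6 * ε * (n : ℤ)) ((n : ℤ) ^ 2)).ncard : ℝ) with hB
  have hK0 : (0 : ℝ) < K := by exact_mod_cast hK
  have hMK : (K : ℝ) / 4 ≤ M := div_four_le_card_squarefree K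
  have hMA : M ≤ A := by
    have : M = ∑ n ∈ (Finset.Icc 1 K).filter Squarefree, (1 : ℝ) := by simp [hM]
    rw [this]
    exact Finset.sum_le_sum fun n hn => by exact_mod_cast one_le_ncard_Fsol _ (hne hn)
  have hc0 : ∀ s, 0 ≤ c s K := fun s =>
    Finset.sum_nonneg fun D _ => Finset.sum_nonneg fun e _ => by split_ifs <;> norm_num
  have hBM : B ≤ M + (c 1 K + c (-1) K) := by
    calc B ≤ ∑ n ∈ (Finset.Icc 1 K).filter Squarefree, (1 + ∑ s ∈ ({1, -1} : Finset ℤ),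
          ∑ q ∈ n.divisorsAntidiagonal,
            (if LocalCond s (-(ε * s)) q.1 q.2 ∧ s * (q.1 : ℤ) ≠ 1 then (1 : ℝ) else 0)) :=
          Finset.sum_le_sum fun n hn => ncard_Fls_le (Finset.mem_filter.mp hn).2 hε
      _ = M + ∑ n ∈ (Finset.Icc 1 K).filter Squarefree, ∑ s ∈ ({1, -1} : Finset ℤ),
          ∑ q ∈ n.divisorsAntidiagonal,
            (if LocalCond s (-(ε * s)) q.1 q.2 ∧ s * (q.1 : ℤ) ≠ 1 then (1 : ℝ) else 0) := by
          rw [Finset.sum_add_distrib]; simp [hM]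
      _ ≤ M + ∑ n ∈ Finset.Icc 1 K, ∑ s ∈ ({1, -1} : Finset ℤ),
          ∑ q ∈ n.divisorsAntidiagonal,
            (if LocalCond s (-(ε * s)) q.1 q.2 ∧ s * (q.1 : ℤ) ≠ 1 then (1 : ℝ) else 0) := by
          refine add_le_add_right ?_ M
          refine Finset.sum_le_sum_of_subset_of_nonneg (Finset.filter_subset _ _) fun n _ _ => ?_
          refine Finset.sum_nonneg fun s _ => Finset.sum_nonneg fun q _ => ?_
          split_ifs <;> norm_num
      _ = M + (c 1 K + c (-1) K) := by
          rw [Finset.sum_comm, Finset.sum_pair (by norm_num), sum_divisorsAntidiagonal_Icc,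
            sum_divisorsAntidiagonal_Icc]
  have hMpos : 0 < M := lt_of_lt_of_le (by positivity) hMK
  have hBpos : 0 < B := hMpos.trans_le (hMA.trans (hle K))
  have hfrac : (c 1 K + c (-1) K) / B ≤ 4 * (c 1 K / K + c (-1) K / K) := by
    rw [← add_div, mul_div_assoc', div_le_div_iff₀ hBpos hK0]
    have h4 : (K : ℝ) ≤ 4 * B := by linarith [hle K]
    nlinarith [mul_le_mul_of_nonneg_left h4 (add_nonneg (hc0 1) (hc0 (-1)))]
  have hAB : 1 - (c 1 K + c (-1) K) / B ≤ A / B := by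
    rw [one_sub_div hBpos.ne']
    gcongr
    linarith
  linarith

theorem tendsto_sum_Fsol_div_sum_Fls {ε : ℤ} (hε : ε = 1 ∨ ε = -1) :
    Tendsto (fun X : ℝ =>
      (∑ n ∈ sqfreeBelow X, ((Fsol (6 * ε * (n : ℤ)) ((n : ℤ) ^ 2)).ncard : ℝ)) /
      (∑ n ∈ sqfreeBelow X, ((Fls (6 * ε * (n : ℤ)) ((n : ℤ) ^ 2)).ncard : ℝ))) atTop (𝓝 1) := by
  have h := (tendsto_sum_Fsol_div_sum_Fls_nat hε).comp
    ((tendsto_sub_atTop_nat 1).comp (tendsto_nat_ceil_atTop (α := ℝ)))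
  have hset : ∀ X : ℝ, sqfreeBelow X = (Finset.Icc 1 (⌈X⌉₊ - 1)).filter Squarefree := by
    intro X
    ext n
    simp only [sqfreeBelow, Finset.mem_filter, Finset.mem_range, Finset.mem_Icc]
    constructor <;> rintro ⟨h1, h2⟩
    · exact ⟨by lia, h2.2⟩
    · exact ⟨by lia, by lia, h2⟩
  simpa only [Function.comp_def, hset] using h

end BinaryQuartic

theorem theorem4p3 :
    Tendsto (fun X : ℝ =>
        (∑ n ∈ sqfreeBelow X, ((BinaryQuartic.Fsol (6 * (n : ℤ)) ((n : ℤ) ^ 2)).ncard : ℝ)) /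
          (∑ n ∈ sqfreeBelow X, ((BinaryQuartic.Fls (6 * (n : ℤ)) ((n : ℤ) ^ 2)).ncard : ℝ)))
      atTop (𝓝 1) ∧
    Tendsto (fun X : ℝ =>
        (∑ n ∈ sqfreeBelow X, ((BinaryQuartic.Fsol (-6 * (n : ℤ)) ((n : ℤ) ^ 2)).ncard : ℝ)) /
          (∑ n ∈ sqfreeBelow X, ((BinaryQuartic.Fls (-6 * (n : ℤ)) ((n : ℤ) ^ 2)).ncard : ℝ)))
      atTop (𝓝 1) := by
  have h1 := BinaryQuartic.tendsto_sum_Fsol_div_sum_Fls (ε := 1) (Or.inl rfl)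
  have h2 := BinaryQuartic.tendsto_sum_Fsol_div_sum_Fls (ε := -1) (Or.inr rfl)
  rw [show (6 : ℤ) * 1 = 6 from rfl] at h1
  rw [show (6 : ℤ) * -1 = -6 from rfl] at h2
  exact ⟨h1, h2⟩
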